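/- An instance of Page-Laminar Paging consists of $k\ge 1$ cache slots, a finite laminar family $\mathcal P$ of nonempty finite sets of pages (any two members of $\mathcal P$ are disjoint or nested), and a sequence $\pi=(P_1,\dots,P_T)$ of requests $P_t\in\mathcal P$. A cache configuration assigns to each slot at most one page. A solution is a sequence $C_1,\dots,C_T$ of configurations such that, for each $t$, $C_t$ assigns some page of $P_t$ to some slot. Its cost is the number of retrievals, that is, of triples $(t,s,p)$ such that $C_t$ assigns page $p$ to slot $s$ and either $t=1$ or $C_{t-1}$ does not assign $p$ to $s$. Let $\mathrm{opt}(I)$ be the minimum cost of a solution of the instance $I$. Let $h$ be the height of $\mathcal P$, that is, the largest $h$ such that $\mathcal P$ contains $h$ strictly nested sets $R_1\subsetneq\dots\subsetneq R_h$, and let $H_k=\sum_{i=1}^k 1/i$. An online algorithm knows $k$ and $\mathcal P$ in advance, receives the requests one at a time, and must choose $C_t$ before it sees $P_{t+1}$. It is $c$-competitive (where $c$ may depend on $k$ and $h$) if there is a constant $b$, independent of the instance, such that on every instance $I$ it produces a solution and its (expected, if it is randomized) cost is at most $c\cdot\mathrm{opt}(I)+b$. An offline algorithm is given the whole instance; it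 is a $c$-approximation algorithm if on every instance it produces a solution of cost at most $c\cdot\mathrm{opt}(I)$. Theorem. Page-Laminar Paging admits the following polynomial-time algorithms: an $hk$-competitive deterministic online algorithm, an $hH_k$-competitive randomized online algorithm, and a deterministic offline $h$-approximation algorithm. Here the input lists the $k$ slots, the sets in $\mathcal P$ and the requests explicitly; an online algorithm is polynomial-time if the time it spends on preparation and on each request is bounded by a polynomial in the size of the input up to that point; and a randomized algorithm may draw uniformly random integers from $\{0,\dots,n\}$ for any $n$ that it has computed. -/

import Mathlib

open scoped ENNReal NNReal

noncomputable section

namespace LaminarPaging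

/-! ## Page-Subset Paging and Page-Laminar Paging -/

/-- A cache configuration with `k` slots: each slot is empty or holds one page.
Pages are named by natural numbers. -/
abbrev Cache (k : ℕ) : Type := Fin k → Option ℕ

/-- The configuration in which every slot is empty. -/
def Cache.empty (k : ℕ) : Cache k := fun _ => none

/-- A request `R` (a set of pages) is satisfied if some page of `R` is in some slot. -/
def Cache.Satisfies {k : ℕ} (C : Cache k) (R : Finset ℕ) : Prop :=
  ∃ p ∈ R, ∃ s : Fin k, C s = some p

/-- The number of retrievals when moving from `C` to `C'`: slots to which `C'` assigns a page
that `C` does not assign to that slot. -/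
def Cache.retrievals {k : ℕ} (C C' : Cache k) : ℕ :=
  Set.ncard {s : Fin k | ∃ p : ℕ, C' s = some p ∧ C s ≠ some p}

/-- The number of retrievals of a sequence of configurations that is preceded by `C`. -/
def Cache.costFrom {k : ℕ} : Cache k → List (Cache k) → ℕ
  | _, [] => 0
  | C, C' :: rest => Cache.retrievals C C' + Cache.costFrom C' rest

/-- An instance of Page-Subset Paging: `k ≥ 1` slots, a finite family of requestable nonempty
finite sets of pages (given by a listing), and a sequence of requests from the family. -/
structure PagingInput where
  k : ℕ
  k_pos : 0 < k
  family : List (Finset ℕ)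
  nonempty_of_mem : ∀ R ∈ family, R.Nonempty
  requests : List (Finset ℕ)
  requests_mem : ∀ R ∈ requests, R ∈ family

/-- A family of sets is laminar if any two of its members are disjoint or nested. -/
def IsLaminar (P : List (Finset ℕ)) : Prop :=
  ∀ R ∈ P, ∀ R' ∈ P, Disjoint R R' ∨ R ⊆ R' ∨ R' ⊆ R

/-- The height of a family: the largest `n` such that the family contains `n` strictly nested
sets `R 0 ⊂ R 1 ⊂ ⋯ ⊂ R (n - 1)`. -/
def height (P : List (Finset ℕ)) : ℕ :=
  sSup {n : ℕ | ∃ R : Fin n → Finset ℕ, StrictMono R ∧ ∀ i, R i ∈ P}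

namespace PagingInput

/-- A solution has one configuration for each request, and it satisfies that request. -/
def IsSolution (I : PagingInput) (C : List (Cache I.k)) : Prop :=
  List.Forall₂ (fun c R => Cache.Satisfies c R) C I.requests

/-- The cost of a sequence of configurations; before the first one the cache is empty, so at the
first step every page in the cache counts as retrieved. -/
def cost (I : PagingInput) (C : List (Cache I.k)) : ℕ :=
  Cache.costFrom (Cache.empty I.k) C

/-- The optimum cost. (Solutions exist, since `k ≥ 1` and the requested sets are nonempty.) -/
def opt (I : PagingInput) : ℕ :=
  sInf {c : ℕ | ∃ C, I.IsSolution C ∧ I.cost C = c}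

end PagingInput

/-! ## Programs and their running time

A program works on registers that hold finite binary trees with natural numbers at the leaves.
Every operation is charged its number of steps plus the bit sizes of its operands and of its
result, so that running times agree with those of Turing machines up to a polynomial. -/

inductive Val : Type
  | num : ℕ → Val
  | pair : Val → Val → Val
  deriving DecidableEq

namespace Val

/-- The size in bits (with one extra unit for each node of the tree). -/
def size : Val → ℕ
  | num n => Nat.size n + 1
  | pair a b => size a + size b + 1

def toNat : Val → ℕ
  | num n => n
  | pair _ _ => 0

def fst : Val → Val
  | num _ => num 0
  | pair a _ => a

def snd : Val → Val
  | num _ => num 0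
  | pair _ b => b

def ofBool (b : Bool) : Val := num b.toNat

def isPair : Val → Bool
  | num _ => false
  | pair _ _ => true

/-- Lists are stored as right-nested pairs that end in a number. -/
def toList : Val → List Val
  | num _ => []
  | pair a b => a :: toList b

def ofList (l : List Val) : Val := l.foldr pair (num 0)

/-- A set of pages is stored as the increasing list of its pages. -/
def ofPages (R : Finset ℕ) : Val := ofList ((R.sort (· ≤ ·)).map num)

def ofFamily (l : List (Finset ℕ)) : Val := ofList (l.map ofPages)

/-- The slots are stored as the explicit list `0, 1, …, k - 1`. -/
def ofSlots (k : ℕ) : Val := ofList ((List.range k).map num)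

/-- Reading a configuration: the `i`-th entry of the list describes slot `i`, where `n + 1` stands
for page `n`; anything else (in particular `0`, or a missing entry) stands for an empty slot. -/
def toCache (k : ℕ) (v : Val) : Cache k := fun i =>
  match v.toList[i.val]? with
  | some (num (n + 1)) => some n
  | _ => none

def toCaches (k : ℕ) (v : Val) : List (Cache k) := v.toList.map (toCache k)

end Val

/-- What is known before the first request: the slots and the family. -/
def PagingInput.encodeStatic (I : PagingInput) : Val :=
  Val.pair (Val.ofSlots I.k) (Val.ofFamily I.family)

/-- The whole input. -/
def PagingInput.encode (I : PagingInput) : Val :=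
  Val.pair I.encodeStatic (Val.ofFamily I.requests)

/-- The size of an input. -/
def PagingInput.size (I : PagingInput) : ℕ := I.encode.size

/-- The contents of the registers. -/
abbrev Store : Type := ℕ → Val

inductive Exp : Type
  | reg : ℕ → Exp
  | const : ℕ → Exp
  | pair : Exp → Exp → Exp
  | fst : Exp → Exp
  | snd : Exp → Exp
  | isPair : Exp → Exp
  | add : Exp → Exp → Exp
  | sub : Exp → Exp → Exp
  | mul : Exp → Exp → Exp
  | div : Exp → Exp → Exp
  | lt : Exp → Exp → Exp
  | eq : Exp → Exp → Exp

namespace Exp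

/-- The value of an expression. Truth values are the numbers `1` and `0`. -/
def eval (s : Store) : Exp → Val
  | reg i => s i
  | const n => Val.num n
  | pair a b => Val.pair (a.eval s) (b.eval s)
  | fst a => (a.eval s).fst
  | snd a => (a.eval s).snd
  | isPair a => Val.ofBool (a.eval s).isPair
  | add a b => Val.num ((a.eval s).toNat + (b.eval s).toNat)
  | sub a b => Val.num ((a.eval s).toNat - (b.eval s).toNat)
  | mul a b => Val.num ((a.eval s).toNat * (b.eval s).toNat)
  | div a b => Val.num ((a.eval s).toNat / (b.eval s).toNat)
  | lt a b => Val.ofBool (decide ((a.eval s).toNat < (b.eval s).toNat))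
  | eq a b => Val.ofBool (decide (a.eval s = b.eval s))

/-- The time to evaluate an expression: each node is charged one unit plus the size of its value. -/
def time (s : Store) : Exp → ℕ
  | reg i => 1 + (s i).size
  | const n => 1 + (Val.num n).size
  | pair a b => a.time s + b.time s + 1 + ((pair a b).eval s).size
  | fst a => a.time s + 1 + ((fst a).eval s).size
  | snd a => a.time s + 1 + ((snd a).eval s).size
  | isPair a => a.time s + 1 + ((isPair a).eval s).size
  | add a b => a.time s + b.time s + 1 + ((add a b).eval s).size
  | sub a b => a.time s + b.time s + 1 + ((sub a b).eval s).size
  | mul a b => a.time s + b.time s + 1 + ((mul a b).eval s).size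
  | div a b => a.time s + b.time s + 1 + ((div a b).eval s).size
  | lt a b => a.time s + b.time s + 1 + ((lt a b).eval s).size
  | eq a b => a.time s + b.time s + 1 + ((eq a b).eval s).size

/-- A test succeeds if its value is not the number `0`. -/
def test (s : Store) (e : Exp) : Bool := decide (e.eval s ≠ Val.num 0)

end Exp

/-- Programs. `draw i e` puts a uniformly random element of `{0, 1, …, n}` into register `i`, where
`n` is the value of `e`. -/
inductive Com : Type
  | skip : Com
  | assign : ℕ → Exp → Com
  | draw : ℕ → Exp → Com
  | seq : Com → Com → Com
  | ite : Exp → Com → Com → Com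
  | loop : Exp → Com → Com

/-- A program is deterministic if it makes no random draw. -/
def Com.Deterministic : Com → Prop
  | skip => True
  | assign _ _ => True
  | draw _ _ => False
  | seq a b => a.Deterministic ∧ b.Deterministic
  | ite _ a b => a.Deterministic ∧ b.Deterministic
  | loop _ a => a.Deterministic

/-- A state of a computation: the commands that are still to be executed, the contents of the
registers, and the time used so far. -/
structure Machine where
  todo : List Com
  store : Store
  time : ℕ

/-- One step of a computation; the next state is random. A state with nothing left to do has
halted. -/
def Machine.step (m : Machine) : PMF Machine :=
  match m.todo with
  | [] => PMF.pure m
  | Com.skip :: K => PMF.pure ⟨K, m.store, m.time + 1⟩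
  | Com.assign i e :: K =>
      PMF.pure ⟨K, Function.update m.store i (e.eval m.store), m.time + 1 + e.time m.store⟩
  | Com.draw i e :: K =>
      (PMF.uniformOfFintype (Fin ((e.eval m.store).toNat + 1))).map fun r =>
        ⟨K, Function.update m.store i (Val.num r), m.time + 1 + e.time m.store⟩
  | Com.seq a b :: K => PMF.pure ⟨a :: b :: K, m.store, m.time + 1⟩
  | Com.ite e a b :: K =>
      PMF.pure ⟨(if e.test m.store then a else b) :: K, m.store, m.time + 1 + e.time m.store⟩
  | Com.loop e a :: K =>
      PMF.pure ⟨if e.test m.store then a :: Com.loop e a :: K else K, m.store,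
        m.time + 1 + e.time m.store⟩

/-- The state after `n` steps. -/
def Machine.steps : ℕ → Machine → PMF Machine
  | 0, m => PMF.pure m
  | n + 1, m => m.step.bind (Machine.steps n)

/-- The contents of the registers when `c`, started on `s`, halts; `none` if `c` does not halt
within time `N`. (Each step takes at least one unit of time, so `N` steps are enough to see.) -/
def Com.run (c : Com) (N : ℕ) (s : Store) : PMF (Option Store) :=
  (Machine.steps N ⟨[c], s, 0⟩).map fun m =>
    if m.todo.isEmpty ∧ m.time ≤ N then some m.store else none

/-- The registers with `v` in register `0` and the number `0` everywhere else. -/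
def Store.init (v : Val) : Store := Function.update (fun _ => Val.num 0) 0 v

/-! ## Offline algorithms -/

/-- The program `c`, given the whole input in register `0`, must leave in register `1` a list of
configurations. The result is `none` if it does not halt within time `N`. -/
def runOffline (c : Com) (I : PagingInput) (N : ℕ) : PMF (Option (List (Cache I.k))) :=
  (c.run N (Store.init I.encode)).map (Option.map fun s => Val.toCaches I.k (s 1))

/-- `c` is a deterministic polynomial-time `ratio`-approximation algorithm for Page-Laminar Paging
(with no additive constant). -/
def IsOfflineApprox (c : Com) (ratio : PagingInput → ℝ≥0) : Prop :=
  c.Deterministic ∧ ∃ p : Polynomial ℕ, ∀ I : PagingInput, IsLaminar I.family →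
    ∀ o ∈ (runOffline c I (p.eval I.size)).support,
      ∃ C, o = some C ∧ I.IsSolution C ∧ (I.cost C : ℝ≥0) ≤ ratio I * I.opt

/-! ## Online algorithms -/

/-- An online algorithm consists of a program `prepare` that is run once, with the slots and the
family in register `0`, and a program `serve` that is run once for each request, with that request
in register `0`. All other registers keep their contents from one run to the next. After each run
of `serve`, register `1` must hold the current configuration. -/
structure OnlineAlgorithm where
  prepare : Com
  serve : Com

namespace OnlineAlgorithm

def Deterministic (A : OnlineAlgorithm) : Prop :=
  A.prepare.Deterministic ∧ A.serve.Deterministic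

/-- Serving a sequence of requests one by one, starting with registers `s`: the random sequence
of configurations, or `none` if some run does not halt within time `N`. -/
def serveAll (A : OnlineAlgorithm) (k N : ℕ) :
    List (Finset ℕ) → Store → PMF (Option (List (Cache k)))
  | [], _ => PMF.pure (some [])
  | R :: rest, s =>
      (A.serve.run N (Function.update s 0 (Val.ofPages R))).bind fun o =>
        match o with
        | none => PMF.pure none
        | some s' =>
            (serveAll A k N rest s').map (Option.map fun C => Val.toCache k (s' 1) :: C)

/-- The random sequence of configurations of `A` on `I`, or `none` if some run of `prepare` or
`serve` does not halt within time `N`. -/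
def run (A : OnlineAlgorithm) (I : PagingInput) (N : ℕ) : PMF (Option (List (Cache I.k))) :=
  (A.prepare.run N (Store.init I.encodeStatic)).bind fun o =>
    match o with
    | none => PMF.pure none
    | some s => A.serveAll I.k N I.requests s

/-- `A` is a polynomial-time `ratio`-competitive (possibly randomized) online algorithm for
Page-Laminar Paging: for one polynomial `p` and one constant `b`, on every input it surely takes
time at most `p(size)` for each request and produces a solution, and its expected cost is at most
`ratio * opt + b`. As every initial part of an input is again an input, the time for a request is
thus polynomial in the size of the input up to that request. -/
def IsCompetitive (A : OnlineAlgorithm) (ratio : PagingInput → ℝ≥0) : Prop :=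
  ∃ (p : Polynomial ℕ) (b : ℝ≥0), ∀ I : PagingInput, IsLaminar I.family →
    (∀ o ∈ (A.run I (p.eval I.size)).support, ∃ C, o = some C ∧ I.IsSolution C) ∧
    ∑' o : Option (List (Cache I.k)),
        A.run I (p.eval I.size) o * (o.elim ⊤ fun C => (I.cost C : ℝ≥0∞)) ≤
      ((ratio I * I.opt + b : ℝ≥0) : ℝ≥0∞)

end OnlineAlgorithm

end LaminarPaging

end

noncomputable section

namespace LaminarPaging

/-! ## Total correctness of programs with time bounds -/

/-! The laminar instance is turned, online, into an ordinary paging instance. Every set of the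
family is represented by one of its pages, at first its smallest one. A request for `P` becomes a
request for its representative `p P`, and from then on this page also represents every superset of
`P` (`redirect`, `pageSeq`). As `p P` lies in `P`, serving the derived requests serves the original
ones at the same cost. What has to be shown is the converse estimate: the derived instance has a
solution of cost at most `h` times the laminar optimum (`PagingInput.exists_serves`).

For this, a laminar solution with pages `C` is followed by a set `D` of pages subject to
`Simulates`: `D` consists of representatives of sets hit by `C`; it is closed under passing to
representatives of supersets; and, as in Hall's condition, hit sets inside a hit set `R` account for
at most `|C ∩ R|` pages of `D`. Applied to the maximal hit sets, the last condition gives `|D| ≤ |C|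
≤ k`. The cost is controlled by the potential `|p(hit sets) \ D| + |C| - #(hit roots)`. A retrieval
raises it by at most `h`, because the newly hit sets all contain the retrieved page and so form a
chain (`Simulates.retrieve`). An eviction does not raise it (`Simulates.evict`), and a request pays
for the page it brings into `D` by lowering it (`Simulates.request`). It vanishes for the empty
cache and is never negative.

It remains to run three paging algorithms on the derived sequence. Emptying a full cache on a miss
is `k`-competitive (`flushCost_le`). Evicting the page whose next request is farthest away is
optimal offline (`beladyCost_le`). A version of the partition algorithm of McGeoch and Sleator is
`H_k`-competitive (`Stages.expCost_le`). The latter keeps a history of stages, in each of which some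
pages join a pool and one uniformly random page leaves it. When a page of the history is requested,
the stored evictions are rerouted so that they become uniform evictions from the pools without that
page, while the actual cache changes in at most one slot (`sampleAvg_condition`,
`rerouteSpec_map_del`). The chance that the page was missing is paid by a potential of harmonic
tails (`sampleAvg_memCost_le`), and the number of requests outside the history is a lower bound for
the cost of every solution (`Stages.Lower`).

Running times come from a calculus of polynomial-time functions (`PolyTime`), closed under
composition, pairing, case distinction and folds with polynomially bounded accumulators. Each such
function is compiled to a program. A loop of random draws followed by such a program realises one
step of a paging algorithm (`Implements`), and the distribution of the program's runs is that of the
abstract algorithm (`Analysis.exists_serveAll_eq`). -/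

/-- The uniform distribution on `{0, 1, …, n}`. -/
def uniformNat (n : ℕ) : PMF ℕ := (PMF.uniformOfFintype (Fin (n + 1))).map Fin.val

theorem bind_congr_support {α β : Type*} {μ : PMF α} {f g : α → PMF β}
    (h : ∀ a ∈ μ.support, f a = g a) : μ.bind f = μ.bind g := by
  ext b
  simp only [PMF.bind_apply]
  refine tsum_congr fun a => ?_
  by_cases ha : a ∈ μ.support
  · rw [h a ha]
  · rw [(PMF.apply_eq_zero_iff _ _).2 ha, zero_mul, zero_mul]

/-- The outcome, with time limit `N`, of `n` steps from the given state. -/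
def outcome (K : List Com) (s : Store) (t n N : ℕ) : PMF (Option Store) :=
  (Machine.steps n ⟨K, s, t⟩).map fun m =>
    if m.todo.isEmpty ∧ m.time ≤ N then some m.store else none

theorem outcome_succ (K : List Com) (s : Store) (t n N : ℕ) :
    outcome K s t (n + 1) N =
      (Machine.step ⟨K, s, t⟩).bind fun m => outcome m.todo m.store m.time n N := by
  simp only [outcome, Machine.steps, PMF.map_bind]

/-- Started on `s`, the program `c` halts within time `T`, and the distribution of the resulting
registers is `μ`. -/
def Com.Spec (c : Com) (s : Store) (T : ℕ) (μ : PMF Store) : Prop :=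
  ∀ (K : List Com) (t n N : ℕ) (f : Store → PMF (Option Store)), T ≤ n →
    (∀ s' ∈ μ.support, ∀ t' n', t' ≤ t + T → n ≤ n' + T → outcome K s' t' n' N = f s') →
    outcome (c :: K) s t n N = μ.bind f

/-- Started on `s`, the program `c` halts within time `T` and surely leaves `s'`. -/
def Com.Det (c : Com) (s : Store) (s' : Store) (T : ℕ) : Prop := c.Spec s T (PMF.pure s')

namespace Com

/-- The clock and the remaining steps enter the continuation only through one-sided bounds, so a
larger `T` asks more of the continuation and is a weaker claim about `c`. -/
theorem Spec.mono {c : Com} {s : Store} {T T' : ℕ} {μ : PMF Store} (h : c.Spec s T μ)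
    (hT : T ≤ T') : c.Spec s T' μ := fun K t n N f hn H =>
  h K t n N f (hT.trans hn) fun s' hs' t' n' h1 h2 => H s' hs' t' n' (by omega) (by omega)

theorem outcome_nil (s : Store) (t n N : ℕ) :
    outcome [] s t n N = PMF.pure (if t ≤ N then some s else none) := by
  induction n with
  | zero => simp [outcome, Machine.steps, PMF.pure_map]
  | succ n ih => rw [outcome_succ]; simpa [Machine.step, PMF.pure_bind] using ih

/-- Take the empty continuation and start the clock at `0`. A halted machine stays as it is, so only
the final time matters, and it is at most `T ≤ N`. -/
theorem Spec.run_eq {c : Com} {s : Store} {T N : ℕ} {μ : PMF Store} (h : c.Spec s T μ)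
    (hN : T ≤ N) : c.run N s = μ.map some := by
  have := h [] 0 N N (fun s' => PMF.pure (some s')) hN fun s' _ t' n' h1 _ => by
    rw [outcome_nil, if_pos (by omega)]
  exact this

theorem spec_assign (i : ℕ) (e : Exp) (s : Store) :
    (assign i e).Det s (Function.update s i (e.eval s)) (1 + e.time s) := by
  intro K t n N f hn H
  obtain ⟨n, rfl⟩ : ∃ m, n = m + 1 := ⟨n - 1, by omega⟩
  rw [outcome_succ]
  simp only [Machine.step, PMF.pure_bind]
  exact H _ (by simp) _ _ (by omega) (by omega)

theorem spec_draw (i : ℕ) (e : Exp) (s : Store) :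
    (draw i e).Spec s (1 + e.time s)
      ((uniformNat (e.eval s).toNat).map fun r => Function.update s i (Val.num r)) := by
  intro K t n N f hn H
  obtain ⟨n, rfl⟩ : ∃ m, n = m + 1 := ⟨n - 1, by omega⟩
  rw [outcome_succ]
  change (PMF.map _ (uniformNat (e.eval s).toNat)).bind _ = _
  simp only [PMF.bind_map]
  refine bind_congr_support fun r hr => ?_
  simp only [Function.comp]
  refine H _ ?_ _ _ (by omega) (by omega)
  rw [PMF.support_map]
  exact ⟨r, hr, rfl⟩

/-- The specification of `a` is applied with `b` pushed onto the continuation; this is what the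
quantification over `K` is for. The extra unit is the step that unfolds `seq`. -/
theorem Spec.seq {a b : Com} {s : Store} {T₁ T₂ : ℕ} {μ : PMF Store} {ν : Store → PMF Store}
    (ha : a.Spec s T₁ μ) (hb : ∀ s' ∈ μ.support, b.Spec s' T₂ (ν s')) :
    (Com.seq a b).Spec s (T₁ + T₂ + 1) (μ.bind ν) := by
  intro K t n N f hn H
  obtain ⟨n, rfl⟩ : ∃ m, n = m + 1 := ⟨n - 1, by omega⟩
  rw [outcome_succ]
  simp only [Machine.step, PMF.pure_bind, PMF.bind_bind]
  refine ha _ _ _ _ _ (by omega) fun s' hs' t' n' h1 h2 => ?_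
  refine hb s' hs' _ _ _ _ _ (by omega) fun s'' hs'' t'' n'' h3 h4 => ?_
  exact H s'' ((PMF.mem_support_bind_iff _ _ _).2 ⟨s', hs', hs''⟩) _ _ (by omega) (by omega)

theorem Spec.ite {e : Exp} {a b : Com} {s : Store} {T : ℕ} {μ : PMF Store}
    (h : (if e.test s then a else b).Spec s T μ) :
    (Com.ite e a b).Spec s (1 + e.time s + T) μ := by
  intro K t n N f hn H
  obtain ⟨n, rfl⟩ : ∃ m, n = m + 1 := ⟨n - 1, by omega⟩
  rw [outcome_succ]
  simp only [Machine.step, PMF.pure_bind]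
  exact h _ _ _ _ _ (by omega) fun s' hs' t' n' h1 h2 => H s' hs' t' n' (by omega) (by omega)

theorem spec_loop_false {e : Exp} {a : Com} {s : Store} (h : e.test s = false) :
    (Com.loop e a).Det s s (1 + e.time s) := by
  intro K t n N f hn H
  obtain ⟨n, rfl⟩ : ∃ m, n = m + 1 := ⟨n - 1, by omega⟩
  rw [outcome_succ]
  simp only [Machine.step, PMF.pure_bind, h]
  exact H _ (by simp) _ _ (by omega) (by omega)

theorem Spec.loop {e : Exp} {a : Com} {s : Store} {T₁ T₂ : ℕ} {μ : PMF Store}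
    {ν : Store → PMF Store} (h : e.test s = true) (ha : a.Spec s T₁ μ)
    (hb : ∀ s' ∈ μ.support, (Com.loop e a).Spec s' T₂ (ν s')) :
    (Com.loop e a).Spec s (1 + e.time s + T₁ + T₂) (μ.bind ν) := by
  intro K t n N f hn H
  obtain ⟨n, rfl⟩ : ∃ m, n = m + 1 := ⟨n - 1, by omega⟩
  rw [outcome_succ]
  simp only [Machine.step, PMF.pure_bind, PMF.bind_bind, h, if_true]
  refine ha _ _ _ _ _ (by omega) fun s' hs' t' n' h1 h2 => ?_
  refine hb s' hs' _ _ _ _ _ (by omega) fun s'' hs'' t'' n'' h3 h4 => ?_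
  exact H s'' ((PMF.mem_support_bind_iff _ _ _).2 ⟨s', hs', hs''⟩) _ _ (by omega) (by omega)

theorem Det.seq {a b : Com} {s s' s'' : Store} {T₁ T₂ : ℕ} (ha : a.Det s s' T₁)
    (hb : b.Det s' s'' T₂) : (Com.seq a b).Det s s'' (T₁ + T₂ + 1) := by
  have := Spec.seq (ν := fun _ => PMF.pure s'') ha fun t ht => by
    obtain rfl : t = s' := by simpa using ht
    exact hb
  simpa [Det, PMF.pure_bind] using this

theorem Det.loop {e : Exp} {a : Com} {s s' s'' : Store} {T₁ T₂ : ℕ} (h : e.test s = true)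
    (ha : a.Det s s' T₁) (hb : (Com.loop e a).Det s' s'' T₂) :
    (Com.loop e a).Det s s'' (1 + e.time s + T₁ + T₂) := by
  have := Spec.loop (ν := fun _ => PMF.pure s'') h ha fun t ht => by
    obtain rfl : t = s' := by simpa using ht
    exact hb
  simpa [Det, PMF.pure_bind] using this

theorem Det.mono {c : Com} {s s' : Store} {T T' : ℕ} (h : c.Det s s' T) (hT : T ≤ T') :
    c.Det s s' T' := Spec.mono h hT

theorem Det.ite {e : Exp} {a b : Com} {s s' : Store} {T : ℕ}
    (h : (if e.test s then a else b).Det s s' T) :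
    (Com.ite e a b).Det s s' (1 + e.time s + T) := Spec.ite h

end Com

/-! ## Sizes -/

theorem Val.size_pos (v : Val) : 0 < v.size := by cases v <;> simp [Val.size]

theorem Val.size_fst_le (v : Val) : v.fst.size ≤ v.size := by
  cases v <;> simp [Val.size, Val.fst]; omega

theorem Val.size_snd_le (v : Val) : v.snd.size ≤ v.size := by
  cases v <;> simp [Val.size, Val.snd]; omega

theorem Val.size_toNat_le (v : Val) : Nat.size v.toNat + 1 ≤ v.size := by
  cases v with
  | num n => simp [Val.size, Val.toNat]
  | pair a b => simp [Val.size, Val.toNat]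

theorem Val.size_ofBool_le (b : Bool) : (Val.ofBool b).size ≤ 2 := by
  cases b <;> simp [Val.size, Val.ofBool]

theorem natSize_add_le (a b : ℕ) : Nat.size (a + b) ≤ Nat.size a + Nat.size b + 1 := by
  rw [Nat.size_le]
  have ha := Nat.lt_size_self a
  have hb := Nat.lt_size_self b
  have h1 : 2 ^ Nat.size a ≤ 2 ^ (Nat.size a + Nat.size b) :=
    Nat.pow_le_pow_right (by norm_num) (by omega)
  have h2 : 2 ^ Nat.size b ≤ 2 ^ (Nat.size a + Nat.size b) :=
    Nat.pow_le_pow_right (by norm_num) (by omega)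
  rw [pow_succ]
  omega

theorem natSize_mul_le (a b : ℕ) : Nat.size (a * b) ≤ Nat.size a + Nat.size b := by
  rw [Nat.size_le, pow_add]
  exact Nat.mul_lt_mul'' (Nat.lt_size_self a) (Nat.lt_size_self b)

theorem polyEval_mono (p : Polynomial ℕ) {m n : ℕ} (h : m ≤ n) : p.eval m ≤ p.eval n := by
  induction p using Polynomial.induction_on' with
  | add p q hp hq => simpa using add_le_add hp hq
  | monomial i a => simpa using Nat.mul_le_mul_left a (Nat.pow_le_pow_left h i)

/-- The registers that an expression reads. -/
def Exp.regs : Exp → List ℕ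
  | reg i => [i]
  | const _ => []
  | pair a b => a.regs ++ b.regs
  | fst a => a.regs
  | snd a => a.regs
  | isPair a => a.regs
  | add a b => a.regs ++ b.regs
  | sub a b => a.regs ++ b.regs
  | mul a b => a.regs ++ b.regs
  | div a b => a.regs ++ b.regs
  | lt a b => a.regs ++ b.regs
  | eq a b => a.regs ++ b.regs

/-- Each operation yields a value no larger than its operands together plus one, and its time is
that of the operands plus the size of the value. Hence bounds `p`, `q` for the operands give `2 * p
+ 2 * q + 2`. -/
theorem Exp.exists_bound (e : Exp) : ∃ p : Polynomial ℕ, ∀ (s : Store) (n : ℕ),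
    (∀ i ∈ e.regs, (s i).size ≤ n) → e.time s ≤ p.eval n ∧ (e.eval s).size ≤ p.eval n := by
  have key2 : ∀ (a b : Exp) (p q : Polynomial ℕ) (f : Exp → Exp → Exp),
      (∀ (s : Store) (n : ℕ), (∀ i ∈ a.regs, (s i).size ≤ n) →
        a.time s ≤ p.eval n ∧ (a.eval s).size ≤ p.eval n) →
      (∀ (s : Store) (n : ℕ), (∀ i ∈ b.regs, (s i).size ≤ n) →
        b.time s ≤ q.eval n ∧ (b.eval s).size ≤ q.eval n) →
      (f a b).regs = a.regs ++ b.regs →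
      (∀ s, (f a b).time s = a.time s + b.time s + 1 + ((f a b).eval s).size) →
      (∀ s, ((f a b).eval s).size ≤ (a.eval s).size + (b.eval s).size + 1) →
      ∃ p : Polynomial ℕ, ∀ (s : Store) (n : ℕ), (∀ i ∈ (f a b).regs, (s i).size ≤ n) →
        (f a b).time s ≤ p.eval n ∧ ((f a b).eval s).size ≤ p.eval n := by
    intro a b p q f hp hq hr ht hs
    refine ⟨2 * p + 2 * q + 2, fun s n h => ?_⟩
    rw [hr] at h
    obtain ⟨h1, h2⟩ := hp s n fun i hi => h i (by simp [hi])
    obtain ⟨h3, h4⟩ := hq s n fun i hi => h i (by simp [hi])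
    have h5 := hs s
    rw [ht]
    simp only [Polynomial.eval_add, Polynomial.eval_mul, Polynomial.eval_ofNat]
    omega
  have key1 : ∀ (a : Exp) (p : Polynomial ℕ) (f : Exp → Exp),
      (∀ (s : Store) (n : ℕ), (∀ i ∈ a.regs, (s i).size ≤ n) →
        a.time s ≤ p.eval n ∧ (a.eval s).size ≤ p.eval n) →
      (f a).regs = a.regs →
      (∀ s, (f a).time s = a.time s + 1 + ((f a).eval s).size) →
      (∀ s, ((f a).eval s).size ≤ (a.eval s).size + 1) →
      ∃ p : Polynomial ℕ, ∀ (s : Store) (n : ℕ), (∀ i ∈ (f a).regs, (s i).size ≤ n) →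
        (f a).time s ≤ p.eval n ∧ ((f a).eval s).size ≤ p.eval n := by
    intro a p f hp hr ht hs
    refine ⟨2 * p + 2, fun s n h => ?_⟩
    rw [hr] at h
    obtain ⟨h1, h2⟩ := hp s n h
    have h5 := hs s
    rw [ht]
    simp only [Polynomial.eval_add, Polynomial.eval_mul, Polynomial.eval_ofNat]
    omega
  have sz : ∀ n : ℕ, (Val.num n).size = Nat.size n + 1 := fun _ => rfl
  induction e with
  | reg i =>
    refine ⟨Polynomial.X + 1, fun s n h => ?_⟩
    have := h i (by simp [regs])
    simp [time, eval]; omega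
  | const m =>
    refine ⟨Polynomial.C (Nat.size m + 2), fun s n _ => ?_⟩
    simp [time, eval, Val.size]; omega
  | pair a b ha hb =>
    obtain ⟨p, hp⟩ := ha
    obtain ⟨q, hq⟩ := hb
    exact key2 a b p q pair hp hq rfl (fun _ => rfl) fun s => by simp [eval, Val.size]
  | fst a ha =>
    obtain ⟨p, hp⟩ := ha
    exact key1 a p fst hp rfl (fun _ => rfl) fun s => (Val.size_fst_le _).trans (by simp)
  | snd a ha =>
    obtain ⟨p, hp⟩ := ha
    exact key1 a p snd hp rfl (fun _ => rfl) fun s => (Val.size_snd_le _).trans (by simp)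
  | isPair a ha =>
    obtain ⟨p, hp⟩ := ha
    exact key1 a p isPair hp rfl (fun _ => rfl) fun s =>
      (Val.size_ofBool_le _).trans (by have := Val.size_pos (a.eval s); omega)
  | add a b ha hb =>
    obtain ⟨p, hp⟩ := ha
    obtain ⟨q, hq⟩ := hb
    refine key2 a b p q add hp hq rfl (fun _ => rfl) fun s => ?_
    have h1 := Val.size_toNat_le (a.eval s)
    have h2 := Val.size_toNat_le (b.eval s)
    have h3 := natSize_add_le (a.eval s).toNat (b.eval s).toNat
    simp only [eval, sz]; omega
  | sub a b ha hb =>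
    obtain ⟨p, hp⟩ := ha
    obtain ⟨q, hq⟩ := hb
    refine key2 a b p q sub hp hq rfl (fun _ => rfl) fun s => ?_
    have h1 := Val.size_toNat_le (a.eval s)
    have h3 := Nat.size_le_size (Nat.sub_le (a.eval s).toNat (b.eval s).toNat)
    simp only [eval, sz]; omega
  | mul a b ha hb =>
    obtain ⟨p, hp⟩ := ha
    obtain ⟨q, hq⟩ := hb
    refine key2 a b p q mul hp hq rfl (fun _ => rfl) fun s => ?_
    have h1 := Val.size_toNat_le (a.eval s)
    have h2 := Val.size_toNat_le (b.eval s)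
    have h3 := natSize_mul_le (a.eval s).toNat (b.eval s).toNat
    simp only [eval, sz]; omega
  | div a b ha hb =>
    obtain ⟨p, hp⟩ := ha
    obtain ⟨q, hq⟩ := hb
    refine key2 a b p q div hp hq rfl (fun _ => rfl) fun s => ?_
    have h1 := Val.size_toNat_le (a.eval s)
    have h3 := Nat.size_le_size (Nat.div_le_self (a.eval s).toNat (b.eval s).toNat)
    simp only [eval, sz]; omega
  | lt a b ha hb =>
    obtain ⟨p, hp⟩ := ha
    obtain ⟨q, hq⟩ := hb
    refine key2 a b p q lt hp hq rfl (fun _ => rfl) fun s => ?_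
    have h1 := Val.size_pos (a.eval s)
    exact (Val.size_ofBool_le _).trans (by omega)
  | eq a b ha hb =>
    obtain ⟨p, hp⟩ := ha
    obtain ⟨q, hq⟩ := hb
    refine key2 a b p q eq hp hq rfl (fun _ => rfl) fun s => ?_
    have h1 := Val.size_pos (a.eval s)
    exact (Val.size_ofBool_le _).trans (by omega)

/-! ## Functions computable in polynomial time -/

/-- Types whose elements are represented by values. -/
class Enc (α : Type) where
  enc : α → Val

instance : Enc ℕ := ⟨Val.num⟩

instance : Enc Bool := ⟨Val.ofBool⟩

instance {α β : Type} [Enc α] [Enc β] : Enc (α × β) := ⟨fun x => Val.pair (Enc.enc x.1) (Enc.enc x.2)⟩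

instance {α : Type} [Enc α] : Enc (List α) := ⟨fun l => Val.ofList (l.map Enc.enc)⟩

open Enc

/-- The size of the representation. -/
def esize {α : Type} [Enc α] (a : α) : ℕ := (enc a).size

section

variable {α β γ δ : Type} [Enc α] [Enc β] [Enc γ] [Enc δ]

theorem enc_nat (n : ℕ) : enc n = Val.num n := rfl

theorem enc_bool (b : Bool) : enc b = Val.ofBool b := rfl

theorem enc_pair (a : α) (b : β) : enc (a, b) = Val.pair (enc a) (enc b) := rfl

theorem enc_nil : enc ([] : List α) = Val.num 0 := rfl

theorem enc_cons (a : α) (l : List α) : enc (a :: l) = Val.pair (enc a) (enc l) := rfl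

theorem esize_pair (a : α) (b : β) : esize (a, b) = esize a + esize b + 1 := rfl

theorem esize_nil : esize ([] : List α) = 1 := rfl

theorem esize_cons (a : α) (l : List α) : esize (a :: l) = esize a + esize l + 1 := rfl

theorem esize_nat (n : ℕ) : esize n = Nat.size n + 1 := rfl

theorem esize_bool_le (b : Bool) : esize b ≤ 2 := Val.size_ofBool_le b

theorem esize_pos (a : α) : 0 < esize a := Val.size_pos _

theorem esize_append (l l' : List α) : esize (l ++ l') + 1 = esize l + esize l' := by
  induction l with
  | nil => simp [esize_nil]; omega
  | cons a l ih => simp only [List.cons_append, esize_cons]; omega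

theorem length_lt_esize (l : List α) : l.length < esize l := by
  induction l with
  | nil => simp [esize_nil]
  | cons a l ih => simp only [List.length_cons, esize_cons]; omega

theorem esize_mem {a : α} {l : List α} (h : a ∈ l) : esize a < esize l := by
  induction l with
  | nil => simp at h
  | cons b l ih =>
    rw [esize_cons]
    rcases List.mem_cons.1 h with rfl | h
    · omega
    · have := ih h; omega

theorem esize_list_le {l : List α} {B : ℕ} (h : ∀ a ∈ l, esize a ≤ B) :
    esize l ≤ l.length * (B + 1) + 1 := by
  induction l with
  | nil => simp [esize_nil]
  | cons b l ih =>
    have h1 := h b (by simp)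
    have h2 := ih fun a ha => h a (by simp [ha])
    rw [esize_cons, List.length_cons, Nat.succ_mul]
    omega

/-- `f` is computed in polynomial time by a deterministic program that replaces, in a given
register, the argument by the value and preserves the registers before it. -/
def PolyTime (f : α → β) : Prop :=
  ∀ b : ℕ, ∃ (c : Com) (p : Polynomial ℕ), c.Deterministic ∧ ∀ (s : Store) (a : α), s b = enc a →
    ∃ s', c.Det s s' (p.eval (esize a)) ∧ s' b = enc (f a) ∧ (∀ i < b, s' i = s i) ∧
      esize (f a) ≤ p.eval (esize a)

namespace PolyTime

theorem size_le {f : α → β} (h : PolyTime f) :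
    ∃ p : Polynomial ℕ, ∀ a, esize (f a) ≤ p.eval (esize a) := by
  obtain ⟨c, p, -, hp⟩ := h 0
  refine ⟨p, fun a => ?_⟩
  obtain ⟨_, _, _, _, h⟩ := hp (fun _ => enc a) a rfl
  exact h

theorem of_exp {f : α → β} (e : ℕ → Exp) (hr : ∀ b, ∀ i ∈ (e b).regs, i = b)
    (he : ∀ b s a, s b = enc a → (e b).eval s = enc (f a)) : PolyTime f := by
  intro b
  obtain ⟨p, hp⟩ := (e b).exists_bound
  refine ⟨Com.assign b (e b), 1 + p, trivial, fun s a hs => ?_⟩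
  obtain ⟨h1, h2⟩ := hp s (esize a) fun i hi => by rw [hr b i hi, hs]; rfl
  rw [he b s a hs] at h2
  refine ⟨_, (Com.spec_assign b (e b) s).mono (by simpa using h1), ?_, ?_, ?_⟩
  · simp [he b s a hs]
  · intro i hi
    simp [Function.update_of_ne hi.ne]
  · simp only [Polynomial.eval_add, Polynomial.eval_one]
    have : esize (f a) ≤ p.eval (esize a) := h2
    omega

theorem id : PolyTime (fun a : α => a) :=
  of_exp Exp.reg (by simp [Exp.regs]) fun b s a h => by simpa [Exp.eval] using h

theorem comp {g : β → γ} {f : α → β} (hg : PolyTime g) (hf : PolyTime f) :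
    PolyTime fun a => g (f a) := by
  intro b
  obtain ⟨c, p, hc, hp⟩ := hf b
  obtain ⟨d, q, hd, hq⟩ := hg b
  refine ⟨Com.seq c d, p + q.comp p + 1, ⟨hc, hd⟩, fun s a hs => ?_⟩
  obtain ⟨s1, h1, h2, h3, h4⟩ := hp s a hs
  obtain ⟨s2, k1, k2, k3, k4⟩ := hq s1 (f a) h2
  have := polyEval_mono q h4
  refine ⟨s2, (h1.seq k1).mono ?_, k2, fun i hi => (k3 i hi).trans (h3 i hi), ?_⟩ <;>
  · simp only [Polynomial.eval_add, Polynomial.eval_comp, Polynomial.eval_one]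
    omega

theorem fst : PolyTime (Prod.fst : α × β → α) :=
  of_exp (fun b => .fst (.reg b)) (by simp [Exp.regs]) fun b s a h => by
    simp [Exp.eval, h, enc, Val.fst]

theorem snd : PolyTime (Prod.snd : α × β → β) :=
  of_exp (fun b => .snd (.reg b)) (by simp [Exp.regs]) fun b s a h => by
    simp [Exp.eval, h, enc, Val.snd]

theorem reg_time_le (s : Store) (b : ℕ) (a : α) (h : s b = enc a) :
    (Exp.reg b).time s = 1 + esize a := by
  simp [Exp.time, h, esize]

/-- The two values are computed in the scratch registers `b + 1` and `b + 2`. Programs preserve all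
registers before their own, so the second computation loses neither the argument nor the first
value. -/
theorem pair {f : α → β} {g : α → γ} (hf : PolyTime f) (hg : PolyTime g) :
    PolyTime fun a => (f a, g a) := by
  intro b
  obtain ⟨c, p, hc, hp⟩ := hf (b + 1)
  obtain ⟨d, q, hd, hq⟩ := hg (b + 2)
  refine ⟨.seq (.assign (b + 1) (.reg b)) (.seq c (.seq (.assign (b + 2) (.reg b)) (.seq d
    (.assign b (.pair (.reg (b + 1)) (.reg (b + 2))))))),
    (2 * Polynomial.X + 3 * p + 3 * q + 20), ⟨trivial, hc, trivial, hd, trivial⟩,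
    fun s a hs => ?_⟩
  have A1 := Com.spec_assign (b + 1) (.reg b) s
  rw [reg_time_le s b a hs] at A1
  set s1 := Function.update s (b + 1) ((Exp.reg b).eval s) with hs1
  obtain ⟨s2, h1, h2, h3, h4⟩ := hp s1 a (by simp [hs1, Exp.eval, hs])
  have hs2 : s2 b = enc a := by rw [h3 b (by omega), hs1]; simp [hs]
  have A2 := Com.spec_assign (b + 2) (.reg b) s2
  rw [reg_time_le s2 b a hs2] at A2
  set s3 := Function.update s2 (b + 2) ((Exp.reg b).eval s2) with hs3
  obtain ⟨s4, k1, k2, k3, k4⟩ := hq s3 a (by simp [hs3, Exp.eval, hs2])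
  have hs4 : s4 (b + 1) = enc (f a) := by rw [k3 _ (by omega), hs3]; simp [h2]
  have A3 := Com.spec_assign b (.pair (.reg (b + 1)) (.reg (b + 2))) s4
  have ev : (Exp.pair (.reg (b + 1)) (.reg (b + 2))).eval s4 = enc (f a, g a) := by
    simp [Exp.eval, hs4, k2, enc]
  have ti : (Exp.pair (.reg (b + 1)) (.reg (b + 2))).time s4 =
      2 * esize (f a) + 2 * esize (g a) + 4 := by
    simp only [Exp.time, Exp.eval, hs4, k2, esize, Val.size]; omega
  rw [ev, ti] at A3
  have hp1 := h4
  refine ⟨_, (A1.seq (h1.seq (A2.seq (k1.seq A3)))).mono ?_, ?_, ?_, ?_⟩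
  · simp only [Polynomial.eval_add, Polynomial.eval_mul, Polynomial.eval_X,
      Polynomial.eval_ofNat]
    omega
  · simp
  · intro i hi
    rw [Function.update_of_ne (by omega), k3 i (by omega), hs3, Function.update_of_ne (by omega),
      h3 i (by omega), hs1, Function.update_of_ne (by omega)]
  · simp only [Polynomial.eval_add, Polynomial.eval_mul, Polynomial.eval_X,
      Polynomial.eval_ofNat, esize_pair]
    omega

theorem ite {t : α → Bool} {f g : α → β} (ht : PolyTime t) (hf : PolyTime f) (hg : PolyTime g) :
    PolyTime fun a => if t a then f a else g a := by
  intro b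
  obtain ⟨c, p, hc, hp⟩ := ht (b + 1)
  obtain ⟨d, q, hd, hq⟩ := hf b
  obtain ⟨e, r, he, hr⟩ := hg b
  refine ⟨.seq (.assign (b + 1) (.reg b)) (.seq c (.ite (.reg (b + 1)) d e)),
    Polynomial.X + p + q + r + 20, ⟨trivial, hc, hd, he⟩, fun s a hs => ?_⟩
  have A1 := Com.spec_assign (b + 1) (.reg b) s
  rw [reg_time_le s b a hs] at A1
  set s1 := Function.update s (b + 1) ((Exp.reg b).eval s) with hs1
  obtain ⟨s2, h1, h2, h3, h4⟩ := hp s1 a (by simp [hs1, Exp.eval, hs])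
  have hs2 : s2 b = enc a := by rw [h3 b (by omega), hs1]; simp [hs]
  have hpres : ∀ i < b, s2 i = s i := fun i hi => by
    rw [h3 i (by omega), hs1, Function.update_of_ne (by omega)]
  have tt : (Exp.reg (b + 1)).test s2 = t a := by
    cases h : t a <;> simp [Exp.test, Exp.eval, h2, h, enc, Val.ofBool]
  have ti : (Exp.reg (b + 1)).time s2 ≤ 3 := by
    rw [reg_time_le s2 _ _ h2]; have := esize_bool_le (t a); omega
  obtain ⟨s3, k1, k2, k3, k4⟩ := hq s2 a hs2
  obtain ⟨s4, m1, m2, m3, m4⟩ := hr s2 a hs2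
  cases h : t a with
  | true =>
    have := Com.Det.ite (e := .reg (b + 1)) (a := d) (b := e) (s := s2) (s' := s3)
      (T := q.eval (esize a)) (by rw [tt, h]; simpa using k1)
    refine ⟨s3, (A1.seq (h1.seq this)).mono ?_, by simpa [h] using k2,
      fun i hi => (k3 i hi).trans (hpres i hi), ?_⟩
    · simp only [Polynomial.eval_add, Polynomial.eval_X, Polynomial.eval_ofNat]
      omega
    · beta_reduce
      rw [if_pos h]
      simp only [Polynomial.eval_add, Polynomial.eval_X, Polynomial.eval_ofNat]
      omega
  | false =>
    have := Com.Det.ite (e := .reg (b + 1)) (a := d) (b := e) (s := s2) (s' := s4)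
      (T := r.eval (esize a)) (by rw [tt, h]; simpa using m1)
    refine ⟨s4, (A1.seq (h1.seq this)).mono ?_, by simpa [h] using m2,
      fun i hi => (m3 i hi).trans (hpres i hi), ?_⟩
    · simp only [Polynomial.eval_add, Polynomial.eval_X, Polynomial.eval_ofNat]
      omega
    · beta_reduce
      rw [h, if_neg Bool.false_ne_true]
      simp only [Polynomial.eval_add, Polynomial.eval_X, Polynomial.eval_ofNat]
      omega

/-- Registers `b`, `b + 1`, `b + 2` hold the argument, the unread part of the list and the
accumulator; the step runs in `b + 3`. A bound for all intermediate accumulators has to be assumed,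
since iterating a polynomial-time step may produce values of exponential size. -/
theorem foldl {l : α → List γ} {init : α → β} {step : α × γ × β → β} (hl : PolyTime l)
    (hi : PolyTime init) (hs : PolyTime step)
    (hQ : ∃ Q : Polynomial ℕ, ∀ a l₁ l₂, l a = l₁ ++ l₂ →
      esize (l₁.foldl (fun acc x => step (a, x, acc)) (init a)) ≤ Q.eval (esize a)) :
    PolyTime fun a => (l a).foldl (fun acc x => step (a, x, acc)) (init a) := by
  obtain ⟨Q, hQ⟩ := hQ
  intro b
  obtain ⟨c₁, p₁, hc₁, hp₁⟩ := hl (b + 1)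
  obtain ⟨c₂, p₂, hc₂, hp₂⟩ := hi (b + 2)
  obtain ⟨c₃, p₃, hc₃, hp₃⟩ := hs (b + 3)
  let e₁ : Exp := .pair (.reg b) (.pair (.fst (.reg (b + 1))) (.reg (b + 2)))
  let e₂ : Exp := .snd (.reg (b + 1))
  let e₃ : Exp := .isPair (.reg (b + 1))
  obtain ⟨r₁, hr₁⟩ := e₁.exists_bound
  obtain ⟨r₂, hr₂⟩ := e₂.exists_bound
  obtain ⟨r₃, hr₃⟩ := e₃.exists_bound
  let body : Com := .seq (.assign (b + 3) e₁) (.seq c₃ (.seq (.assign (b + 2) (.reg (b + 3)))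
    (.assign (b + 1) e₂)))
  -- `M` bounds the argument, the list and every accumulator; the triple passed to the step then has
  -- size at most `3 * M + 2`, the `2` counting its two pair nodes.
  let M : Polynomial ℕ := Polynomial.X + p₁ + Q
  let TB : Polynomial ℕ := r₁.comp M + p₃.comp (3 * M + 2) + p₃.comp (3 * M + 2) + r₂.comp M + 10
  -- one iteration
  have hbody : ∀ (n : ℕ) (s : Store) (a : α) (x : γ) (xs : List γ) (acc : β),
      esize a ≤ n → esize (x :: xs) ≤ n → esize acc ≤ n → s b = enc a →
      s (b + 1) = enc (x :: xs) → s (b + 2) = enc acc →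
      ∃ s', body.Det s s' (r₁.eval n + p₃.eval (3 * n + 2) + p₃.eval (3 * n + 2) + r₂.eval n + 10) ∧
        s' b = enc a ∧ s' (b + 1) = enc xs ∧ s' (b + 2) = enc (step (a, x, acc)) ∧
        ∀ i < b, s' i = s i := by
    intro n s a x xs acc ha hx hacc hsa hsx hsacc
    have B1 := Com.spec_assign (b + 3) e₁ s
    obtain ⟨t1, -⟩ := hr₁ s n (by
      intro i hi
      simp only [e₁, Exp.regs, List.mem_append, List.mem_singleton] at hi
      rcases hi with rfl | rfl | rfl
      · rw [hsa]; exact ha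
      · rw [hsx]; exact hx
      · rw [hsacc]; exact hacc)
    have ev1 : e₁.eval s = enc (a, x, acc) := by
      simp [e₁, Exp.eval, hsa, hsx, hsacc, enc_pair, enc_cons, Val.fst]
    rw [ev1] at B1
    set s1 := Function.update s (b + 3) (enc (a, x, acc)) with hs1
    obtain ⟨s2, h1, h2, h3, h4⟩ := hp₃ s1 (a, x, acc) (by simp [hs1])
    have hsz : esize (a, x, acc) ≤ 3 * n + 2 := by
      simp only [esize_pair]
      rw [esize_cons] at hx
      omega
    have hsz' := polyEval_mono p₃ hsz
    have B2 := Com.spec_assign (b + 2) (.reg (b + 3)) s2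
    rw [reg_time_le s2 _ _ h2, show (Exp.reg (b + 3)).eval s2 = _ from h2] at B2
    set s3 := Function.update s2 (b + 2) (enc (step (a, x, acc))) with hs3
    have hs3x : s3 (b + 1) = enc (x :: xs) := by
      rw [hs3, Function.update_of_ne (by omega), h3 _ (by omega), hs1,
        Function.update_of_ne (by omega), hsx]
    have B3 := Com.spec_assign (b + 1) e₂ s3
    obtain ⟨t3, -⟩ := hr₂ s3 n (by
      intro i hi
      simp only [e₂, Exp.regs, List.mem_singleton] at hi
      rw [hi, hs3x]; exact hx)
    refine ⟨_, (B1.seq (h1.seq (B2.seq B3))).mono (by omega), ?_, ?_, ?_, ?_⟩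
    · rw [Function.update_of_ne (by omega), hs3, Function.update_of_ne (by omega),
        h3 _ (by omega), hs1, Function.update_of_ne (by omega), hsa]
    · simp [e₂, Exp.eval, hs3x, enc_cons, Val.snd]
    · rw [Function.update_of_ne (by omega), hs3]; simp
    · intro i hi
      rw [Function.update_of_ne (by omega), hs3, Function.update_of_ne (by omega),
        h3 _ (by omega), hs1, Function.update_of_ne (by omega)]
  -- the loop
  have hloop : ∀ (a : α) (n T : ℕ), esize a ≤ n → esize (l a) ≤ n →
      (∀ l₁ l₂, l a = l₁ ++ l₂ →
        esize (l₁.foldl (fun acc x => step (a, x, acc)) (init a)) ≤ n) →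
      r₁.eval n + p₃.eval (3 * n + 2) + p₃.eval (3 * n + 2) + r₂.eval n + 10 ≤ T →
      ∀ (l₂ l₁ : List γ), l a = l₁ ++ l₂ → ∀ s : Store, s b = enc a → s (b + 1) = enc l₂ →
      s (b + 2) = enc (l₁.foldl (fun acc x => step (a, x, acc)) (init a)) →
      ∃ s', (Com.loop e₃ body).Det s s' (l₂.length * (T + r₃.eval n + 1) + r₃.eval n + 1) ∧
        s' (b + 2) = enc ((l a).foldl (fun acc x => step (a, x, acc)) (init a)) ∧
        ∀ i < b, s' i = s i := by
    intro a n T ha hla hacc hT l₂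
    induction l₂ with
    | nil =>
      intro l₁ hl₁ s hsa hsl hsacc
      obtain ⟨t1, -⟩ := hr₃ s n (by
        intro i hi
        simp only [e₃, Exp.regs, List.mem_singleton] at hi
        rw [hi, hsl]
        exact (Nat.succ_le_of_lt (esize_pos a)).trans ha)
      refine ⟨s, (Com.spec_loop_false ?_).mono (by simp; omega), ?_, fun _ _ => rfl⟩
      · simp [e₃, Exp.test, Exp.eval, hsl, enc_nil, Val.isPair, Val.ofBool]
      · rw [hsacc, hl₁, List.append_nil]
    | cons x xs ih =>
      intro l₁ hl₁ s hsa hsl hsacc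
      have hxs : esize (x :: xs) ≤ n := by
        have := esize_append l₁ (x :: xs)
        rw [← hl₁] at this
        have := esize_pos l₁
        omega
      obtain ⟨t1, -⟩ := hr₃ s n (by
        intro i hi
        simp only [e₃, Exp.regs, List.mem_singleton] at hi
        rw [hi, hsl]
        exact hxs)
      obtain ⟨s1, h1, h2, h3, h4, h5⟩ := hbody n s a x xs _ ha hxs (hacc l₁ _ hl₁) hsa hsl hsacc
      obtain ⟨s2, k1, k2, k3⟩ := ih (l₁ ++ [x]) (by simp [hl₁]) s1 h2 h3 (by simp [h4])
      refine ⟨s2, (Com.Det.loop ?_ h1 k1).mono ?_, k2, fun i hi => (k3 i hi).trans (h5 i hi)⟩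
      · simp [e₃, Exp.test, Exp.eval, hsl, enc_cons, Val.isPair, Val.ofBool]
      · rw [List.length_cons, Nat.add_mul xs.length 1, one_mul]
        omega
  refine ⟨.seq (.assign (b + 1) (.reg b)) (.seq c₁ (.seq (.assign (b + 2) (.reg b)) (.seq c₂
    (.seq (.loop e₃ body) (.assign b (.reg (b + 2))))))),
    2 * Polynomial.X + p₁ + p₂ + M * (TB + r₃.comp M + 1) + r₃.comp M + 2 * Q + 20,
    ⟨trivial, hc₁, trivial, hc₂, ⟨trivial, hc₃, trivial, trivial⟩, trivial⟩, fun s a hs => ?_⟩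
  have A1 := Com.spec_assign (b + 1) (.reg b) s
  rw [reg_time_le s b a hs] at A1
  set s1 := Function.update s (b + 1) ((Exp.reg b).eval s) with hs1
  obtain ⟨s2, h1, h2, h3, h4⟩ := hp₁ s1 a (by simp [hs1, Exp.eval, hs])
  have hs2 : s2 b = enc a := by rw [h3 b (by omega), hs1]; simp [hs]
  have A2 := Com.spec_assign (b + 2) (.reg b) s2
  rw [reg_time_le s2 b a hs2] at A2
  set s3 := Function.update s2 (b + 2) ((Exp.reg b).eval s2) with hs3
  obtain ⟨s4, k1, k2, k3, k4⟩ := hp₂ s3 a (by simp [hs3, Exp.eval, hs2])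
  have hMa : M.eval (esize a) = esize a + p₁.eval (esize a) + Q.eval (esize a) := by
    simp [M]
  have hQ' := hQ a (l a) [] (by simp)
  obtain ⟨s5, m1, m2, m3⟩ := hloop a (M.eval (esize a)) (TB.eval (esize a))
    (by omega) (by omega) (fun l₁ l₂ h => (hQ a l₁ l₂ h).trans (by omega)) (by simp [TB])
    (l a) [] rfl s4 (by rw [k3 _ (by omega), hs3]; simp [hs2])
    (by rw [k3 _ (by omega), hs3]; simp [h2]) (by simpa using k2)
  have A3 := Com.spec_assign b (.reg (b + 2)) s5
  rw [reg_time_le s5 _ _ m2, show (Exp.reg (b + 2)).eval s5 = _ from m2] at A3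
  refine ⟨_, (A1.seq (h1.seq (A2.seq (k1.seq (m1.seq A3))))).mono ?_, ?_, ?_, ?_⟩
  · have hlen : (l a).length ≤ M.eval (esize a) := by have := length_lt_esize (l a); omega
    have := Nat.mul_le_mul_right (TB.eval (esize a) + r₃.eval (M.eval (esize a)) + 1) hlen
    simp only [Polynomial.eval_add, Polynomial.eval_mul, Polynomial.eval_X,
      Polynomial.eval_ofNat, Polynomial.eval_comp, Polynomial.eval_one]
    omega
  · simp
  · intro i hi
    rw [Function.update_of_ne (by omega), m3 i hi, k3 i (by omega), hs3,
      Function.update_of_ne (by omega), h3 i (by omega), hs1, Function.update_of_ne (by omega)]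
  · simp only [Polynomial.eval_add, Polynomial.eval_mul, Polynomial.eval_X,
      Polynomial.eval_ofNat, Polynomial.eval_comp, Polynomial.eval_one]
    omega

end PolyTime

end

/-! ### Closure properties of polynomial-time functions: folds, arithmetic, lists. -/

section

variable {α β γ δ : Type} [Enc α] [Enc β] [Enc γ] [Enc δ]

namespace PolyTime

theorem exists_add_le {f : α → β} {g : α → γ} (hf : PolyTime f) (hg : PolyTime g) :
    ∃ p : Polynomial ℕ, ∀ a, esize (f a) + esize (g a) ≤ p.eval (esize a) := by
  obtain ⟨p, hp⟩ := hf.size_le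
  obtain ⟨q, hq⟩ := hg.size_le
  exact ⟨p + q, fun a => by simpa using add_le_add (hp a) (hq a)⟩

/-- A fold whose accumulator grows by a polynomially bounded amount in each step. -/
theorem foldl_of_growth {l : α → List γ} {init : α → β} {step : α × γ × β → β} (hl : PolyTime l)
    (hi : PolyTime init) (hs : PolyTime step)
    (hQ : ∃ q : Polynomial ℕ, ∀ a x acc,
      esize (step (a, x, acc)) ≤ esize acc + q.eval (esize a + esize x)) :
    PolyTime fun a => (l a).foldl (fun acc x => step (a, x, acc)) (init a) := by
  refine foldl hl hi hs ?_
  obtain ⟨q, hq⟩ := hQ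
  obtain ⟨p, hp⟩ := hl.size_le
  obtain ⟨r, hr⟩ := hi.size_le
  refine ⟨r + p * q.comp (Polynomial.X + p), fun a l₁ l₂ h => ?_⟩
  have key : ∀ l₁ l₂, l a = l₁ ++ l₂ →
      esize (l₁.foldl (fun acc x => step (a, x, acc)) (init a)) ≤
        r.eval (esize a) + l₁.length * q.eval (esize a + p.eval (esize a)) := by
    intro l₁
    induction l₁ using List.reverseRecOn with
    | nil => intro l₂ _; simpa using hr a
    | append_singleton l₁ x ih =>
      intro l₂ h
      have h1 := ih (x :: l₂) (by simpa using h)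
      rw [List.foldl_append, List.foldl_cons, List.foldl_nil, List.length_append,
        List.length_singleton, add_mul, one_mul]
      refine (hq a x _).trans ?_
      have hx : esize x ≤ p.eval (esize a) := (esize_mem (by rw [h]; simp)).le.trans (hp a)
      have := polyEval_mono q (Nat.add_le_add_left hx (esize a))
      omega
  refine (key l₁ l₂ h).trans ?_
  simp only [Polynomial.eval_add, Polynomial.eval_mul, Polynomial.eval_comp, Polynomial.eval_X]
  have hlen : l₁.length ≤ p.eval (esize a) := by
    have := length_lt_esize (l a)
    have h2 := hp a
    rw [h, List.length_append] at this
    rw [h] at h2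
    omega
  exact Nat.add_le_add_left (Nat.mul_le_mul_right _ hlen) _

theorem const_nat (n : ℕ) : PolyTime fun _ : α => n :=
  of_exp (fun _ => .const n) (by simp [Exp.regs]) fun _ _ _ _ => rfl

theorem const_nil : PolyTime fun _ : α => ([] : List β) :=
  of_exp (fun _ => .const 0) (by simp [Exp.regs]) fun _ _ _ _ => rfl

theorem const_bool (t : Bool) : PolyTime fun _ : α => t :=
  of_exp (fun _ => .const t.toNat) (by simp [Exp.regs]) fun _ _ _ _ => rfl

theorem fst' {f : α → β × γ} (h : PolyTime f) : PolyTime fun a => (f a).1 := fst.comp h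

theorem snd' {f : α → β × γ} (h : PolyTime f) : PolyTime fun a => (f a).2 := snd.comp h

theorem cons {f : α → β} {g : α → List β} (hf : PolyTime f) (hg : PolyTime g) :
    PolyTime fun a => f a :: g a :=
  (of_exp (f := fun z : β × List β => z.1 :: z.2) Exp.reg (by simp [Exp.regs])
    fun b s a h => h).comp (hf.pair hg)

theorem nat_op (op : Exp → Exp → Exp) (g : ℕ → ℕ → β)
    (hr : ∀ a b, (op a b).regs = a.regs ++ b.regs)
    (he : ∀ a b s m n, a.eval s = enc m → b.eval s = enc n → (op a b).eval s = enc (g m n))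
    {f₁ f₂ : α → ℕ} (h₁ : PolyTime f₁) (h₂ : PolyTime f₂) :
    PolyTime fun a => g (f₁ a) (f₂ a) :=
  (of_exp (f := fun z : ℕ × ℕ => g z.1 z.2) (fun b => op (.fst (.reg b)) (.snd (.reg b)))
    (by simp [hr, Exp.regs]) fun b s ⟨m, n⟩ h => he _ _ _ _ _
      (by simp [Exp.eval, h, enc_pair, Val.fst])
      (by simp [Exp.eval, h, enc_pair, Val.snd])).comp (h₁.pair h₂)

theorem nat_add {f g : α → ℕ} (hf : PolyTime f) (hg : PolyTime g) :
    PolyTime fun a => f a + g a :=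
  nat_op Exp.add (· + ·) (fun _ _ => rfl)
    (fun a b s m n h1 h2 => by simp [Exp.eval, h1, h2, enc_nat, Val.toNat]) hf hg

theorem nat_sub {f g : α → ℕ} (hf : PolyTime f) (hg : PolyTime g) :
    PolyTime fun a => f a - g a :=
  nat_op Exp.sub (· - ·) (fun _ _ => rfl)
    (fun a b s m n h1 h2 => by simp [Exp.eval, h1, h2, enc_nat, Val.toNat]) hf hg

theorem nat_lt {f g : α → ℕ} (hf : PolyTime f) (hg : PolyTime g) :
    PolyTime fun a => decide (f a < g a) :=
  nat_op Exp.lt (fun m n => decide (m < n)) (fun _ _ => rfl)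
    (fun a b s m n h1 h2 => by simp [Exp.eval, h1, h2, enc_nat, enc_bool, Val.toNat]) hf hg

theorem nat_eq {f g : α → ℕ} (hf : PolyTime f) (hg : PolyTime g) :
    PolyTime fun a => decide (f a = g a) :=
  nat_op Exp.eq (fun m n => decide (m = n)) (fun _ _ => rfl)
    (fun a b s m n h1 h2 => by simp [Exp.eval, h1, h2, enc_nat, enc_bool]) hf hg

theorem not {f : α → Bool} (hf : PolyTime f) : PolyTime fun a => !f a := by
  convert hf.ite (const_bool false) (const_bool true) using 2 with a
  cases f a <;> rfl

theorem and {f g : α → Bool} (hf : PolyTime f) (hg : PolyTime g) :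
    PolyTime fun a => f a && g a := by
  convert hf.ite hg (const_bool false) using 2 with a
  cases f a <;> rfl

theorem or {f g : α → Bool} (hf : PolyTime f) (hg : PolyTime g) :
    PolyTime fun a => f a || g a := by
  convert hf.ite (const_bool true) hg using 2 with a
  cases f a <;> rfl

/-- Case distinction on a decidable proposition. -/
theorem ite_prop {t : α → Prop} [∀ a, Decidable (t a)] {f g : α → β}
    (ht : PolyTime fun a => decide (t a)) (hf : PolyTime f) (hg : PolyTime g) :
    PolyTime fun a => if t a then f a else g a := by
  convert ht.ite hf hg using 2 with a
  simp

theorem tail {f : α → List β} (hf : PolyTime f) : PolyTime fun a => (f a).tail :=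
  (of_exp (f := fun l : List β => l.tail) (fun b => .snd (.reg b)) (by simp [Exp.regs])
    fun b s l h => by
      cases l <;> simp [Exp.eval, h, enc_nil, enc_cons, Val.snd]).comp hf

/-- The empty list is stored as the number `0`, and `Val.fst` of a number is `0`; this is why `0` is
the default here and in the list functions of the algorithms. -/
theorem headD {f : α → List ℕ} (hf : PolyTime f) : PolyTime fun a => (f a).headD 0 :=
  (of_exp (f := fun l : List ℕ => l.headD 0) (fun b => .fst (.reg b)) (by simp [Exp.regs])
    fun b s l h => by
      cases l <;> simp [Exp.eval, h, enc_nil, enc_cons, Val.fst, enc_nat]).comp hf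

theorem isEmpty {f : α → List β} (hf : PolyTime f) : PolyTime fun a => (f a).isEmpty :=
  ((of_exp (f := fun l : List β => !l.isEmpty) (fun b => .isPair (.reg b)) (by simp [Exp.regs])
    fun b s l h => by
      cases l <;> simp [Exp.eval, h, enc_nil, enc_cons, Val.isPair, enc_bool]).comp hf).not.comp id
    |> fun h => by simpa using h

theorem reverse {f : α → List β} (hf : PolyTime f) : PolyTime fun a => (f a).reverse := by
  have := foldl_of_growth (l := fun l : List β => l) (init := fun _ => ([] : List β))
    (step := fun z : List β × β × List β => z.2.1 :: z.2.2) id const_nil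
    (cons snd.fst' snd.snd') ⟨Polynomial.X + 1, fun a x acc => by
      simp only [esize_cons, Polynomial.eval_add, Polynomial.eval_X, Polynomial.eval_one]
      omega⟩
  refine PolyTime.comp (g := List.reverse) ?_ hf
  convert this using 2 with l
  simp

theorem foldr_of_growth {l : α → List γ} {init : α → β} {step : α × γ × β → β} (hl : PolyTime l)
    (hi : PolyTime init) (hs : PolyTime step)
    (hQ : ∃ q : Polynomial ℕ, ∀ a x acc,
      esize (step (a, x, acc)) ≤ esize acc + q.eval (esize a + esize x)) :
    PolyTime fun a => (l a).foldr (fun x acc => step (a, x, acc)) (init a) := by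
  have := foldl_of_growth hl.reverse hi hs hQ
  simpa using this

theorem map {l : α → List γ} {f : α × γ → β} (hl : PolyTime l) (hf : PolyTime f) :
    PolyTime fun a => (l a).map fun x => f (a, x) := by
  obtain ⟨p, hp⟩ := hf.size_le
  have := foldr_of_growth (init := fun _ => ([] : List β))
    (step := fun z : α × γ × List β => f (z.1, z.2.1) :: z.2.2) hl const_nil
    (cons (hf.comp (fst.pair snd.fst')) snd.snd') ⟨p.comp (Polynomial.X + 1) + 1,
      fun a x acc => by
        have := hp (a, x)
        simp only [esize_cons, esize_pair, Polynomial.eval_add, Polynomial.eval_X,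
          Polynomial.eval_one, Polynomial.eval_comp] at this ⊢
        omega⟩
  convert this using 2 with a
  induction l a with
  | nil => rfl
  | cons x l ih => rw [List.map_cons, List.foldr_cons, ih]

theorem filter {l : α → List γ} {t : α × γ → Bool} (hl : PolyTime l) (ht : PolyTime t) :
    PolyTime fun a => (l a).filter fun x => t (a, x) := by
  have := foldr_of_growth (init := fun _ => ([] : List γ))
    (step := fun z : α × γ × List γ => if t (z.1, z.2.1) then z.2.1 :: z.2.2 else z.2.2)
    hl const_nil
    (ite (ht.comp (fst.pair snd.fst')) (cons snd.fst' snd.snd') snd.snd')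
    ⟨Polynomial.X + 1, fun a x acc => by
        simp only [Polynomial.eval_add, Polynomial.eval_X, Polynomial.eval_one]
        split_ifs
        · rw [esize_cons]; omega
        · omega⟩
  convert this using 2 with a
  induction l a with
  | nil => rfl
  | cons x l ih => simp [List.filter_cons, ih]

theorem append {f g : α → List β} (hf : PolyTime f) (hg : PolyTime g) :
    PolyTime fun a => f a ++ g a := by
  have := foldr_of_growth (step := fun z : α × β × List β => z.2.1 :: z.2.2) hf hg
    (cons snd.fst' snd.snd') ⟨Polynomial.X + 1, fun a x acc => by
      simp only [esize_cons, Polynomial.eval_add, Polynomial.eval_X, Polynomial.eval_one]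
      omega⟩
  convert this using 2 with a
  simp

theorem length {f : α → List β} (hf : PolyTime f) : PolyTime fun a => (f a).length := by
  have := foldl_of_growth (init := fun _ => 0)
    (step := fun z : α × β × ℕ => z.2.2 + 1) hf (const_nat 0) (nat_add snd.snd' (const_nat 1))
    ⟨2, fun a x acc => by
      have := natSize_add_le acc 1
      have h1 : Nat.size 1 = 1 := Nat.size_one
      simp only [esize_nat, Polynomial.eval_ofNat]
      omega⟩
  convert this using 2 with a
  simp

theorem any {l : α → List γ} {t : α × γ → Bool} (hl : PolyTime l) (ht : PolyTime t) :
    PolyTime fun a => (l a).any fun x => t (a, x) := by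
  have := foldr_of_growth (init := fun _ => false)
    (step := fun z : α × γ × Bool => t (z.1, z.2.1) || z.2.2) hl (const_bool false)
    (or (ht.comp (fst.pair snd.fst')) snd.snd')
    ⟨2, fun a x acc => by
      have := esize_bool_le (t (a, x) || acc)
      simp only [Polynomial.eval_ofNat]
      omega⟩
  convert this using 2 with a
  induction l a with
  | nil => rfl
  | cons x l ih => simp [ih]

theorem mem {f : α → ℕ} {l : α → List ℕ} (hf : PolyTime f) (hl : PolyTime l) :
    PolyTime fun a => decide (f a ∈ l a) := by
  have := any hl (t := fun z : α × ℕ => decide (f z.1 = z.2)) (nat_eq (hf.comp fst) snd)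
  convert this using 2 with a
  induction l a with
  | nil => simp
  | cons x l ih => simp_all

theorem subset {f g : α → List ℕ} (hf : PolyTime f) (hg : PolyTime g) :
    PolyTime fun a => decide (f a ⊆ g a) := by
  have := (any hf (t := fun z : α × ℕ => !decide (z.2 ∈ g z.1)) (mem snd (hg.comp fst)).not).not
  convert this using 2 with a
  rw [Bool.eq_iff_iff]
  simp [List.subset_def]

theorem getD {l : α → List ℕ} {n : α → ℕ} (hl : PolyTime l) (hn : PolyTime n) :
    PolyTime fun a => (l a).getD (n a) 0 := by
  have := foldl_of_growth (init := fun _ => (0, 0))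
    (step := fun z : α × ℕ × ℕ × ℕ =>
      (z.2.2.1 + 1, if z.2.2.1 = n z.1 then z.2.1 else z.2.2.2)) hl
    ((const_nat 0).pair (const_nat 0))
    ((nat_add snd.snd'.fst' (const_nat 1)).pair (ite_prop (nat_eq snd.snd'.fst' (hn.comp fst))
      snd.fst' snd.snd'.snd'))
    ⟨Polynomial.X + 2, fun a x acc => by
      have := natSize_add_le acc.1 1
      have h1 : Nat.size 1 = 1 := Nat.size_one
      rcases acc with ⟨i, r⟩
      simp only [esize_pair, Polynomial.eval_add, Polynomial.eval_X, Polynomial.eval_ofNat] at *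
      simp only [esize_nat]
      split_ifs <;> omega⟩
  have key : ∀ (n : ℕ) (l : List ℕ), (l.foldl (fun (acc : ℕ × ℕ) x =>
      (acc.1 + 1, if acc.1 = n then x else acc.2)) (0, 0)) = (l.length, l.getD n 0) := by
    intro n l
    induction l using List.reverseRecOn with
    | nil => simp
    | append_singleton l x ih =>
      rw [List.foldl_append, ih]
      simp only [List.foldl_cons, List.foldl_nil, List.length_append, List.length_singleton,
        Prod.mk.injEq, true_and]
      split_ifs with h
      · subst h; simp
      · rcases Nat.lt_or_ge n l.length with h1 | h1
        · rw [List.getD_append _ _ _ _ h1]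
        · rw [List.getD_append_right _ _ _ _ h1, List.getD_eq_default _ _ h1,
            List.getD_eq_default _ _ (by simp; omega)]
  convert this.snd' using 2 with a
  exact (congrArg Prod.snd (key (n a) (l a))).symm

theorem idxOf {f : α → ℕ} {l : α → List ℕ} (hf : PolyTime f) (hl : PolyTime l) :
    PolyTime fun a => (l a).idxOf (f a) := by
  have := foldr_of_growth (init := fun _ => 0)
    (step := fun z : α × ℕ × ℕ => if z.2.1 = f z.1 then 0 else z.2.2 + 1) hl (const_nat 0)
    (ite_prop (nat_eq snd.fst' (hf.comp fst)) (const_nat 0) (nat_add snd.snd' (const_nat 1)))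
    ⟨2, fun a x acc => by
      have := natSize_add_le acc 1
      have h1 : Nat.size 1 = 1 := Nat.size_one
      have h0 : Nat.size 0 = 0 := Nat.size_zero
      simp only [Polynomial.eval_ofNat]
      split_ifs <;> simp only [esize_nat] <;> omega⟩
  convert this using 2 with a
  induction l a with
  | nil => simp
  | cons x l ih => simp [List.idxOf_cons, ih]

end PolyTime

end

/-! ## From Page-Laminar Paging to Paging -/

/-- Some solution of the paging problem with `k` slots and request sequence `σ`, started with the
pages in `D`, has cost `c`. -/
inductive Serves (k : ℕ) : Finset ℕ → List ℕ → ℕ → Prop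
  | nil (D : Finset ℕ) : Serves k D [] 0
  | cons {D D' : Finset ℕ} {v : ℕ} {σ : List ℕ} {c : ℕ} : D'.card ≤ k → v ∈ D' →
      Serves k D' σ c → Serves k D (v :: σ) ((D' \ D).card + c)

/-- After a request for `P`, every superset of `P` is represented by the page that represents
`P`. -/
def redirect (p : Finset ℕ → ℕ) (P : Finset ℕ) : Finset ℕ → ℕ :=
  fun A => if P ⊆ A then p P else p A

/-- The page requests that replace the given requests, when the sets are represented by `p`. -/
def pageSeq : (Finset ℕ → ℕ) → List (Finset ℕ) → List ℕ
  | _, [] => []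
  | p, P :: rs => p P :: pageSeq (redirect p P) rs

/-- A finite laminar family of nonempty sets. -/
structure Laminar (F : Finset (Finset ℕ)) : Prop where
  nonempty : ∀ R ∈ F, R.Nonempty
  cases : ∀ R ∈ F, ∀ R' ∈ F, Disjoint R R' ∨ R ⊆ R' ∨ R' ⊆ R

theorem Laminar.comparable {F : Finset (Finset ℕ)} (hF : Laminar F) {R R' : Finset ℕ}
    (hR : R ∈ F) (hR' : R' ∈ F) {x : ℕ} (hx : x ∈ R) (hx' : x ∈ R') : R ⊆ R' ∨ R' ⊆ R := by
  rcases hF.cases R hR R' hR' with h | h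
  · exact absurd hx' (Finset.disjoint_left.1 h hx)
  · exact h

/-- Every set of the family is represented by one of its pages, and a subset that contains the
representative of a set has the same representative. -/
structure Represents (F : Finset (Finset ℕ)) (p : Finset ℕ → ℕ) : Prop where
  mem : ∀ R ∈ F, p R ∈ R
  eq : ∀ Z ∈ F, ∀ Y ∈ F, Y ⊆ Z → p Z ∈ Y → p Y = p Z

/-- The one case that needs laminarity is `P ⊆ Z`, `¬ P ⊆ Y` with `p P ∈ Y`: then `Y` meets `P`,
hence `Y ⊆ P`, and the old property for the pair `P`, `Y` applies. -/
theorem Represents.redirect {F : Finset (Finset ℕ)} (hF : Laminar F) {p : Finset ℕ → ℕ}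
    (hp : Represents F p) {P : Finset ℕ} (hP : P ∈ F) : Represents F (redirect p P) := by
  constructor
  · intro R hR
    unfold LaminarPaging.redirect
    split_ifs with h
    · exact h (hp.mem P hP)
    · exact hp.mem R hR
  · intro Z hZ Y hY hYZ h
    unfold LaminarPaging.redirect at h ⊢
    by_cases hPZ : P ⊆ Z
    · rw [if_pos hPZ] at h ⊢
      split_ifs with hPY
      · rfl
      · rcases hF.comparable hP hY (hp.mem P hP) h with h1 | h1
        · exact absurd h1 hPY
        · exact hp.eq P hP Y hY h1 h
    · rw [if_neg hPZ] at h ⊢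
      rw [if_neg fun h' => hPZ (h'.trans hYZ)]
      exact hp.eq Z hZ Y hY hYZ h

/-! ### The simulation invariant and retrievals. -/

section

variable {F : Finset (Finset ℕ)} {p : Finset ℕ → ℕ} {C D : Finset ℕ}

/-- The sets of the family that contain a page of `C`. -/
def hitSets (F : Finset (Finset ℕ)) (C : Finset ℕ) : Finset (Finset ℕ) :=
  F.filter fun R => (C ∩ R).Nonempty

/-- The maximal sets of the family that contain a page of `C`. -/
def hitRoots (F : Finset (Finset ℕ)) (C : Finset ℕ) : Finset (Finset ℕ) :=
  (hitSets F C).filter fun R => ∀ Y ∈ F, R ⊆ Y → Y = R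

theorem mem_hitSets {R : Finset ℕ} : R ∈ hitSets F C ↔ R ∈ F ∧ ∃ x ∈ C, x ∈ R := by
  simp only [hitSets, Finset.mem_filter, Finset.Nonempty, Finset.mem_inter]

theorem hitSets_mono {C' : Finset ℕ} (h : C ⊆ C') : hitSets F C ⊆ hitSets F C' := by
  intro R hR
  rw [mem_hitSets] at hR ⊢
  obtain ⟨h1, x, h2, h3⟩ := hR
  exact ⟨h1, x, h h2, h3⟩

theorem hitSets_up {X Y : Finset ℕ} (hX : X ∈ hitSets F C) (hY : Y ∈ F) (h : X ⊆ Y) :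
    Y ∈ hitSets F C := by
  rw [mem_hitSets] at hX ⊢
  obtain ⟨_, x, h2, h3⟩ := hX
  exact ⟨hY, x, h2, h h3⟩

/-- The pages of `D` that represent a subset of `R` that contains a page of `C`. -/
def usedIn (F : Finset (Finset ℕ)) (p : Finset ℕ → ℕ) (C D R : Finset ℕ) : Finset ℕ :=
  D.filter fun d => ∃ X ∈ hitSets F C, X ⊆ R ∧ p X = d

theorem mem_usedIn {R : Finset ℕ} {d : ℕ} :
    d ∈ usedIn F p C D R ↔ d ∈ D ∧ ∃ X ∈ hitSets F C, X ⊆ R ∧ p X = d := by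
  simp [usedIn]

/-- The relation between the pages `C` in the cache of a solution of the laminar instance and the
pages `D` in the cache of the solution of the paging instance that is derived from it. -/
structure Simulates (F : Finset (Finset ℕ)) (p : Finset ℕ → ℕ) (C D : Finset ℕ) : Prop where
  sub : D ⊆ (hitSets F C).image p
  up : ∀ X ∈ hitSets F C, ∀ Y ∈ F, X ⊆ Y → p X ∈ D → p Y ∈ D
  hall : ∀ R ∈ hitSets F C, (usedIn F p C D R).card ≤ (C ∩ R).card

theorem exists_maximal_superset {Q : Finset (Finset ℕ)} {X : Finset ℕ} (hX : X ∈ Q) :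
    ∃ T ∈ Q, X ⊆ T ∧ ∀ Y ∈ Q, T ⊆ Y → Y = T := by
  obtain ⟨T, hXT, hT⟩ := Q.exists_le_maximal hX
  exact ⟨T, hT.prop, hXT, fun Y hY h => (hT.eq_of_le hY h).symm⟩

/-- The maximal members of `Q` are disjoint by laminarity, and every page counted on the left is
used inside one of them, so the Hall conditions of these members add up. -/
theorem Simulates.hall_biUnion (hF : Laminar F) (h : Simulates F p C D) (Q : Finset (Finset ℕ))
    (hQ : Q ⊆ hitSets F C) :
    (D.filter fun d => ∃ X ∈ Q, p X = d).card ≤ (C ∩ Q.biUnion id).card := by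
  let T := Q.filter fun X => ∀ Y ∈ Q, X ⊆ Y → Y = X
  have hT : ∀ X ∈ T, X ∈ Q := fun X hX => (Finset.mem_filter.1 hX).1
  have h1 : (D.filter fun d => ∃ X ∈ Q, p X = d) ⊆ T.biUnion fun R => usedIn F p C D R := by
    intro d hd
    obtain ⟨hd, X, hX, rfl⟩ := Finset.mem_filter.1 hd
    obtain ⟨R, hR, hXR, hmax⟩ := exists_maximal_superset hX
    exact Finset.mem_biUnion.2 ⟨R, Finset.mem_filter.2 ⟨hR, hmax⟩,
      mem_usedIn.2 ⟨hd, X, hQ hX, hXR, rfl⟩⟩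
  have hdisj : (T : Set (Finset ℕ)).PairwiseDisjoint fun R => C ∩ R := by
    intro A hA B hB hAB
    refine Finset.disjoint_left.2 fun x hxA hxB => hAB ?_
    have hA' := Finset.mem_filter.1 hA
    have hB' := Finset.mem_filter.1 hB
    rcases hF.comparable (mem_hitSets.1 (hQ hA'.1)).1 (mem_hitSets.1 (hQ hB'.1)).1
      (Finset.mem_inter.1 hxA).2 (Finset.mem_inter.1 hxB).2 with h | h
    · exact (hA'.2 B hB'.1 h).symm
    · exact hB'.2 A hA'.1 h
  calc _ ≤ (T.biUnion fun R => usedIn F p C D R).card := Finset.card_le_card h1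
    _ ≤ ∑ R ∈ T, (usedIn F p C D R).card := Finset.card_biUnion_le
    _ ≤ ∑ R ∈ T, (C ∩ R).card := Finset.sum_le_sum fun R hR => h.hall R (hQ (hT R hR))
    _ = (T.biUnion fun R => C ∩ R).card := (Finset.card_biUnion hdisj).symm
    _ ≤ _ := Finset.card_le_card fun x hx => by
      obtain ⟨R, hR, hx⟩ := Finset.mem_biUnion.1 hx
      obtain ⟨h1, h2⟩ := Finset.mem_inter.1 hx
      exact Finset.mem_inter.2 ⟨h1, Finset.mem_biUnion.2 ⟨R, hT R hR, h2⟩⟩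

/-- This is what makes `D` fit into `k` slots. -/
theorem Simulates.card_le (hF : Laminar F) (h : Simulates F p C D) : D.card ≤ C.card := by
  have := h.hall_biUnion hF (hitSets F C) subset_rfl
  rw [Finset.filter_true_of_mem fun d hd => by simpa using h.sub hd] at this
  exact this.trans (Finset.card_le_card Finset.inter_subset_left)

/-- Distinct roots are disjoint and each contains a page of `C`. Hence the potential is nonnegative.
-/
theorem card_hitRoots_le (hF : Laminar F) : (hitRoots F C).card ≤ C.card := by
  have hdisj : (hitRoots F C : Set (Finset ℕ)).PairwiseDisjoint fun R => C ∩ R := by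
    intro A hA B hB hAB
    refine Finset.disjoint_left.2 fun x hxA hxB => hAB ?_
    have hA' := Finset.mem_filter.1 hA
    have hB' := Finset.mem_filter.1 hB
    have hAF := (mem_hitSets.1 hA'.1).1
    have hBF := (mem_hitSets.1 hB'.1).1
    rcases hF.comparable hAF hBF
      (Finset.mem_inter.1 hxA).2 (Finset.mem_inter.1 hxB).2 with h | h
    · exact (hA'.2 B hBF h).symm
    · exact hB'.2 A hAF h
  calc (hitRoots F C).card = ∑ R ∈ hitRoots F C, 1 := by simp
    _ ≤ ∑ R ∈ hitRoots F C, (C ∩ R).card := Finset.sum_le_sum fun R hR =>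
      Finset.card_pos.2 (Finset.mem_filter.1 (Finset.mem_filter.1 hR).1).2
    _ = ((hitRoots F C).biUnion fun R => C ∩ R).card := (Finset.card_biUnion hdisj).symm
    _ ≤ _ := Finset.card_le_card fun x hx => by
      obtain ⟨R, _, hx⟩ := Finset.mem_biUnion.1 hx
      exact (Finset.mem_inter.1 hx).1

/-- Every chain of the family has at most `h` sets. -/
def ChainBound (F : Finset (Finset ℕ)) (h : ℕ) : Prop :=
  ∀ Q ⊆ F, (∀ X ∈ Q, ∀ Y ∈ Q, X ⊆ Y ∨ Y ⊆ X) → Q.card ≤ h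

/-- `D` need not change. The sets newly hit by `q` form a chain, and each adds at most one page to
the representatives outside `D`. If the maximal set around `q` was hit before, it lengthens this
chain, so at most `h - 1` sets are new and one unit is left for the growth of `|C|`; otherwise there
is a new root, which compensates that growth. -/
theorem Simulates.retrieve (hF : Laminar F) (hp : Represents F p) {h : ℕ} (hh : ChainBound F h)
    (h1 : 1 ≤ h) (hs : Simulates F p C D) {q : ℕ} (hq : q ∉ C) :
    Simulates F p (insert q C) D ∧
      ((hitSets F (insert q C)).image p \ D).card + 1 + (hitRoots F C).card ≤
        ((hitSets F C).image p \ D).card + (hitRoots F (insert q C)).card + h := by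
  have hsub : hitSets F C ⊆ hitSets F (insert q C) := hitSets_mono (Finset.subset_insert q C)
  have hmemF : ∀ {C R}, R ∈ hitSets F C → R ∈ F := fun hR => (mem_hitSets.1 hR).1
  have hnew : ∀ R ∈ hitSets F (insert q C), R ∉ hitSets F C → q ∈ R := by
    intro R hR hR'
    obtain ⟨hRF, x, hx, hxR⟩ := mem_hitSets.1 hR
    rcases Finset.mem_insert.1 hx with rfl | hx
    · exact hxR
    · exact absurd (mem_hitSets.2 ⟨hRF, x, hx, hxR⟩) hR'
  -- A newly hit set with representative in `D` lies below an old hit set with the same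
  -- representative: the two sets share this page, and the old one cannot be the smaller, or the new
  -- one would have been hit already. All invariants thus reduce to the old sets.
  have hlow : ∀ X ∈ hitSets F (insert q C), X ∉ hitSets F C → p X ∈ D →
      ∃ Z ∈ hitSets F C, X ⊆ Z ∧ p Z = p X := by
    intro X hX hX' hpX
    obtain ⟨Z, hZ, hZX⟩ := Finset.mem_image.1 (hs.sub hpX)
    have hXm := hp.mem X (hmemF hX)
    have hZm := hp.mem Z (hmemF hZ)
    rw [hZX] at hZm
    rcases hF.comparable (hmemF hX) (hmemF hZ) hXm hZm with h | h
    · exact ⟨Z, hZ, h, hZX⟩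
    · exact absurd (hitSets_up hZ (hmemF hX) h) hX'
  refine ⟨⟨hs.sub.trans (Finset.image_subset_image hsub), ?_, ?_⟩, ?_⟩
  · intro X hX Y hY hXY hpX
    by_cases hX' : X ∈ hitSets F C
    · exact hs.up X hX' Y hY hXY hpX
    obtain ⟨Z, hZ, hXZ, hZX⟩ := hlow X hX hX' hpX
    have hXm := hp.mem X (hmemF hX)
    rcases hF.comparable hY (hmemF hZ) (hXY hXm) (hXZ hXm) with h | h
    · rw [hp.eq Z (hmemF hZ) Y hY h (by rw [hZX]; exact hXY hXm), hZX]
      exact hpX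
    · exact hs.up Z hZ Y hY h (by rwa [hZX])
  · intro R hR
    by_cases hR' : R ∈ hitSets F C
    · refine le_trans (Finset.card_le_card ?_) ((hs.hall R hR').trans (Finset.card_le_card
        (Finset.inter_subset_inter_right (Finset.subset_insert q C))))
      intro d hd
      obtain ⟨hd, X, hX, hXR, rfl⟩ := mem_usedIn.1 hd
      by_cases hX' : X ∈ hitSets F C
      · exact mem_usedIn.2 ⟨hd, X, hX', hXR, rfl⟩
      obtain ⟨Z, hZ, hXZ, hZX⟩ := hlow X hX hX' hd
      have hXm := hp.mem X (hmemF hX)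
      rcases hF.comparable (hmemF hR) (hmemF hZ) (hXR hXm) (hXZ hXm) with h | h
      · exact mem_usedIn.2 ⟨hd, R, hR', subset_rfl,
          (hp.eq Z (hmemF hZ) R (hmemF hR) h (by rw [hZX]; exact hXR hXm)).trans hZX⟩
      · exact mem_usedIn.2 ⟨hd, Z, hZ, h, hZX⟩
    -- Inside a newly hit `R` only the page `p R` can be used, and `q` itself supplies the one page
    -- of the cache that is needed.
    · have hqR := hnew R hR hR'
      have : (usedIn F p (insert q C) D R) ⊆ {p R} := by
        intro d hd
        obtain ⟨hd, X, hX, hXR, rfl⟩ := mem_usedIn.1 hd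
        have hX' : X ∉ hitSets F C := fun h => hR' (hitSets_up h (hmemF hR) hXR)
        obtain ⟨Z, hZ, hXZ, hZX⟩ := hlow X hX hX' hd
        have hXm := hp.mem X (hmemF hX)
        rcases hF.comparable (hmemF hR) (hmemF hZ) (hXR hXm) (hXZ hXm) with h | h
        · rw [hp.eq Z (hmemF hZ) R (hmemF hR) h (by rw [hZX]; exact hXR hXm), hZX]
          exact Finset.mem_singleton_self _
        · exact absurd (hitSets_up hZ (hmemF hR) h) hR'
      refine (Finset.card_le_card this).trans ?_
      rw [Finset.card_singleton]
      exact Finset.card_pos.2 ⟨q, by simp [hqR]⟩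
  · let N := hitSets F (insert q C) \ hitSets F C
    have hN : ∀ X ∈ N, X ∈ F ∧ q ∈ X ∧ X ∉ hitSets F C := fun X hX => by
      obtain ⟨ha, hb⟩ := Finset.mem_sdiff.1 hX
      exact ⟨hmemF ha, hnew X ha hb, hb⟩
    have hcard : ((hitSets F (insert q C)).image p \ D).card ≤
        ((hitSets F C).image p \ D).card + N.card := by
      calc _ ≤ (((hitSets F C).image p \ D) ∪ N.image p).card := Finset.card_le_card (by
              intro d hd
              obtain ⟨hd, hdD⟩ := Finset.mem_sdiff.1 hd
              obtain ⟨X, hX, rfl⟩ := Finset.mem_image.1 hd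
              by_cases hX' : X ∈ hitSets F C
              · exact Finset.mem_union_left _ (Finset.mem_sdiff.2
                  ⟨Finset.mem_image_of_mem p hX', hdD⟩)
              · exact Finset.mem_union_right _ (Finset.mem_image_of_mem p
                  (Finset.mem_sdiff.2 ⟨hX, hX'⟩)))
        _ ≤ _ := (Finset.card_union_le _ _).trans
          (Nat.add_le_add_left Finset.card_image_le _)
    have hroots : hitRoots F C ⊆ hitRoots F (insert q C) :=
      Finset.filter_subset_filter _ hsub
    have hchain : ∀ X ∈ N, ∀ Y ∈ N, X ⊆ Y ∨ Y ⊆ X := fun X hX Y hY =>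
      hF.comparable (hN X hX).1 (hN Y hY).1 (hN X hX).2.1 (hN Y hY).2.1
    have hNF : N ⊆ F := fun X hX => (hN X hX).1
    by_cases hR : ∃ R ∈ F, q ∈ R
    · obtain ⟨R, hRF, hqR⟩ := hR
      obtain ⟨T, hT, hRT, hmax⟩ := exists_maximal_superset hRF
      have hqT := hRT hqR
      -- `T` is the maximal set around `q`. If it was hit before, it extends the chain `N` by one;
      -- if not, it becomes a new root.
      by_cases hTC : T ∈ hitSets F C
      · have hTN : T ∉ N := fun h => (hN T h).2.2 hTC
        have := hh (insert T N) (Finset.insert_subset hT hNF) (by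
          intro X hX Y hY
          refine hF.comparable (x := q) ?_ ?_ ?_ ?_
          · rcases Finset.mem_insert.1 hX with rfl | h
            · exact hT
            · exact (hN X h).1
          · rcases Finset.mem_insert.1 hY with rfl | h
            · exact hT
            · exact (hN Y h).1
          · rcases Finset.mem_insert.1 hX with rfl | h
            · exact hqT
            · exact (hN X h).2.1
          · rcases Finset.mem_insert.1 hY with rfl | h
            · exact hqT
            · exact (hN Y h).2.1)
        rw [Finset.card_insert_of_notMem hTN] at this
        have := Finset.card_le_card hroots
        omega
      · have hlt : (hitRoots F C).card < (hitRoots F (insert q C)).card := by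
          refine Finset.card_lt_card ⟨hroots, fun hsup => hTC ?_⟩
          have : T ∈ hitRoots F (insert q C) := Finset.mem_filter.2
            ⟨mem_hitSets.2 ⟨hT, q, Finset.mem_insert_self _ _, hqT⟩, hmax⟩
          exact (Finset.mem_filter.1 (hsup this)).1
        have := hh N hNF hchain
        omega
    -- A page outside all sets of the family hits nothing new, but `|C|` still grows; here `1 ≤ h`
    -- pays.
    · have : N = ∅ := Finset.eq_empty_of_forall_notMem fun X hX =>
        hR ⟨X, (hN X hX).1, (hN X hX).2.1⟩
      rw [this, Finset.card_empty] at hcard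
      have := Finset.card_le_card hroots
      omega

end

/-! ### The simulation under evictions and requests. -/

section

variable {F : Finset (Finset ℕ)} {p : Finset ℕ → ℕ} {C D : Finset ℕ}

theorem hitSets_mem {R : Finset ℕ} (h : R ∈ hitSets F C) : R ∈ F := (mem_hitSets.1 h).1

/-- Roots are disjoint, so at most one of them contains `q`, and only this one can be lost. -/
theorem card_hitRoots_le_erase (hF : Laminar F) (q : ℕ) :
    (hitRoots F C).card ≤ (hitRoots F (C.erase q)).card + 1 := by
  have h1 : hitRoots F C ⊆
      hitRoots F (C.erase q) ∪ (hitRoots F C).filter fun T => q ∈ T := by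
    intro T hT
    obtain ⟨hTS, hmax⟩ := Finset.mem_filter.1 hT
    by_cases hqT : q ∈ T
    · exact Finset.mem_union_right _ (Finset.mem_filter.2 ⟨hT, hqT⟩)
    · obtain ⟨hTF, x, hx, hxT⟩ := mem_hitSets.1 hTS
      exact Finset.mem_union_left _ (Finset.mem_filter.2 ⟨mem_hitSets.2 ⟨hTF, x,
        Finset.mem_erase.2 ⟨fun h => hqT (h ▸ hxT), hx⟩, hxT⟩, hmax⟩)
  have h2 : ((hitRoots F C).filter fun T => q ∈ T).card ≤ 1 := by
    refine Finset.card_le_one.2 fun A hA B hB => ?_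
    obtain ⟨hA, hqA⟩ := Finset.mem_filter.1 hA
    obtain ⟨hB, hqB⟩ := Finset.mem_filter.1 hB
    obtain ⟨hA, hA'⟩ := Finset.mem_filter.1 hA
    obtain ⟨hB, hB'⟩ := Finset.mem_filter.1 hB
    rcases hF.comparable (hitSets_mem hA) (hitSets_mem hB) hqA hqB with h | h
    · exact (hA' B (hitSets_mem hB) h).symm
    · exact hB' A (hitSets_mem hA) h
  exact (Finset.card_le_card h1).trans ((Finset.card_union_le _ _).trans
    (Nat.add_le_add_left h2 _))

/-- After discarding from `D` the pages that no longer represent a hit set, the Hall condition fails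
by at most one, and only at sets containing `q`, which form a chain. Dropping one suitable page used
in the smallest of them repairs them all. This page is paid by the loss of `q`: the violated set is
still hit, so no root disappears. -/
theorem Simulates.evict (hF : Laminar F) (hp : Represents F p) (hs : Simulates F p C D) {q : ℕ}
    (hq : q ∈ C) : ∃ D' ⊆ D, Simulates F p (C.erase q) D' ∧
      ((hitSets F (C.erase q)).image p \ D').card + (hitRoots F C).card ≤
        ((hitSets F C).image p \ D).card + 1 + (hitRoots F (C.erase q)).card := by
  set S' := hitSets F (C.erase q) with hS'
  let D₀ := D.filter fun d => d ∈ S'.image p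
  have hS : S' ⊆ hitSets F C := hitSets_mono (Finset.erase_subset q C)
  have hD₀ : D₀ ⊆ D := Finset.filter_subset _ _
  have hsub₀ : D₀ ⊆ S'.image p := fun d hd => (Finset.mem_filter.1 hd).2
  have hup₀ : ∀ X ∈ S', ∀ Y ∈ F, X ⊆ Y → p X ∈ D₀ → p Y ∈ D₀ := fun X hX Y hY hXY h =>
    Finset.mem_filter.2 ⟨hs.up X (hS hX) Y hY hXY (hD₀ h),
      Finset.mem_image_of_mem p (hitSets_up hX hY hXY)⟩
  have hused₀ : ∀ R, usedIn F p (C.erase q) D₀ R ⊆ usedIn F p C D R := by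
    intro R d hd
    obtain ⟨hd, X, hX, h⟩ := mem_usedIn.1 hd
    exact mem_usedIn.2 ⟨hD₀ hd, X, hS hX, h⟩
  have hC' : ∀ R, (C ∩ R).card ≤ (C.erase q ∩ R).card + 1 := by
    intro R
    have : C ∩ R ⊆ insert q (C.erase q ∩ R) := by
      intro x hx
      obtain ⟨h1, h2⟩ := Finset.mem_inter.1 hx
      by_cases h : x = q
      · exact Finset.mem_insert.2 (Or.inl h)
      · exact Finset.mem_insert_of_mem (Finset.mem_inter.2 ⟨Finset.mem_erase.2 ⟨h, h1⟩, h2⟩)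
    exact (Finset.card_le_card this).trans (Finset.card_insert_le _ _)
  have hCq : ∀ R, q ∉ R → C ∩ R ⊆ C.erase q ∩ R := by
    intro R hqR x hx
    obtain ⟨h1, h2⟩ := Finset.mem_inter.1 hx
    exact Finset.mem_inter.2 ⟨Finset.mem_erase.2 ⟨fun h => hqR (h ▸ h2), h1⟩, h2⟩
  have himg : S'.image p \ D₀ ⊆ (hitSets F C).image p \ D := by
    intro d hd
    obtain ⟨h1, h2⟩ := Finset.mem_sdiff.1 hd
    exact Finset.mem_sdiff.2 ⟨Finset.image_subset_image hS h1,
      fun h => h2 (Finset.mem_filter.2 ⟨h, h1⟩)⟩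
  by_cases hv : ∃ R ∈ S', (C.erase q ∩ R).card < (usedIn F p (C.erase q) D₀ R).card
  swap
  · push Not at hv
    refine ⟨D₀, hD₀, ⟨hsub₀, hup₀, hv⟩, ?_⟩
    have h1 := Finset.card_le_card himg
    have h2 := card_hitRoots_le_erase (C := C) hF q
    omega
  -- A hit set without `q` keeps all its cached pages, so its Hall condition survives.
  have hviol : ∀ R ∈ S', (C.erase q ∩ R).card < (usedIn F p (C.erase q) D₀ R).card → q ∈ R := by
    intro R hR h
    by_contra hqR
    have h1 := hs.hall R (hS hR)
    have h2 := Finset.card_le_card (hused₀ R)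
    have h3 := Finset.card_le_card (hCq R hqR)
    omega
  obtain ⟨R₀, hR₀, hmin⟩ := Finset.exists_min_image
    (S'.filter fun R => (C.erase q ∩ R).card < (usedIn F p (C.erase q) D₀ R).card) Finset.card
    (by obtain ⟨R, hR, h⟩ := hv; exact ⟨R, Finset.mem_filter.2 ⟨hR, h⟩⟩)
  obtain ⟨hR₀, hR₀v⟩ := Finset.mem_filter.1 hR₀
  have hqR₀ := hviol R₀ hR₀ hR₀v
  have hR₀F := hitSets_mem hR₀
  have hpos : 0 < (C.erase q ∩ R₀).card := Finset.card_pos.2 (Finset.mem_filter.1 hR₀).2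
  -- The page to drop must not break upward closure. Among the pages other than `p R₀` used in the
  -- smallest violated set `R₀`, one is taken for which the largest set it represents (of size `m
  -- X`) is as small as possible. There is a candidate: `R₀` is still hit, so violation means that
  -- at least two pages are used.
  let Q := S'.filter fun X => X ⊆ R₀ ∧ p X ∈ D₀ ∧ p X ≠ p R₀
  let m : Finset ℕ → ℕ := fun X => (F.filter fun Y => p Y = p X).sup Finset.card
  obtain ⟨X, hXQ, hXmin⟩ : ∃ X ∈ Q, ∀ X' ∈ Q, m X ≤ m X' := by
    refine Finset.exists_min_image Q m ?_
    obtain ⟨d, hd, hne⟩ := Finset.exists_mem_ne (s := usedIn F p (C.erase q) D₀ R₀)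
      (by omega) (p R₀)
    obtain ⟨hd, X, hX, hXR, rfl⟩ := mem_usedIn.1 hd
    exact ⟨X, Finset.mem_filter.2 ⟨hX, hXR, hd, hne⟩⟩
  obtain ⟨hX, hXR₀, hXD, hXne⟩ := Finset.mem_filter.1 hXQ
  have hXF := hitSets_mem hX
  refine ⟨D₀.erase (p X), (Finset.erase_subset _ _).trans hD₀,
    ⟨(Finset.erase_subset _ _).trans hsub₀, ?_, ?_⟩, ?_⟩
  -- Suppose `p X₁` is kept, `X₁ ⊆ Y₁`, and `p Y₁` is the dropped page. Then `Y₁ ⊆ R₀`, as otherwise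
  -- `R₀` would have the dropped page as its representative; so `X₁` was a candidate. But the
  -- largest set represented by `p X₁` is strictly inside `Y₁`, contradicting the minimality of `m
  -- X`.
  · intro X₁ hX₁ Y₁ hY₁ hXY h
    obtain ⟨hne, hX₁D⟩ := Finset.mem_erase.1 h
    refine Finset.mem_erase.2 ⟨fun hY₁X => ?_, hup₀ X₁ hX₁ Y₁ hY₁ hXY hX₁D⟩
    have hX₁F := hitSets_mem hX₁
    have hmR : p X ∈ R₀ := hXR₀ (hp.mem X hXF)
    have hmY : p X ∈ Y₁ := by rw [← hY₁X]; exact hp.mem Y₁ hY₁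
    have hYR : Y₁ ⊆ R₀ := by
      rcases hF.comparable hY₁ hR₀F hmY hmR with h | h
      · exact h
      · exact absurd (hp.eq Y₁ hY₁ R₀ hR₀F h (by rwa [hY₁X])).symm (by rwa [hY₁X])
    have hX₁Q : X₁ ∈ Q := by
      refine Finset.mem_filter.2 ⟨hX₁, hXY.trans hYR, hX₁D, fun he => hXne ?_⟩
      have := hp.eq R₀ hR₀F Y₁ hY₁ hYR (by rw [← he]; exact hXY (hp.mem X₁ hX₁F))
      rw [← hY₁X, this]
    have hle := hXmin X₁ hX₁Q
    have h1 : Y₁.card ≤ m X := Finset.le_sup (f := Finset.card)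
      (Finset.mem_filter.2 ⟨hY₁, hY₁X⟩)
    obtain ⟨Y, hY, hYm⟩ := Finset.exists_mem_eq_sup (F.filter fun Y => p Y = p X₁)
      ⟨X₁, Finset.mem_filter.2 ⟨hX₁F, rfl⟩⟩ Finset.card
    obtain ⟨hYF, hYp⟩ := Finset.mem_filter.1 hY
    have hmY₁ := hXY (hp.mem X₁ hX₁F)
    have hmY' : p X₁ ∈ Y := by rw [← hYp]; exact hp.mem Y hYF
    have hlt : Y.card < Y₁.card := by
      rcases hF.comparable hYF hY₁ hmY' hmY₁ with h | h
      · refine Finset.card_lt_card ⟨h, fun h' => hne ?_⟩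
        rw [← hYp, ← hY₁X, Finset.Subset.antisymm h h']
      · exact absurd (by rw [← hYp, ← hp.eq Y hYF Y₁ hY₁ h (by rwa [hYp]), hY₁X]) hne
    have : m X₁ = Y.card := hYm
    omega
  · intro R hR
    have hsub : usedIn F p (C.erase q) (D₀.erase (p X)) R ⊆
        (usedIn F p (C.erase q) D₀ R).erase (p X) := by
      intro d hd
      obtain ⟨hd, hZ⟩ := mem_usedIn.1 hd
      obtain ⟨h1, h2⟩ := Finset.mem_erase.1 hd
      exact Finset.mem_erase.2 ⟨h1, mem_usedIn.2 ⟨h2, hZ⟩⟩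
    have hcard := Finset.card_le_card hsub
    -- By minimality of `R₀`, every violated set contains `R₀` and therefore uses the dropped page;
    -- its excess was exactly one.
    by_cases hRv : (C.erase q ∩ R).card < (usedIn F p (C.erase q) D₀ R).card
    · have hqR := hviol R hR hRv
      have hRR : R₀ ⊆ R := by
        rcases hF.comparable hR₀F (hitSets_mem hR) hqR₀ hqR with h | h
        · exact h
        · exact (Finset.eq_of_subset_of_card_le h
            (hmin R (Finset.mem_filter.2 ⟨hR, hRv⟩))).ge
      rw [Finset.card_erase_of_mem (mem_usedIn.2 ⟨hXD, X, hX, hXR₀.trans hRR, rfl⟩)] at hcard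
      have h1 := hs.hall R (hS hR)
      have h2 := Finset.card_le_card (hused₀ R)
      have h3 := hC' R
      omega
    · have := Finset.card_le_card (Finset.erase_subset (p X) (usedIn F p (C.erase q) D₀ R))
      omega
  · have h1 : S'.image p \ D₀.erase (p X) ⊆ insert (p X) (S'.image p \ D₀) := by
      intro d hd
      obtain ⟨h1, h2⟩ := Finset.mem_sdiff.1 hd
      by_cases h : d = p X
      · exact Finset.mem_insert.2 (Or.inl h)
      · exact Finset.mem_insert_of_mem (Finset.mem_sdiff.2
          ⟨h1, fun h' => h2 (Finset.mem_erase.2 ⟨h, h'⟩)⟩)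
    have h2 := (Finset.card_le_card h1).trans (Finset.card_insert_le _ _)
    have h3 := Finset.card_le_card himg
    -- A root around `q` contains `R₀`, which is still hit by another page.
    have h4 : hitRoots F C ⊆ hitRoots F (C.erase q) := by
      intro T hT
      obtain ⟨hTS, hmax⟩ := Finset.mem_filter.1 hT
      refine Finset.mem_filter.2 ⟨?_, hmax⟩
      obtain ⟨hTF, x, hx, hxT⟩ := mem_hitSets.1 hTS
      by_cases hxq : x = q
      · subst hxq
        rcases hF.comparable hTF hR₀F hxT hqR₀ with h | h
        · rw [← hmax R₀ hR₀F h]; exact hR₀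
        · exact hitSets_up hR₀ hTF h
      · exact mem_hitSets.2 ⟨hTF, x, Finset.mem_erase.2 ⟨hxq, hx⟩, hxT⟩
    have h5 := Finset.card_le_card h4
    omega

/-- If `p P` is not yet in `D`, it is one of the representatives outside `D`, so adding it lowers
their number by the one unit that it costs. Redirecting creates no new representatives of hit sets,
because `P` itself is hit. -/
theorem Simulates.request (hF : Laminar F) (hp : Represents F p) (hs : Simulates F p C D)
    {P : Finset ℕ} (hP : P ∈ hitSets F C) : ∃ D', p P ∈ D' ∧ D' ⊆ insert (p P) D ∧
      Simulates F (redirect p P) C D' ∧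
      ((hitSets F C).image (redirect p P) \ D').card + (D' \ D).card ≤
        ((hitSets F C).image p \ D).card := by
  have hPF := hitSets_mem hP
  have hpos : ∀ {R}, P ⊆ R → redirect p P R = p P := fun h => if_pos h
  have hneg : ∀ {R}, ¬ P ⊆ R → redirect p P R = p R := fun h => if_neg h
  have himg : (hitSets F C).image (redirect p P) ⊆ (hitSets F C).image p := by
    intro d hd
    obtain ⟨X, hX, rfl⟩ := Finset.mem_image.1 hd
    by_cases h : P ⊆ X
    · rw [hpos h]; exact Finset.mem_image_of_mem p hP
    · rw [hneg h]; exact Finset.mem_image_of_mem p hX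
  let D' := (insert (p P) D).filter fun d => d ∈ (hitSets F C).image (redirect p P)
  have hD' : ∀ {d}, d ∈ D' → d ∈ insert (p P) D := fun h => (Finset.mem_filter.1 h).1
  have hvD' : p P ∈ D' := Finset.mem_filter.2 ⟨Finset.mem_insert_self _ _,
    Finset.mem_image.2 ⟨P, hP, hpos subset_rfl⟩⟩
  have hvP := hp.mem P hPF
  refine ⟨D', hvD', fun d hd => hD' hd, ⟨fun d hd => (Finset.mem_filter.1 hd).2, ?_, ?_⟩, ?_⟩
  · intro X hX Y hY hXY h
    by_cases hPY : P ⊆ Y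
    · rwa [hpos hPY]
    have hPX : ¬ P ⊆ X := fun h => hPY (h.trans hXY)
    refine Finset.mem_filter.2 ⟨?_, Finset.mem_image_of_mem _ (hitSets_up hX hY hXY)⟩
    rw [hneg hPX] at h
    rw [hneg hPY]
    rcases Finset.mem_insert.1 (hD' h) with h' | h'
    · have hvY : p P ∈ Y := hXY (by rw [← h']; exact hp.mem X (hitSets_mem hX))
      rcases hF.comparable hPF hY hvP hvY with h1 | h1
      · exact absurd h1 hPY
      · rw [hp.eq P hPF Y hY h1 hvY]
        exact Finset.mem_insert_self _ _
    · exact Finset.mem_insert_of_mem (hs.up X hX Y hY hXY h')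
  · intro R hR
    by_cases hv : p P ∈ D
    · refine (Finset.card_le_card ?_).trans (hs.hall R hR)
      intro d hd
      obtain ⟨hd, X, hX, hXR, rfl⟩ := mem_usedIn.1 hd
      have hd' := hD' hd
      rw [Finset.insert_eq_of_mem hv] at hd'
      refine mem_usedIn.2 ⟨hd', ?_⟩
      by_cases h : P ⊆ X
      · exact ⟨P, hP, h.trans hXR, (hpos h).symm⟩
      · exact ⟨X, hX, hXR, (hneg h).symm⟩
    -- Upward closure, read backwards: when `p P` is outside `D`, so are the representatives of all
    -- hit subsets of `P`.
    have hlow : ∀ X ∈ hitSets F C, X ⊆ P → p X ∉ D := fun X hX h hX' =>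
      hv (hs.up X hX P hPF h hX')
    by_cases hPR : P ⊆ R
    -- The old pages still used in `R ⊇ P` belong to sets disjoint from `P`. These sets miss the
    -- pages of `C` in `P`, and there is at least one such page, so the Hall bound for them is
    -- strict and leaves room for `p P`.
    · let Q := (hitSets F C).filter fun X => X ⊆ R ∧ Disjoint X P
      have h1 : usedIn F (redirect p P) C D' R ⊆
          insert (p P) (D.filter fun d => ∃ X ∈ Q, p X = d) := by
        intro d hd
        obtain ⟨hd, X, hX, hXR, rfl⟩ := mem_usedIn.1 hd
        by_cases hPX : P ⊆ X
        · rw [hpos hPX]; exact Finset.mem_insert_self _ _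
        have hd' := hD' hd
        rw [hneg hPX] at hd' ⊢
        rcases Finset.mem_insert.1 hd' with h | h
        · rw [h]; exact Finset.mem_insert_self _ _
        refine Finset.mem_insert_of_mem (Finset.mem_filter.2 ⟨h, X,
          Finset.mem_filter.2 ⟨hX, hXR, ?_⟩, rfl⟩)
        rcases hF.cases X (hitSets_mem hX) P hPF with h' | h' | h'
        · exact h'
        · exact absurd h (hlow X hX h')
        · exact absurd h' hPX
      have h2 := hs.hall_biUnion hF Q (Finset.filter_subset _ _)
      have h3 : (C ∩ Q.biUnion id).card < (C ∩ R).card := by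
        refine Finset.card_lt_card ⟨fun x hx => ?_, fun h => ?_⟩
        · obtain ⟨hxC, hx⟩ := Finset.mem_inter.1 hx
          obtain ⟨X, hX, hxX⟩ := Finset.mem_biUnion.1 hx
          exact Finset.mem_inter.2 ⟨hxC, (Finset.mem_filter.1 hX).2.1 hxX⟩
        · obtain ⟨_, x, hxC, hxP⟩ := mem_hitSets.1 hP
          obtain ⟨_, hx⟩ := Finset.mem_inter.1 (h (Finset.mem_inter.2 ⟨hxC, hPR hxP⟩))
          obtain ⟨X, hX, hxX⟩ := Finset.mem_biUnion.1 hx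
          exact Finset.disjoint_left.1 (Finset.mem_filter.1 hX).2.2 hxX hxP
      have h4 := (Finset.card_le_card h1).trans (Finset.card_insert_le _ _)
      omega
    have hnegR : ∀ X, X ⊆ R → redirect p P X = p X := fun X h =>
      hneg fun h' => hPR (h'.trans h)
    by_cases hvR : p P ∈ R
    · have hRP : R ⊆ P := by
        rcases hF.comparable hPF (hitSets_mem hR) hvP hvR with h | h
        · exact absurd h hPR
        · exact h
      have h1 : usedIn F (redirect p P) C D' R ⊆ {p P} := by
        intro d hd
        obtain ⟨hd, X, hX, hXR, rfl⟩ := mem_usedIn.1 hd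
        rcases Finset.mem_insert.1 (hD' hd) with h | h
        · exact Finset.mem_singleton.2 h
        · rw [hnegR X hXR] at h
          exact absurd h (hlow X hX (hXR.trans hRP))
      refine (Finset.card_le_card h1).trans ?_
      rw [Finset.card_singleton]
      exact Finset.card_pos.2 (Finset.mem_filter.1 hR).2
    · refine (Finset.card_le_card ?_).trans (hs.hall R hR)
      intro d hd
      obtain ⟨hd, X, hX, hXR, rfl⟩ := mem_usedIn.1 hd
      have hd' := hD' hd
      rw [hnegR X hXR] at hd' ⊢
      rcases Finset.mem_insert.1 hd' with h | h
      · exact absurd (hXR (by rw [← h]; exact hp.mem X (hitSets_mem hX))) hvR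
      · exact mem_usedIn.2 ⟨h, X, hX, hXR, rfl⟩
  · have hout : ∀ d ∈ (hitSets F C).image (redirect p P) \ D', d ∈ (hitSets F C).image p ∧
        d ∉ insert (p P) D := by
      intro d hd
      obtain ⟨h1, h2⟩ := Finset.mem_sdiff.1 hd
      exact ⟨himg h1, fun h => h2 (Finset.mem_filter.2 ⟨h, h1⟩)⟩
    by_cases hv : p P ∈ D
    · have h1 : D' \ D = ∅ := by
        rw [Finset.sdiff_eq_empty_iff_subset]
        intro d hd
        have := hD' hd
        rwa [Finset.insert_eq_of_mem hv] at this
      rw [h1, Finset.card_empty, add_zero]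
      refine Finset.card_le_card fun d hd => ?_
      obtain ⟨h1, h2⟩ := hout d hd
      exact Finset.mem_sdiff.2 ⟨h1, fun h => h2 (Finset.mem_insert_of_mem h)⟩
    · have h1 : D' \ D ⊆ {p P} := by
        intro d hd
        obtain ⟨h1, h2⟩ := Finset.mem_sdiff.1 hd
        rcases Finset.mem_insert.1 (hD' h1) with h | h
        · exact Finset.mem_singleton.2 h
        · exact absurd h h2
      have h2 : (hitSets F C).image (redirect p P) \ D' ⊆
          ((hitSets F C).image p \ D).erase (p P) := by
        intro d hd
        obtain ⟨h1, h2⟩ := hout d hd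
        exact Finset.mem_erase.2 ⟨fun h => h2 (h ▸ Finset.mem_insert_self _ _),
          Finset.mem_sdiff.2 ⟨h1, fun h => h2 (Finset.mem_insert_of_mem h)⟩⟩
      have hvm : p P ∈ (hitSets F C).image p \ D :=
        Finset.mem_sdiff.2 ⟨Finset.mem_image_of_mem p hP, hv⟩
      have h3 := Finset.card_le_card h1
      have h4 := Finset.card_le_card h2
      rw [Finset.card_erase_of_mem hvm] at h4
      have h5 := Finset.card_pos.2 ⟨_, hvm⟩
      rw [Finset.card_singleton] at h3
      omega

/-- Moving from the pages `C` to the pages `C'`. -/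
theorem Simulates.move (hF : Laminar F) (hp : Represents F p) {h : ℕ} (hh : ChainBound F h)
    (h1 : 1 ≤ h) (hs : Simulates F p C D) (C' : Finset ℕ) : ∃ D' ⊆ D, Simulates F p C' D' ∧
      ((hitSets F C').image p \ D').card + C'.card + (hitRoots F C).card ≤
        ((hitSets F C).image p \ D).card + C.card + (hitRoots F C').card +
          h * (C' \ C).card := by
  -- The move is split into single evictions, followed by single retrievals. Throughout, `D` only
  -- shrinks, so no cost arises before the request itself is treated.
  have hev : ∀ (E C D : Finset ℕ), Simulates F p C D → E ⊆ C → ∃ D' ⊆ D,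
      Simulates F p (C \ E) D' ∧
      ((hitSets F (C \ E)).image p \ D').card + (C \ E).card + (hitRoots F C).card ≤
        ((hitSets F C).image p \ D).card + C.card + (hitRoots F (C \ E)).card := by
    intro E
    induction E using Finset.induction_on with
    | empty => intro C D hs _; exact ⟨D, subset_rfl, by simpa using hs, by simp⟩
    | insert q E hqE ih =>
      intro C D hs hE
      obtain ⟨D₁, hD₁, hs₁, hle₁⟩ := ih C D hs ((Finset.subset_insert q E).trans hE)
      have hq : q ∈ C \ E := Finset.mem_sdiff.2 ⟨hE (Finset.mem_insert_self q E), hqE⟩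
      obtain ⟨D₂, hD₂, hs₂, hle₂⟩ := hs₁.evict hF hp hq
      have he : C \ insert q E = (C \ E).erase q := by
        ext x; simp only [Finset.mem_sdiff, Finset.mem_insert, Finset.mem_erase]; tauto
      rw [he]
      refine ⟨D₂, hD₂.trans hD₁, hs₂, ?_⟩
      have := Finset.card_erase_add_one hq
      omega
  have hin : ∀ (E C D : Finset ℕ), Simulates F p C D → Disjoint E C →
      Simulates F p (E ∪ C) D ∧
      ((hitSets F (E ∪ C)).image p \ D).card + (E ∪ C).card + (hitRoots F C).card ≤
        ((hitSets F C).image p \ D).card + C.card + (hitRoots F (E ∪ C)).card + h * E.card := by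
    intro E
    induction E using Finset.induction_on with
    | empty => intro C D hs _; exact ⟨by simpa using hs, by simp⟩
    | insert q E hqE ih =>
      intro C D hs hE
      rw [Finset.disjoint_insert_left] at hE
      obtain ⟨hs₁, hle₁⟩ := ih C D hs hE.2
      have hq : q ∉ E ∪ C := by simp [hqE, hE.1]
      obtain ⟨hs₂, hle₂⟩ := hs₁.retrieve hF hp hh h1 hq
      rw [Finset.insert_union]
      refine ⟨hs₂, ?_⟩
      rw [Finset.card_insert_of_notMem hq, Finset.card_insert_of_notMem hqE, Nat.mul_succ]
      omega
  obtain ⟨D₁, hD₁, hs₁, hle₁⟩ := hev (C \ C') C D hs Finset.sdiff_subset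
  have hdisj : Disjoint (C' \ C) (C \ (C \ C')) :=
    Finset.disjoint_of_subset_right Finset.sdiff_subset Finset.sdiff_disjoint
  have he : C' \ C ∪ C \ (C \ C') = C' := by
    rw [Finset.sdiff_sdiff_self_left, Finset.inter_comm, Finset.sdiff_union_inter]
  obtain ⟨hs₂, hle₂⟩ := hin (C' \ C) _ D₁ hs₁ hdisj
  rw [he] at hs₂ hle₂
  exact ⟨D₁, hD₁, hs₂, by omega⟩

end

/-! ### From slots to sets of pages, and the cost of the derived instance. -/

/-- The pages in a cache. -/
def Cache.pages {k : ℕ} (C : Cache k) : Finset ℕ :=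
  Finset.univ.biUnion fun s => (C s).toFinset

theorem Cache.mem_pages {k : ℕ} {C : Cache k} {x : ℕ} : x ∈ C.pages ↔ ∃ s, C s = some x := by
  simp [pages, Option.mem_def]

theorem Cache.card_pages_le {k : ℕ} (C : Cache k) : C.pages.card ≤ k := by
  refine Finset.card_biUnion_le.trans ((Finset.sum_le_card_nsmul _ _ 1 fun s _ => ?_).trans
    (by simp))
  cases C s <;> simp

theorem Cache.card_pages_sdiff_le {k : ℕ} (C C' : Cache k) :
    (C'.pages \ C.pages).card ≤ Cache.retrievals C C' := by
  classical
  have hfin : ({s : Fin k | ∃ p : ℕ, C' s = some p ∧ C s ≠ some p} : Set (Fin k)) =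
      ((Finset.univ.filter fun s => ∃ p : ℕ, C' s = some p ∧ C s ≠ some p : Finset (Fin k)) :
        Set (Fin k)) := by ext; simp
  rw [retrievals, hfin, Set.ncard_coe_finset]
  have : C'.pages \ C.pages ⊆ (Finset.univ.filter fun s =>
      ∃ p : ℕ, C' s = some p ∧ C s ≠ some p).biUnion fun s => (C' s).toFinset := by
    intro x hx
    obtain ⟨h1, h2⟩ := Finset.mem_sdiff.1 hx
    obtain ⟨s, hs⟩ := Cache.mem_pages.1 h1
    refine Finset.mem_biUnion.2 ⟨s, Finset.mem_filter.2 ⟨Finset.mem_univ _, x, hs, fun h => h2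
      (Cache.mem_pages.2 ⟨s, h⟩)⟩, by simp [hs]⟩
  refine (Finset.card_le_card this).trans (Finset.card_biUnion_le.trans
    ((Finset.sum_le_card_nsmul _ _ 1 fun s _ => ?_).trans (by simp)))
  cases C' s <;> simp

/-- Amortisation with the potential `|p(hit sets) \ D| + |C| - #roots`, written without subtraction:
the root term stands on the left, and the induction ends because there are at most `|C|` roots. -/
theorem Simulates.exists_serves {F : Finset (Finset ℕ)} (hF : Laminar F) {h k : ℕ}
    (hh : ChainBound F h) (h1 : 1 ≤ h) :
    ∀ (rs : List (Finset ℕ)) (Cs : List (Cache k)) (p : Finset ℕ → ℕ) (C : Cache k)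
      (D : Finset ℕ), Represents F p → Simulates F p C.pages D → (∀ R ∈ rs, R ∈ F) →
      List.Forall₂ (fun c R => Cache.Satisfies c R) Cs rs →
      ∃ c, Serves k D (pageSeq p rs) c ∧ c + (hitRoots F C.pages).card ≤
        h * Cache.costFrom C Cs + ((hitSets F C.pages).image p \ D).card + C.pages.card := by
  intro rs
  induction rs with
  | nil =>
    intro Cs p C D hp hs _ _
    have := card_hitRoots_le (C := C.pages) hF
    exact ⟨0, Serves.nil D, by omega⟩
  | cons P rs ih =>
    intro Cs p C D hp hs hrs hCs
    obtain ⟨C', Cs, hsat, hCs', rfl⟩ := List.forall₂_cons_right_iff.1 hCs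
    obtain ⟨D₁, hD₁, hs₁, hle₁⟩ := hs.move hF hp hh h1 C'.pages
    have hPF := hrs P (by simp)
    have hP : P ∈ hitSets F C'.pages := by
      obtain ⟨x, hxP, s, hs⟩ := hsat
      exact mem_hitSets.2 ⟨hPF, x, Cache.mem_pages.2 ⟨s, hs⟩, hxP⟩
    obtain ⟨D₂, hv, hsub, hs₂, hle₂⟩ := hs₁.request hF hp hP
    obtain ⟨c, hc, hle₃⟩ := ih Cs (LaminarPaging.redirect p P) C' D₂ (hp.redirect hF hPF) hs₂
      (fun R hR => hrs R (by simp [hR])) hCs'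
    refine ⟨_, Serves.cons ((hs₂.card_le hF).trans C'.card_pages_le) hv hc, ?_⟩
    have h2 : (D₂ \ D).card ≤ (D₂ \ D₁).card := by
      refine Finset.card_le_card fun x hx => ?_
      obtain ⟨h1, h2⟩ := Finset.mem_sdiff.1 hx
      exact Finset.mem_sdiff.2 ⟨h1, fun h => h2 (hD₁ h)⟩
    have h3 := Nat.mul_le_mul_left h (Cache.card_pages_sdiff_le C C')
    rw [Cache.costFrom, Nat.mul_add]
    omega

/-- The smallest page of a set. -/
def minPage (R : Finset ℕ) : ℕ := (R.sort (· ≤ ·)).headD 0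

theorem minPage_mem {R : Finset ℕ} (h : R.Nonempty) : minPage R ∈ R := by
  have hne : R.sort (· ≤ ·) ≠ [] := fun h' => by
    have := congrArg List.length h'
    simp at this
    simp [this] at h
  obtain ⟨a, l, hl⟩ := List.exists_cons_of_ne_nil hne
  have : a ∈ R.sort (· ≤ ·) := by rw [hl]; simp
  rw [minPage, hl]
  simpa using this

theorem minPage_le {R : Finset ℕ} {x : ℕ} (h : x ∈ R) : minPage R ≤ x := by
  have hx : x ∈ R.sort (· ≤ ·) := by simpa using h
  have hs := R.pairwise_sort (· ≤ ·)
  rw [minPage]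
  cases hl : R.sort (· ≤ ·) with
  | nil => simp [hl] at hx
  | cons a l =>
    rw [hl] at hx hs
    rcases List.mem_cons.1 hx with rfl | hx
    · simp
    · simpa using List.rel_of_pairwise_cons hs hx

theorem represents_minPage {F : Finset (Finset ℕ)} (hF : Laminar F) : Represents F minPage where
  mem R hR := minPage_mem (hF.nonempty R hR)
  eq _ _ Y hY hYZ h := le_antisymm (minPage_le h)
    (minPage_le (hYZ (minPage_mem (hF.nonempty Y hY))))

theorem PagingInput.laminar (I : PagingInput) (hI : IsLaminar I.family) :
    Laminar I.family.toFinset where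
  nonempty R hR := I.nonempty_of_mem R (by simpa using hR)
  cases R hR R' hR' := hI R (by simpa using hR) R' (by simpa using hR')

/-- In a chain, sets are determined by their cardinalities; listing these in increasing order gives
the strictly monotone sequence required by `height`. The supremum is over a bounded set, since such
a sequence injects into the finite family. -/
theorem chainBound_height (P : List (Finset ℕ)) : ChainBound P.toFinset (height P) := by
  intro Q hQ hcomp
  have hinj : ∀ X ∈ Q, ∀ Y ∈ Q, X.card = Y.card → X = Y := fun X hX Y hY h => by
    rcases hcomp X hX Y hY with h' | h'
    · exact Finset.eq_of_subset_of_card_le h' h.ge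
    · exact (Finset.eq_of_subset_of_card_le h' h.le).symm
  have hcard : (Q.image Finset.card).card = Q.card :=
    Finset.card_image_of_injOn fun X hX Y hY h => hinj X hX Y hY h
  let e := (Q.image Finset.card).orderEmbOfFin hcard
  have he : ∀ i, ∃ X ∈ Q, X.card = e i := fun i =>
    Finset.mem_image.1 ((Q.image Finset.card).orderEmbOfFin_mem hcard i)
  choose R hRQ hR using he
  refine le_csSup ⟨P.toFinset.card, ?_⟩ ⟨R, ?_, fun i => by simpa using hQ (hRQ i)⟩
  · rintro n ⟨R, hR, hRP⟩
    have := Finset.card_le_card_of_injOn (s := (Finset.univ : Finset (Fin n))) (t := P.toFinset) R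
      (fun i _ => by simpa using hRP i) hR.injective.injOn
    simpa using this
  · intro i j hij
    have hlt : (R i).card < (R j).card := by
      rw [hR, hR]; exact e.strictMono hij
    rcases hcomp _ (hRQ i) _ (hRQ j) with h | h
    · exact lt_of_le_of_ne h fun h' => by rw [h'] at hlt; exact lt_irrefl _ hlt
    · exact absurd (Finset.card_le_card h) (by omega)

theorem PagingInput.exists_solution (I : PagingInput) :
    ∃ C, I.IsSolution C ∧ I.cost C = I.opt := by
  have hne : {c : ℕ | ∃ C, I.IsSolution C ∧ I.cost C = c}.Nonempty := by
    refine ⟨_, I.requests.map fun R _ => some (minPage R), ?_, rfl⟩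
    rw [IsSolution, List.forall₂_map_left_iff, List.forall₂_same]
    exact fun R hR => ⟨minPage R, minPage_mem (I.nonempty_of_mem R (I.requests_mem R hR)),
      ⟨0, I.k_pos⟩, rfl⟩
  exact Nat.sInf_mem hne

/-- The derived paging instance has a solution that costs at most `height` times the optimum. -/
theorem PagingInput.exists_serves (I : PagingInput) (hI : IsLaminar I.family) :
    ∃ c, Serves I.k ∅ (pageSeq minPage I.requests) c ∧ c ≤ height I.family * I.opt := by
  obtain ⟨C, hC, hopt⟩ := I.exists_solution
  have hF := I.laminar hI
  -- Without requests the family may be empty and the height `0`; the potential argument needs `1 ≤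
  -- h`.
  rcases hreq : I.requests with _ | ⟨R, rs⟩
  · exact ⟨0, Serves.nil _, Nat.zero_le _⟩
  have hh := chainBound_height I.family
  have h1 : 1 ≤ height I.family := by
    have hR : R ∈ I.family := I.requests_mem R (by simp [hreq])
    simpa using hh {R} (by simpa using hR) (by simp)
  have hempty : (Cache.empty I.k).pages = ∅ := by
    ext x; simp [Cache.mem_pages, Cache.empty]
  have hhit : hitSets I.family.toFinset ∅ = ∅ := by
    ext R; simp [mem_hitSets]
  have hs : Simulates I.family.toFinset minPage (Cache.empty I.k).pages ∅ := by
    rw [hempty]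
    exact ⟨by simp, by simp [hhit], by simp [hhit]⟩
  obtain ⟨c, hc, hle⟩ := Simulates.exists_serves hF hh h1 I.requests C minPage
    (Cache.empty I.k) ∅ (represents_minPage hF) hs
    (fun R hR => by simpa using I.requests_mem R hR) hC
  rw [hempty, hhit, Finset.image_empty, Finset.empty_sdiff, Finset.card_empty, add_zero,
    add_zero] at hle
  rw [hreq] at hc
  refine ⟨c, hc, ?_⟩
  rw [← hopt]
  exact (Nat.le_add_right _ _).trans hle

/-! ## Caches given by lists of pages -/

/-- The configuration whose slot `i` holds the `i`-th page of a list. -/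
def slotCache (k : ℕ) (l : List ℕ) : Cache k := fun i => l[i.val]?

theorem retrievals_le_one {k : ℕ} {C C' : Cache k} (i : ℕ)
    (h : ∀ s : Fin k, s.val ≠ i → ∀ p, C' s = some p → C s = some p) :
    Cache.retrievals C C' ≤ 1 := by
  refine (Set.ncard_le_one (Set.toFinite _)).2 fun s hs t ht => ?_
  obtain ⟨p, hp, hp'⟩ := hs
  obtain ⟨q, hq, hq'⟩ := ht
  have h1 : s.val = i := by by_contra h1; exact hp' (h s h1 p hp)
  have h2 : t.val = i := by by_contra h2; exact hq' (h t h2 q hq)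
  exact Fin.ext (h1.trans h2.symm)

theorem retrievals_self {k : ℕ} (C : Cache k) : Cache.retrievals C C = 0 := by
  simp [Cache.retrievals]

theorem retrievals_append (k : ℕ) (l : List ℕ) (v : ℕ) :
    Cache.retrievals (slotCache k l) (slotCache k (l ++ [v])) ≤ 1 := by
  refine retrievals_le_one l.length fun s hs p hp => ?_
  simp only [slotCache] at hp ⊢
  rcases Nat.lt_or_ge s.val l.length with h | h
  · rwa [List.getElem?_append_left h] at hp
  · rw [List.getElem?_eq_none (by simp; omega)] at hp
    simp at hp

theorem retrievals_singleton (k : ℕ) (C : Cache k) (v : ℕ) :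
    Cache.retrievals C (slotCache k [v]) ≤ 1 := by
  refine retrievals_le_one 0 fun s hs p hp => ?_
  simp only [slotCache] at hp
  rw [List.getElem?_eq_none (by simp; omega)] at hp
  simp at hp

/-- The list `l` with `v` in the place of `y`. -/
def replacePage (l : List ℕ) (y v : ℕ) : List ℕ := l.map fun x => if x = y then v else x

theorem length_replacePage (l : List ℕ) (y v : ℕ) : (replacePage l y v).length = l.length := by
  simp [replacePage]

theorem replacePage_self (l : List ℕ) (v : ℕ) : replacePage l v v = l := by
  unfold replacePage
  conv_rhs => rw [← List.map_id l]
  refine List.map_congr_left fun x _ => ?_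
  split_ifs with h
  · exact h.symm
  · rfl

theorem mem_replacePage {l : List ℕ} {y v x : ℕ} :
    x ∈ replacePage l y v ↔ (x = v ∧ y ∈ l) ∨ (x ∈ l ∧ x ≠ y) := by
  simp only [replacePage, List.mem_map]
  constructor
  · rintro ⟨z, hz, rfl⟩
    split_ifs with h
    · exact Or.inl ⟨rfl, h ▸ hz⟩
    · exact Or.inr ⟨hz, h⟩
  · rintro (⟨rfl, h⟩ | ⟨h, h'⟩)
    · exact ⟨y, h, if_pos rfl⟩
    · exact ⟨x, h, if_neg h'⟩

theorem nodup_replacePage {l : List ℕ} {y v : ℕ} (hl : l.Nodup) (h : v ∉ l ∨ v = y) :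
    (replacePage l y v).Nodup := by
  rcases h with h | rfl
  · refine (List.nodup_map_iff_inj_on hl).2 fun a ha b hb hab => ?_
    split_ifs at hab with h1 h2 h2
    · rw [h1, h2]
    · exact absurd (hab ▸ hb) h
    · exact absurd (hab.symm ▸ ha) h
    · exact hab
  · rwa [replacePage_self]

/-- Without repetitions, `y` occupies only one slot, and no other slot changes. -/
theorem retrievals_replace (k : ℕ) {l : List ℕ} (hl : l.Nodup) (y v : ℕ) :
    Cache.retrievals (slotCache k l) (slotCache k (replacePage l y v)) ≤ 1 := by
  refine retrievals_le_one (l.idxOf y) fun s hs p hp => ?_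
  simp only [slotCache, replacePage, List.getElem?_map, Option.map_eq_some_iff] at hp ⊢
  obtain ⟨x, hx, rfl⟩ := hp
  rw [if_neg, hx]
  rintro rfl
  obtain ⟨h1, h2⟩ := List.getElem?_eq_some_iff.1 hx
  exact hs (by rw [← h2, hl.idxOf_getElem])

/-! ## Flushing the cache when it is full -/

/-- Retrieve a missing page into the next empty slot; if there is none, empty the cache first. -/
def flushStep (k : ℕ) (W : List ℕ) (v : ℕ) : List ℕ :=
  if v ∈ W then W else if W.length < k then W ++ [v] else [v]

def flushCost (k : ℕ) : List ℕ → List ℕ → ℕ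
  | _, [] => 0
  | W, v :: σ => (if v ∈ W then 0 else 1) + flushCost k (flushStep k W v) σ

theorem card_sdiff_le_add (A B W : Finset ℕ) :
    (B \ W).card ≤ (A \ W).card + (B \ A).card := by
  refine (Finset.card_le_card (t := A \ W ∪ B \ A) fun x hx => ?_).trans
    (Finset.card_union_le _ _)
  by_cases h : x ∈ A
  · exact Finset.mem_union_left _ (Finset.mem_sdiff.2 ⟨h, (Finset.mem_sdiff.1 hx).2⟩)
  · exact Finset.mem_union_right _ (Finset.mem_sdiff.2 ⟨(Finset.mem_sdiff.1 hx).1, h⟩)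

theorem card_sdiff_insert {D W : Finset ℕ} {v : ℕ} (hv : v ∈ D) (hW : v ∉ W) :
    (D \ insert v W).card + 1 = (D \ W).card := by
  rw [Finset.sdiff_insert]
  exact Finset.card_erase_add_one (Finset.mem_sdiff.2 ⟨hv, hW⟩)

/-- Here `a` is the cost of flushing so far, `cD` that of the other solution, and `ph` the number of
phases begun, a phase being the time between two flushes. At most `k` misses occur per phase. The
last hypothesis counts, besides the completed phases, the pages the other solution must still have
fetched: when `W` is full it says `ph + |D \ W| ≤ cD`. -/
theorem flushCost_le_aux {k : ℕ} {D : Finset ℕ} {σ : List ℕ} {c : ℕ} (h : Serves k D σ c) :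
    ∀ (W : List ℕ) (a cD ph : ℕ), W.length ≤ k → a + k ≤ k * ph + W.length →
      ph ≤ cD → ph + (D \ W.toFinset).card + W.length ≤ cD + k →
      a + flushCost k W σ ≤ k * (cD + c) := by
  induction h with
  | nil D =>
    intro W a cD ph h1 h2 h3 _
    have := Nat.mul_le_mul_left k h3
    simp only [flushCost, add_zero]
    omega
  | @cons D D' v σ c hcard hv _ ih =>
    intro W a cD ph h1 h2 h3 h4
    have hg := card_sdiff_le_add D D' W.toFinset
    rw [flushCost, flushStep, ← add_assoc cD]
    by_cases hvW : v ∈ W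
    · rw [if_pos hvW, if_pos hvW, zero_add]
      exact ih W a _ ph h1 h2 (by omega) (by omega)
    have hvW' : v ∉ W.toFinset := by simpa using hvW
    rw [if_neg hvW, if_neg hvW, ← add_assoc]
    have h5 := card_sdiff_insert hv hvW'
    split_ifs with hlt
    · have he : (W ++ [v]).toFinset = insert v W.toFinset := by ext; simp
      refine ih (W ++ [v]) _ _ ph (by simp; omega) (by simp; omega) (by omega) ?_
      rw [he, List.length_append, List.length_singleton]
      omega
    -- The cache is full and `v` is a page of `D'` outside `W`, so the new phase is covered: `ph +
    -- 1` is at most the new cost of the other solution.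
    · have h6 := card_sdiff_insert hv (Finset.notMem_empty v)
      have hpos := Finset.card_pos.2 ⟨v, hv⟩
      refine ih [v] _ _ (ph + 1) (by simp; omega) ?_ (by omega) ?_
      · rw [Nat.mul_succ, List.length_singleton]; omega
      · simp only [List.toFinset_cons, List.toFinset_nil, List.length_singleton,
          Finset.sdiff_empty] at h6 ⊢
        omega

/-- Flushing is `k`-competitive. -/
theorem flushCost_le {k : ℕ} {σ : List ℕ} {c : ℕ} (hk : 0 < k) (h : Serves k ∅ σ c) :
    flushCost k [] σ ≤ k * c := by
  cases h with
  | nil => simp [flushCost]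
  | @cons _ D' v σ c hcard hv h =>
    have h6 := card_sdiff_insert hv (Finset.notMem_empty v)
    -- The invariant presupposes a phase that has begun, so the first request is treated apart.
    have := flushCost_le_aux h [v] 1 (D' \ ∅).card 1 (by simp; omega) (by simp; omega) (by omega)
      (by
        simp only [List.toFinset_cons, List.toFinset_nil, List.length_singleton,
          Finset.sdiff_empty] at h6 ⊢
        omega)
    simpa [flushCost, flushStep, hk] using this

/-! ## Evicting the page whose next request is farthest in the future -/

/-- The page of a cache whose next request in `rest` is last. -/
def farthest (slots rest : List ℕ) : ℕ :=
  slots.foldl (fun acc x => if rest.idxOf acc < rest.idxOf x then x else acc) (slots.headD 0)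

def beladyStep (k : ℕ) (slots : List ℕ) (v : ℕ) (rest : List ℕ) : List ℕ :=
  if v ∈ slots then slots
  else if slots.length < k then slots ++ [v]
  else replacePage slots (farthest slots rest) v

def beladyCost (k : ℕ) : List ℕ → List ℕ → ℕ
  | _, [] => 0
  | slots, v :: σ => (if v ∈ slots then 0 else 1) + beladyCost k (beladyStep k slots v σ) σ

/-- `idxOf` of a page that is never requested again is the length of the list, so such pages count
as farthest. -/
theorem farthest_spec {slots : List ℕ} (rest : List ℕ) (h : slots ≠ []) :
    farthest slots rest ∈ slots ∧
      ∀ x ∈ slots, rest.idxOf x ≤ rest.idxOf (farthest slots rest) := by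
  have key : ∀ (l : List ℕ) (a : ℕ),
      let r := l.foldl (fun acc x => if rest.idxOf acc < rest.idxOf x then x else acc) a
      (r = a ∨ r ∈ l) ∧ rest.idxOf a ≤ rest.idxOf r ∧ ∀ x ∈ l, rest.idxOf x ≤ rest.idxOf r := by
    intro l
    induction l with
    | nil => intro a; simp
    | cons b l ih =>
      intro a
      obtain ⟨h1, h2, h3⟩ := ih (if rest.idxOf a < rest.idxOf b then b else a)
      simp only [List.foldl_cons]
      refine ⟨?_, ?_, ?_⟩
      · rcases h1 with h1 | h1
        · rw [h1]; split_ifs <;> simp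
        · exact Or.inr (List.mem_cons_of_mem _ h1)
      · refine le_trans ?_ h2
        split_ifs with h <;> omega
      · intro x hx
        rcases List.mem_cons.1 hx with rfl | hx
        · refine le_trans ?_ h2
          split_ifs with h <;> omega
        · exact h3 x hx
  obtain ⟨a, l, rfl⟩ := List.exists_cons_of_ne_nil h
  obtain ⟨h1, h2, h3⟩ := key (a :: l) a
  refine ⟨?_, h3⟩
  rcases h1 with h1 | h1
  · rw [farthest, List.headD_cons, h1]; simp
  · exact h1

theorem mem_take_iff_idxOf {l : List ℕ} {x n : ℕ} :
    x ∈ l.take n ↔ l.idxOf x < n ∧ l.idxOf x < l.length := by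
  constructor
  · intro h
    have h1 := List.mem_of_mem_take h
    have h2 := List.idxOf_lt_length_of_mem h1
    refine ⟨?_, h2⟩
    have h3 := List.idxOf_lt_length_of_mem h
    rw [List.length_take] at h3
    have h4 : l.idxOf x = (l.take n).idxOf x := by
      conv_lhs => rw [← List.take_append_drop n l, List.idxOf_append_of_mem h]
    omega
  · rintro ⟨h1, h2⟩
    rw [List.mem_take_iff_getElem]
    exact ⟨l.idxOf x, by omega, List.getElem_idxOf h2⟩

theorem beladyStep_nodup {k : ℕ} {slots : List ℕ} {v : ℕ} {rest : List ℕ} (h : slots.Nodup) :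
    (beladyStep k slots v rest).Nodup := by
  unfold beladyStep
  split_ifs with h1 h2
  · exact h
  · exact List.nodup_append.2 ⟨h, by simp, fun a ha b hb => by
      rw [List.mem_singleton] at hb
      rintro rfl
      exact h1 (hb ▸ ha)⟩
  · exact nodup_replacePage h (Or.inl h1)

theorem length_beladyStep_le {k : ℕ} {slots : List ℕ} {v : ℕ} {rest : List ℕ}
    (h : slots.length ≤ k) : (beladyStep k slots v rest).length ≤ k := by
  unfold beladyStep
  split_ifs with h1 h2
  · exact h
  · simp; omega
  · rwa [length_replacePage]

theorem mem_beladyStep {k : ℕ} (hk : 0 < k) {slots : List ℕ} {v : ℕ} {rest : List ℕ} :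
    v ∈ beladyStep k slots v rest := by
  unfold beladyStep
  split_ifs with h1 h2
  · exact h1
  · simp
  · exact mem_replacePage.2 (Or.inl ⟨rfl, (farthest_spec rest (by rintro rfl; simp at h2; omega)).1⟩)

/-- For every prefix of the future, the other solution's advantage in cached pages occurring in this
prefix is covered by the extra cost it has already paid. For the empty prefix this compares the
costs alone. The whole family of inequalities is kept by the eviction rule. -/
theorem beladyCost_le_aux {k : ℕ} (hk : 0 < k) {D : Finset ℕ} {σ : List ℕ} {c : ℕ}
    (h : Serves k D σ c) :
    ∀ (B : List ℕ) (a cD : ℕ), B.Nodup → B.length ≤ k →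
      (∀ n, a + (D ∩ (σ.take n).toFinset).card ≤ cD + (B.toFinset ∩ (σ.take n).toFinset).card) →
      a + beladyCost k B σ ≤ cD + c := by
  induction h with
  | nil D =>
    intro B a cD _ _ h3
    simpa [beladyCost] using h3 0
  | @cons D D' v σ c hcard hv _ ih =>
    intro B a cD hB hBk h
    rw [beladyCost, ← add_assoc, ← add_assoc]
    have hD' : ∀ N : Finset ℕ, (D' ∩ N).card ≤ (D ∩ N).card + (D' \ D).card := by
      intro N
      refine (Finset.card_le_card (t := D ∩ N ∪ D' \ D) fun x hx => ?_).trans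
        (Finset.card_union_le _ _)
      obtain ⟨h1, h2⟩ := Finset.mem_inter.1 hx
      by_cases hxD : x ∈ D
      · exact Finset.mem_union_left _ (Finset.mem_inter.2 ⟨hxD, h2⟩)
      · exact Finset.mem_union_right _ (Finset.mem_sdiff.2 ⟨h1, hxD⟩)
    have hins : ∀ (A N : Finset ℕ), v ∈ A → (A ∩ insert v N).card = (A ∩ N.erase v).card + 1 := by
      intro A N hA
      rw [← Finset.card_insert_of_notMem (s := A ∩ N.erase v) (a := v) (by simp)]
      congr 1
      ext x
      simp only [Finset.mem_inter, Finset.mem_insert, Finset.mem_erase]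
      by_cases hx : x = v
      · subst hx; simp [hA]
      · simp [hx]
    have hsplit : ∀ (A N : Finset ℕ), v ∈ A →
        (A ∩ N).card = (A ∩ N.erase v).card + if v ∈ N then 1 else 0 := by
      intro A N hA
      split_ifs with hN
      · rw [← hins A N hA, Finset.insert_eq_of_mem hN]
      · rw [Finset.erase_eq_of_notMem hN, add_zero]
    -- what is known about the requests up to the next ones
    have hn : ∀ n, a + (D' ∩ (σ.take n).toFinset.erase v).card + 1 ≤
        cD + (D' \ D).card + (B.toFinset ∩ insert v (σ.take n).toFinset).card := by
      intro n
      have h1 := h (n + 1)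
      rw [List.take_succ_cons, List.toFinset_cons] at h1
      have h2 := hD' (insert v (σ.take n).toFinset)
      rw [hins D' _ hv] at h2
      omega
    have hB' := beladyStep_nodup (k := k) (v := v) (rest := σ) hB
    have hvB' : v ∈ (beladyStep k B v σ).toFinset := by
      rw [List.mem_toFinset]; exact mem_beladyStep hk
    refine ih _ _ _ hB' (length_beladyStep_le hBk) fun n => ?_
    rw [hsplit D' _ hv, hsplit _ _ hvB']
    suffices (a + if v ∈ B then 0 else 1) + (D' ∩ (σ.take n).toFinset.erase v).card ≤
        cD + (D' \ D).card +
          ((beladyStep k B v σ).toFinset ∩ (σ.take n).toFinset.erase v).card by omega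
    set N := (σ.take n).toFinset with hN
    have hnn := hn n
    rw [← hN] at hnn
    by_cases hvB : v ∈ B
    · rw [if_pos hvB, beladyStep, if_pos hvB, add_zero]
      rw [hins _ _ (by simpa using hvB)] at hnn
      omega
    rw [if_neg hvB, beladyStep, if_neg hvB]
    have hvBf : v ∉ B.toFinset := by simpa using hvB
    have hBN : B.toFinset ∩ insert v N = B.toFinset ∩ N.erase v := by
      ext x
      simp only [Finset.mem_inter, Finset.mem_insert, Finset.mem_erase]
      constructor
      · rintro ⟨h1, h2⟩
        have : x ≠ v := fun h => hvBf (h ▸ h1)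
        tauto
      · tauto
    rw [hBN] at hnn
    split_ifs with hlt
    · have : B.toFinset ∩ N.erase v ⊆ (B ++ [v]).toFinset ∩ N.erase v :=
        Finset.inter_subset_inter_right fun x hx => by
          rw [List.mem_toFinset] at hx ⊢; exact List.mem_append_left _ hx
      have := Finset.card_le_card this
      omega
    · have hBne : B ≠ [] := by rintro rfl; simp at hlt; omega
      obtain ⟨hy, hfar⟩ := farthest_spec σ hBne
      set y := farthest B σ
      by_cases hyN : y ∈ N
      · -- all pages of the cache are requested soon
        have hall : ∀ x ∈ B, x ∈ N := by
          intro x hx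
          rw [hN, List.mem_toFinset, mem_take_iff_idxOf] at hyN ⊢
          have := hfar x hx
          omega
        -- The prefix consisting only of the missed page `v` shows that the other solution has
        -- already paid for this miss. Moreover `B`, being full, still has `k - 1` pages in the
        -- prefix, at least as many as `D'` has besides `v`.
        have h0 := hn 0
        rw [List.take_zero, List.toFinset_nil] at h0
        have hz : B.toFinset ∩ insert v ∅ = ∅ := by
          ext x; simp only [Finset.mem_inter, Finset.mem_insert, Finset.notMem_empty, or_false,
            iff_false]
          rintro ⟨h1, rfl⟩; exact hvBf h1
        rw [hz, Finset.card_empty] at h0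
        have h5 : (D' ∩ N.erase v).card + 1 ≤ D'.card := by
          rw [← hins D' N hv]
          exact Finset.card_le_card Finset.inter_subset_left
        have h6 : B.toFinset.erase y ⊆ (replacePage B y v).toFinset ∩ N.erase v := by
          intro x hx
          obtain ⟨h1, h2⟩ := Finset.mem_erase.1 hx
          have h2' : x ∈ B := by simpa using h2
          refine Finset.mem_inter.2 ⟨?_, Finset.mem_erase.2 ⟨fun h => hvB (h ▸ h2'), hall x h2'⟩⟩
          rw [List.mem_toFinset, mem_replacePage]
          exact Or.inr ⟨h2', h1⟩
        have h7 := Finset.card_le_card h6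
        rw [Finset.card_erase_of_mem (by simpa using hy), List.toFinset_card_of_nodup hB] at h7
        omega
      -- The evicted page does not occur in the prefix, so nothing that counts is lost.
      · have : B.toFinset ∩ N.erase v ⊆ (replacePage B y v).toFinset ∩ N.erase v := by
          intro x hx
          obtain ⟨h1, h2⟩ := Finset.mem_inter.1 hx
          refine Finset.mem_inter.2 ⟨?_, h2⟩
          rw [List.mem_toFinset, mem_replacePage]
          refine Or.inr ⟨by simpa using h1, ?_⟩
          rintro rfl
          exact hyN (Finset.mem_of_mem_erase h2)
        have := Finset.card_le_card this
        omega

/-- Evicting the page whose next request is farthest in the future is optimal. -/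
theorem beladyCost_le {k : ℕ} (hk : 0 < k) {σ : List ℕ} {c : ℕ} (h : Serves k ∅ σ c) :
    beladyCost k [] σ ≤ c := by
  simpa using beladyCost_le_aux hk h [] 0 0 (by simp) (by simp) (by simp)

/-! ## Averages -/

/-- The average of `f` over a list. -/
def avg (A : List ℕ) (f : ℕ → ℝ≥0∞) : ℝ≥0∞ := (A.map f).sum / A.length

theorem avg_congr {A : List ℕ} {f g : ℕ → ℝ≥0∞} (h : ∀ v ∈ A, f v = g v) : avg A f = avg A g := by
  rw [avg, avg, List.map_congr_left h]

theorem avg_const {A : List ℕ} (h : A ≠ []) (c : ℝ≥0∞) : avg A (fun _ => c) = c := by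
  have h0 : (A.length : ℝ≥0∞) ≠ 0 := by simpa using h
  rw [avg, List.map_const', List.sum_replicate, nsmul_eq_mul, mul_comm,
    ENNReal.mul_div_cancel_right h0 (ENNReal.natCast_ne_top _)]

theorem sum_map_add_list (A : List ℕ) (f g : ℕ → ℝ≥0∞) :
    (A.map fun v => f v + g v).sum = (A.map f).sum + (A.map g).sum := by
  induction A with
  | nil => simp
  | cons a A ih => simp only [List.map_cons, List.sum_cons, ih]; ring

theorem avg_add (A : List ℕ) (f g : ℕ → ℝ≥0∞) :
    avg A (fun v => f v + g v) = avg A f + avg A g := by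
  simp only [avg, sum_map_add_list, ENNReal.add_div]

theorem avg_mono {A : List ℕ} {f g : ℕ → ℝ≥0∞} (h : ∀ v ∈ A, f v ≤ g v) : avg A f ≤ avg A g := by
  refine ENNReal.div_le_div_right ?_ _
  induction A with
  | nil => simp
  | cons a A ih =>
    simp only [List.map_cons, List.sum_cons]
    exact add_le_add (h a (by simp)) (ih fun v hv => h v (by simp [hv]))

theorem avg_perm {A B : List ℕ} (h : A.Perm B) (f : ℕ → ℝ≥0∞) : avg A f = avg B f := by
  rw [avg, avg, (h.map f).sum_eq, h.length_eq]

theorem avg_mul (A : List ℕ) (f : ℕ → ℝ≥0∞) (c : ℝ≥0∞) :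
    avg A (fun v => f v * c) = avg A f * c := by
  have : (A.map fun v => f v * c).sum = (A.map f).sum * c := by
    induction A with
    | nil => simp
    | cons a A ih => simp only [List.map_cons, List.sum_cons, ih, add_mul]
  rw [avg, avg, this, ENNReal.div_eq_inv_mul, ENNReal.div_eq_inv_mul, mul_assoc]

/-- Replacing the value at one point by the average over the other points gives their average. -/
theorem avg_cons_avg {A : List ℕ} (h : A ≠ []) (y : ℕ) (f g : ℕ → ℝ≥0∞)
    (hf : ∀ v ∈ A, f v = g v) (hfy : f y = avg A g) : avg (y :: A) f = avg A g := by
  have h0 : (A.length : ℝ≥0∞) ≠ 0 := by simpa using h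
  have ht : (A.length : ℝ≥0∞) ≠ ⊤ := ENNReal.natCast_ne_top _
  have hsum : (A.map f).sum = avg A g * A.length := by
    rw [List.map_congr_left hf, avg, ENNReal.div_mul_cancel h0 ht]
  rw [avg, List.map_cons, List.sum_cons, hsum, hfy, List.length_cons, Nat.cast_succ,
    ← mul_one_add, add_comm (1 : ℝ≥0∞), mul_div_assoc, ENNReal.div_self (by simp) (by simp),
    mul_one]

/-- The average of `f` over lists of independent uniform draws from `{0, …, b}` for `b ∈ bs`. -/
def drawAvg : List ℕ → (List ℕ → ℝ≥0∞) → ℝ≥0∞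
  | [], f => f []
  | b :: bs, f => avg (List.range (b + 1)) fun d => drawAvg bs fun ds => f (d :: ds)

/-- A uniform element of a list is obtained from a uniform index; this links the integers drawn by
programs to random evictions. -/
theorem avg_range_getD {A : List ℕ} {b : ℕ} (h : b + 1 = A.length) (f : ℕ → ℝ≥0∞) :
    avg (List.range (b + 1)) (fun d => f (A.getD d 0)) = avg A f := by
  have : (List.range A.length).map (fun d => A.getD d 0) = A := by
    refine List.ext_getElem (by simp) fun i h1 h2 => ?_
    simp [h2]
  conv_rhs => rw [← this]
  rw [avg, avg, h, List.map_map]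
  simp [Function.comp_def]

/-! ## Sequences of uniform evictions -/

/-- The list without the page `v`. -/
def del (A : List ℕ) (v : ℕ) : List ℕ := A.filter fun x => !decide (x = v)

theorem mem_del {A : List ℕ} {v x : ℕ} : x ∈ del A v ↔ x ∈ A ∧ x ≠ v := by
  simp [del]

theorem del_eq_erase {A : List ℕ} (hA : A.Nodup) (v : ℕ) : del A v = A.erase v := by
  rw [hA.erase_eq_filter, del]
  congr 1

theorem del_of_notMem {A : List ℕ} {v : ℕ} (h : v ∉ A) : del A v = A := by
  rw [del, List.filter_eq_self]
  intro x hx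
  have : x ≠ v := fun h' => h (h' ▸ hx)
  simp [this]

theorem del_perm {A B : List ℕ} (h : A.Perm B) (v : ℕ) : (del A v).Perm (del B v) := h.filter _

theorem perm_cons_del {A : List ℕ} (hA : A.Nodup) {v : ℕ} (h : v ∈ A) : A.Perm (v :: del A v) := by
  rw [del_eq_erase hA]
  exact List.perm_cons_erase h

theorem length_del {A : List ℕ} (hA : A.Nodup) {v : ℕ} (h : v ∈ A) :
    (del A v).length + 1 = A.length := by
  simpa using (perm_cons_del hA h).length_eq.symm

theorem del_append (A B : List ℕ) (v : ℕ) : del (A ++ B) v = del A v ++ del B v := by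
  simp [del]

theorem del_cons_self (A : List ℕ) (y : ℕ) : del (y :: A) y = del A y := by
  simp [del]

theorem del_cons_of_ne (A : List ℕ) {y v : ℕ} (h : y ≠ v) : del (y :: A) v = y :: del A v := by
  simp [del, h]

/-- The average of `f` over the sequences of evictions from a pool of pages: in each stage the
pages of the next list are added to the pool, and then a uniformly random page is evicted. -/
def sampleAvg : List (List ℕ) → List ℕ → (List ℕ → ℝ≥0∞) → ℝ≥0∞
  | [], _, f => f []
  | S :: Ss, N, f => avg (N ++ S) fun v => sampleAvg Ss (del (N ++ S) v) fun vs => f (v :: vs)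

/-- The pool that remains after all stages. -/
def finalPool : List ℕ → List (List ℕ) → List ℕ → List ℕ
  | N, [], _ => N
  | N, S :: Ss, vs => finalPool (del (N ++ S) (vs.headD 0)) Ss vs.tail

/-- The size of the pool after all stages. -/
def poolSize : ℕ → List (List ℕ) → ℕ
  | n, [] => n
  | n, S :: Ss => poolSize (n + S.length - 1) Ss

/-- In each stage there is a page to evict. -/
def Evictable : ℕ → List (List ℕ) → Prop
  | _, [] => True
  | n, S :: Ss => 1 ≤ n + S.length ∧ Evictable (n + S.length - 1) Ss

/-- In each stage at least one page remains in the pool. -/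
def Live : ℕ → List (List ℕ) → Prop
  | _, [] => True
  | n, S :: Ss => 2 ≤ n + S.length ∧ Live (n + S.length - 1) Ss

theorem Live.evictable {n : ℕ} {Ss : List (List ℕ)} (h : Live n Ss) : Evictable n Ss := by
  induction Ss generalizing n with
  | nil => trivial
  | cons S Ss ih => exact ⟨by have := h.1; omega, ih h.2⟩

theorem sampleAvg_add (Ss : List (List ℕ)) (N : List ℕ) (f g : List ℕ → ℝ≥0∞) :
    sampleAvg Ss N (fun vs => f vs + g vs) = sampleAvg Ss N f + sampleAvg Ss N g := by
  induction Ss generalizing N f g with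
  | nil => rfl
  | cons S Ss ih => simp only [sampleAvg, ih, avg_add]

theorem sampleAvg_mul (Ss : List (List ℕ)) (N : List ℕ) (f : List ℕ → ℝ≥0∞) (c : ℝ≥0∞) :
    sampleAvg Ss N (fun vs => f vs * c) = sampleAvg Ss N f * c := by
  induction Ss generalizing N f with
  | nil => rfl
  | cons S Ss ih => simp only [sampleAvg, ih, avg_mul]

theorem sampleAvg_zero (Ss : List (List ℕ)) (N : List ℕ) : sampleAvg Ss N (fun _ => 0) = 0 := by
  simpa using sampleAvg_mul Ss N (fun _ => 0) 0

theorem sampleAvg_avg (Ss : List (List ℕ)) (N B : List ℕ) (f : ℕ → List ℕ → ℝ≥0∞) :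
    sampleAvg Ss N (fun vs => avg B fun d => f d vs) = avg B fun d => sampleAvg Ss N (f d) := by
  simp only [avg, ENNReal.div_eq_inv_mul]
  simp only [mul_comm _ (List.sum _), sampleAvg_mul]
  congr 1
  induction B with
  | nil => simpa using sampleAvg_zero Ss N
  | cons b B ih => simp only [List.map_cons, List.sum_cons, sampleAvg_add, ih]

theorem nodup_stage {N S : List ℕ} {Ss : List (List ℕ)} (h : (N ++ (S :: Ss).flatten).Nodup)
    (v : ℕ) : (N ++ S).Nodup ∧ (del (N ++ S) v ++ Ss.flatten).Nodup := by
  rw [List.flatten_cons, ← List.append_assoc] at h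
  refine ⟨h.of_append_left, ?_⟩
  refine List.Nodup.sublist ?_ h
  exact List.Sublist.append_right List.filter_sublist _

/-- Evictability is needed because an average over the empty list is `0` rather than the constant.
-/
theorem sampleAvg_const {Ss : List (List ℕ)} {N : List ℕ} (hn : (N ++ Ss.flatten).Nodup)
    (h : Evictable N.length Ss) (c : ℝ≥0∞) : sampleAvg Ss N (fun _ => c) = c := by
  induction Ss generalizing N with
  | nil => rfl
  | cons S Ss ih =>
    have hne : N ++ S ≠ [] := by
      intro h0
      have h1 := congrArg List.length h0
      have h2 := h.1
      simp only [List.length_append, List.length_nil] at h1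
      omega
    rw [sampleAvg, ← avg_const hne c]
    refine avg_congr fun v hv => ?_
    rw [avg_const hne c]
    refine ih (nodup_stage hn v).2 ?_
    have := length_del (nodup_stage hn v).1 hv
    rw [List.length_append] at this
    rw [show (del (N ++ S) v).length = N.length + S.length - 1 by omega]
    exact h.2

/-! ## Conditioning on a page not being evicted -/

/-- The bounds for the random draws that are needed in the stages. -/
def stageBounds : ℕ → List (List ℕ) → List ℕ
  | _, [] => []
  | n, S :: Ss => (n + S.length - 1) :: stageBounds (n + S.length - 1) Ss

/-- Given a sequence of evictions `vs` from pools that also contained the page `y`, change it to a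
sequence of evictions from the pools without `y`. The second component is the page that was
evicted at last in exchange for `y`. -/
def reroute : List ℕ → ℕ → List (List ℕ) → List ℕ → List ℕ → List ℕ × ℕ
  | _, y, [], _, _ => ([], y)
  | N, y, S :: Ss, vs, ds =>
    let A := N ++ S
    let w := if vs.headD 0 = y then A.getD (ds.headD 0) 0 else vs.headD 0
    let r := reroute (del A w) (if vs.headD 0 = y then w else y) Ss vs.tail ds.tail
    (w :: r.1, r.2)

/-- One stage of the coupling between the pool `A`, which contains `y`, and the pool `A'` without
it. An eviction other than `y` is kept; an eviction of `y` is replaced by a fresh uniform element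
`w` of `A'`. In both cases the result is uniform on `A'`. After a replacement the real pool is `A'`,
the new one is `A'` without `w`, and so `w` takes over the part of `y` in the later stages. -/
theorem reroute_stage {A A' : List ℕ} {Ss : List (List ℕ)} {y : ℕ} (hA : A.Perm (y :: A'))
    (hn : (y :: A' ++ Ss.flatten).Nodup) (hne : A' ≠ []) (f : List ℕ → ℝ≥0∞)
    (ih : ∀ (N M : List ℕ) (y : ℕ) (f : List ℕ → ℝ≥0∞), M.Perm (y :: N) →
      (y :: N ++ Ss.flatten).Nodup → N.length + 1 = A'.length →
      sampleAvg Ss M (fun vs => drawAvg (stageBounds N.length Ss) fun ds =>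
        f (reroute N y Ss vs ds).1) = sampleAvg Ss N f) :
    (avg A fun v => sampleAvg Ss (del A v) fun vs =>
      drawAvg ((A'.length - 1) :: stageBounds (A'.length - 1) Ss) fun ds =>
        f ((if v = y then A'.getD (ds.headD 0) 0 else v) ::
          (reroute (del A' (if v = y then A'.getD (ds.headD 0) 0 else v))
            (if v = y then (if v = y then A'.getD (ds.headD 0) 0 else v) else y)
            Ss vs ds.tail).1)) =
      avg A' fun w => sampleAvg Ss (del A' w) fun vs => f (w :: vs) := by
  have hy : y ∉ A' := fun h => by
    simp only [List.cons_append, List.nodup_cons, List.mem_append, not_or] at hn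
    exact hn.1.1 h
  have hA'n : A'.Nodup := (List.nodup_cons.1 hn.of_append_left).2
  have hlen : ∀ {v}, v ∈ A' → (del A' v).length = A'.length - 1 := fun hv => by
    have := length_del hA'n hv
    omega
  have hsub : ∀ v ∈ A', (v :: del A' v ++ Ss.flatten).Nodup := fun v hv => by
    have h1 : (A' ++ Ss.flatten).Nodup := (List.nodup_cons.1 hn).2
    exact (List.Perm.nodup_iff ((perm_cons_del hA'n hv).append_right _)).1 h1
  rw [avg_perm hA]
  refine avg_cons_avg hne y _ (fun w => sampleAvg Ss (del A' w) fun vs => f (w :: vs)) ?_ ?_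
  · intro v hv
    have hvy : v ≠ y := fun h => hy (h ▸ hv)
    simp only [if_neg hvy, drawAvg]
    rw [← ih (del A' v) (del A v) y (fun vs => f (v :: vs)) ?_ ?_
      (length_del hA'n hv), hlen hv]
    -- The draw for this stage is not used here; it is made anyway, so that the list of bounds does
    -- not depend on the evictions.
    · simp only [List.tail_cons, avg_const (show List.range (A'.length - 1 + 1) ≠ [] by simp)]
    · rw [← del_cons_of_ne A' hvy.symm]
      exact del_perm hA v
    · refine List.Nodup.sublist ?_ hn
      exact List.Sublist.append_right (List.filter_sublist.cons_cons y) _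
  · simp only [if_true, drawAvg, List.headD_cons, List.tail_cons]
    rw [sampleAvg_avg, ← avg_range_getD (A := A') (b := A'.length - 1)
      (by have := List.length_pos_of_ne_nil hne; omega)]
    refine avg_congr fun d hd => ?_
    have hd' : d < A'.length := by
      have := List.length_pos_of_ne_nil hne
      rw [List.mem_range] at hd; omega
    have hw : A'.getD d 0 ∈ A' := by
      rw [List.getD_eq_getElem _ _ hd']; exact List.getElem_mem hd'
    rw [← ih (del A' (A'.getD d 0)) (del A y) (A'.getD d 0) (fun vs => f (A'.getD d 0 :: vs)) ?_
      (hsub _ hw) (length_del hA'n hw), hlen hw]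
    refine (del_perm hA y).trans ?_
    rw [del_cons_self, del_of_notMem hy]
    exact perm_cons_del hA'n hw

/-- The coupling of `reroute_stage`, iterated from a point where the pools already differ by `y`.
`Live` keeps the pool without `y` nonempty in each stage. -/
theorem sampleAvg_reroute (Ss : List (List ℕ)) (N M : List ℕ) (y : ℕ) (f : List ℕ → ℝ≥0∞)
    (hM : M.Perm (y :: N)) (hn : (y :: N ++ Ss.flatten).Nodup) (h : Live (N.length + 1) Ss) :
    sampleAvg Ss M (fun vs => drawAvg (stageBounds N.length Ss) fun ds =>
      f (reroute N y Ss vs ds).1) = sampleAvg Ss N f := by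
  induction Ss generalizing N M y f with
  | nil => rfl
  | cons S Ss ih =>
    have hpos := h.1
    have := reroute_stage (A := M ++ S) (A' := N ++ S) (Ss := Ss) (y := y)
      (hM.append_right S) (by simpa [List.append_assoc] using hn)
      (fun h0 => by
        have h1 := congrArg List.length h0
        simp only [List.length_append, List.length_nil] at h1
        omega) f
      (fun N' M' y' f' h1 h2 h3 => ih N' M' y' f' h1 h2 (by
        rw [h3, List.length_append]
        have := h.2
        rwa [show N.length + 1 + S.length - 1 = N.length + S.length by omega] at this))
    rw [List.length_append] at this
    exact this

theorem flatten_map_del (Ss : List (List ℕ)) (r : ℕ) :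
    (Ss.map fun S => del S r).flatten = del Ss.flatten r := by
  induction Ss with
  | nil => rfl
  | cons S Ss ih => rw [List.map_cons, List.flatten_cons, List.flatten_cons, del_append, ih]

theorem map_del_of_notMem {Ss : List (List ℕ)} {r : ℕ} (h : r ∉ Ss.flatten) :
    (Ss.map fun S => del S r) = Ss := by
  conv_rhs => rw [← List.map_id Ss]
  refine List.map_congr_left fun S hS => del_of_notMem fun hr => h ?_
  exact List.mem_flatten.2 ⟨S, hS, hr⟩

/-- Rerouting the evictions from a page `r` gives uniform evictions from the pools without `r`. -/
theorem sampleAvg_condition (Ss : List (List ℕ)) (N : List ℕ) (r : ℕ) (f : List ℕ → ℝ≥0∞)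
    (hr : r ∈ Ss.flatten) (hn : (N ++ Ss.flatten).Nodup) (h : Live N.length Ss) :
    sampleAvg Ss N (fun vs =>
      drawAvg (stageBounds N.length (Ss.map fun S => del S r)) fun ds =>
        f (reroute N r (Ss.map fun S => del S r) vs ds).1) =
      sampleAvg (Ss.map fun S => del S r) N f := by
  induction Ss generalizing N f with
  | nil => simp at hr
  | cons S Ss ih =>
    have hrN : r ∉ N := fun hrN => (List.nodup_append.1 hn).2.2 r hrN r hr rfl
    have hpos := h.1
    by_cases hrS : r ∈ S
    · have hrSs : r ∉ Ss.flatten := fun h' => by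
        have := hn.of_append_right
        rw [List.flatten_cons] at this
        exact (List.nodup_append.1 this).2.2 r hrS r h' rfl
      have hNS := (nodup_stage hn r).1
      have hlen := length_del hNS (List.mem_append_right N hrS)
      rw [del_append, del_of_notMem hrN, List.length_append, List.length_append] at hlen
      rw [List.map_cons, map_del_of_notMem hrSs]
      have hA : (N ++ S).Perm (r :: (N ++ del S r)) := by
        have := perm_cons_del hNS (List.mem_append_right N hrS)
        rwa [del_append, del_of_notMem hrN] at this
      have := reroute_stage (A := N ++ S) (A' := N ++ del S r) (Ss := Ss) (y := r) hA
        (by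
          rw [List.flatten_cons, ← List.append_assoc] at hn
          exact (List.Perm.nodup_iff (hA.append_right _)).1 hn)
        (fun h0 => by
          have h1 := congrArg List.length h0
          simp only [List.length_append, List.length_nil] at h1
          omega) f
        (fun N' M' y' f' h1 h2 h3 => sampleAvg_reroute Ss N' M' y' f' h1 h2 (by
          rw [h3, List.length_append]
          have := h.2
          rwa [show N.length + S.length - 1 = N.length + (del S r).length by omega] at this))
      rw [List.length_append] at this
      exact this
    · have hrSs : r ∈ Ss.flatten := by
        rw [List.flatten_cons, List.mem_append] at hr
        exact hr.resolve_left hrS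
      rw [List.map_cons, del_of_notMem hrS, sampleAvg, sampleAvg]
      refine avg_congr fun v hv => ?_
      have hvr : v ≠ r := by
        rintro rfl
        rcases List.mem_append.1 hv with h | h
        · exact hrN h
        · exact hrS h
      have hlen := length_del (nodup_stage hn v).1 hv
      rw [List.length_append] at hlen
      have hl : (del (N ++ S) v).length = N.length + S.length - 1 := by omega
      rw [← ih (del (N ++ S) v) (fun vs => f (v :: vs)) hrSs (nodup_stage hn v).2
        (by rw [hl]; exact h.2), hl]
      simp only [stageBounds, drawAvg, reroute, List.headD_cons, List.tail_cons, hvr, if_false,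
        avg_const (show List.range (N.length + S.length - 1 + 1) ≠ [] by simp)]

/-! ## The probability that a page was evicted -/

/-- `1 / 2 + ⋯ + 1 / (m + 1)` -/
def tailHarmonic (m : ℕ) : ℝ≥0∞ := ∑ i ∈ Finset.range m, 1 / ((i : ℝ≥0∞) + 2)

theorem tailHarmonic_mono {m n : ℕ} (h : m ≤ n) : tailHarmonic m ≤ tailHarmonic n :=
  Finset.sum_le_sum_of_subset (by simpa using h)

theorem tailHarmonic_succ (m : ℕ) :
    tailHarmonic (m + 1) = tailHarmonic m + 1 / ((m : ℝ≥0∞) + 2) := Finset.sum_range_succ _ _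

/-- The expected future cost that the stages can cause. -/
def stagePotential : ℕ → List (List ℕ) → ℝ≥0∞
  | _, [] => 0
  | n, S :: Ss => tailHarmonic (n + S.length - 1) + stagePotential (n + S.length - 1) Ss

theorem stagePotential_mono {m n : ℕ} (h : m ≤ n) (Ss : List (List ℕ)) :
    stagePotential m Ss ≤ stagePotential n Ss := by
  induction Ss generalizing m n with
  | nil => exact le_rfl
  | cons S Ss ih =>
    exact add_le_add (tailHarmonic_mono (by omega)) (ih (by omega))

theorem stagePotential_append (n : ℕ) (Ss Ts : List (List ℕ)) :
    stagePotential n (Ss ++ Ts) = stagePotential n Ss + stagePotential (poolSize n Ss) Ts := by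
  induction Ss generalizing n with
  | nil => simp [stagePotential, poolSize]
  | cons S Ss ih => simp [stagePotential, poolSize, ih, add_assoc]

/-- The indicator of `r ∈ vs`. -/
def memCost (r : ℕ) (vs : List ℕ) : ℝ≥0∞ := if r ∈ vs then 1 else 0

theorem memCost_cons_of_ne {r v : ℕ} (h : v ≠ r) (vs : List ℕ) :
    memCost r (v :: vs) = memCost r vs := by
  simp [memCost, h.symm]

theorem avg_indicator {A : List ℕ} (hA : A.Nodup) {y : ℕ} (hy : y ∈ A) :
    avg A (fun v => if v = y then 1 else 0) = 1 / (A.length : ℝ≥0∞) := by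
  rw [avg_perm (perm_cons_del hA hy)]
  have h0 : ((del A y).map fun v => if v = y then (1 : ℝ≥0∞) else 0).sum = 0 := by
    rw [List.sum_eq_zero]
    intro x hx
    obtain ⟨v, hv, rfl⟩ := List.mem_map.1 hx
    exact if_neg (mem_del.1 hv).2
  rw [avg, List.map_cons, List.sum_cons, h0, if_pos rfl, add_zero, List.length_cons,
    length_del hA hy]

/-- The page `y` is evicted now with probability `1 / |A|`, which is exactly the last term of
`tailHarmonic (A.length - 1)`, the term lost when the pool shrinks by one. If another page is
evicted, the later stages pay by `ih`. -/
theorem memCost_stage {A : List ℕ} {Ss : List (List ℕ)} {y : ℕ} (hn : (A ++ Ss.flatten).Nodup)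
    (hy : y ∈ A) (hA : 2 ≤ A.length) (h : Evictable (A.length - 1) Ss)
    (ih : ∀ M : List ℕ, y ∈ M → (M ++ Ss.flatten).Nodup → M.length + 1 = A.length →
      sampleAvg Ss M (memCost y) + stagePotential (M.length - 1) Ss ≤
        stagePotential M.length Ss) :
    (avg A fun v => sampleAvg Ss (del A v) fun vs => memCost y (v :: vs)) +
      (tailHarmonic (A.length - 2) + stagePotential (A.length - 2) Ss) ≤
      tailHarmonic (A.length - 1) + stagePotential (A.length - 1) Ss := by
  have hAn : A.Nodup := hn.of_append_left
  have hne : A ≠ [] := by rintro rfl; simp at hA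
  have hsub : ∀ v, (del A v ++ Ss.flatten).Nodup := fun v =>
    List.Nodup.sublist (List.Sublist.append_right List.filter_sublist _) hn
  obtain ⟨m, hm⟩ : ∃ m, A.length = m + 2 := ⟨A.length - 2, by omega⟩
  have h1 : (avg A fun v => sampleAvg Ss (del A v) fun vs => memCost y (v :: vs)) +
      stagePotential (A.length - 2) Ss ≤
      1 / (A.length : ℝ≥0∞) + stagePotential (A.length - 1) Ss := by
    rw [← avg_indicator hAn hy, ← avg_const hne (stagePotential (A.length - 2) Ss),
      ← avg_const hne (stagePotential (A.length - 1) Ss), ← avg_add, ← avg_add]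
    refine avg_mono fun v hv => ?_
    have hlen := length_del hAn hv
    by_cases hvy : v = y
    · rw [if_pos hvy]
      refine add_le_add ?_ (stagePotential_mono (by omega) _)
      simp only [hvy, memCost, List.mem_cons, true_or, if_true]
      rw [sampleAvg_const (hsub y)]
      rw [← hvy, show (del A v).length = A.length - 1 by omega]
      exact h
    · rw [if_neg hvy, zero_add]
      simp only [memCost_cons_of_ne hvy]
      have := ih (del A v) (mem_del.2 ⟨hy, fun h => hvy h.symm⟩) (hsub v) hlen
      rwa [show (del A v).length = A.length - 1 by omega,
        show A.length - 1 - 1 = A.length - 2 by omega] at this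
  rw [hm] at h1 ⊢
  rw [show m + 2 - 1 = m + 1 by omega, show m + 2 - 2 = m by omega] at h1 ⊢
  rw [tailHarmonic_succ]
  calc _ = tailHarmonic m + ((avg A fun v => sampleAvg Ss (del A v) fun vs =>
        memCost y (v :: vs)) + stagePotential m Ss) := by ring
    _ ≤ tailHarmonic m + (1 / ((m + 2 : ℕ) : ℝ≥0∞) + stagePotential (m + 1) Ss) := by gcongr
    _ = _ := by push_cast; ring

/-- Removing `y` from the pool lowers every later pool size by one, and the resulting loss of
potential covers the probability that `y` was evicted. -/
theorem sampleAvg_memCost_le_of_mem (Ss : List (List ℕ)) (M : List ℕ) (y : ℕ) (hy : y ∈ M)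
    (hn : (M ++ Ss.flatten).Nodup) (h : Live M.length Ss) :
    sampleAvg Ss M (memCost y) + stagePotential (M.length - 1) Ss ≤
      stagePotential M.length Ss := by
  induction Ss generalizing M with
  | nil => simp [sampleAvg, memCost, stagePotential]
  | cons S Ss ih =>
    have hpos := h.1
    have hMpos := List.length_pos_of_mem hy
    have := memCost_stage (A := M ++ S) (Ss := Ss) (y := y)
      (by simpa [List.append_assoc] using hn) (List.mem_append_left _ hy)
      (by rw [List.length_append]; exact hpos)
      (by rw [List.length_append]; exact h.2.evictable)
      (fun M' h1 h2 h3 => ih M' h1 h2 (by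
        rw [List.length_append] at h3
        rw [show M'.length = M.length + S.length - 1 by omega]; exact h.2))
    rw [List.length_append] at this
    rw [stagePotential, stagePotential, sampleAvg,
      show M.length - 1 + S.length - 1 = M.length + S.length - 2 by omega]
    exact this

/-- Nothing happens to `r` before the stage in which it joins the pool; from then on the previous
argument applies. This bounds the expected cost of a request for a page of the history. -/
theorem sampleAvg_memCost_le (Ss : List (List ℕ)) (N : List ℕ) (r : ℕ)
    (hr : r ∈ Ss.flatten) (hn : (N ++ Ss.flatten).Nodup) (h : Live N.length Ss) :
    sampleAvg Ss N (memCost r) + stagePotential N.length (Ss.map fun S => del S r) ≤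
      stagePotential N.length Ss := by
  induction Ss generalizing N with
  | nil => simp at hr
  | cons S Ss ih =>
    have hrN : r ∉ N := fun hrN => (List.nodup_append.1 hn).2.2 r hrN r hr rfl
    have hpos := h.1
    by_cases hrS : r ∈ S
    · have hrSs : r ∉ Ss.flatten := fun h' => by
        have := hn.of_append_right
        rw [List.flatten_cons] at this
        exact (List.nodup_append.1 this).2.2 r hrS r h' rfl
      have hSn : S.Nodup := ((nodup_stage hn r).1).of_append_right
      have hlen := length_del hSn hrS
      rw [List.map_cons, map_del_of_notMem hrSs]
      have := memCost_stage (A := N ++ S) (Ss := Ss) (y := r)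
        (by simpa [List.append_assoc] using hn) (List.mem_append_right _ hrS)
        (by rw [List.length_append]; exact hpos)
        (by rw [List.length_append]; exact h.2.evictable)
        (fun M' h1 h2 h3 => sampleAvg_memCost_le_of_mem Ss M' r h1 h2 (by
          rw [List.length_append] at h3
          rw [show M'.length = N.length + S.length - 1 by omega]; exact h.2))
      rw [List.length_append] at this
      rw [stagePotential, stagePotential, sampleAvg,
        show N.length + (del S r).length - 1 = N.length + S.length - 2 by omega]
      exact this
    · have hrSs : r ∈ Ss.flatten := by
        rw [List.flatten_cons, List.mem_append] at hr
        exact hr.resolve_left hrS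
      have hne : N ++ S ≠ [] := by
        intro h0
        have h1 := congrArg List.length h0
        simp only [List.length_append, List.length_nil] at h1
        omega
      rw [List.map_cons, del_of_notMem hrS, sampleAvg, stagePotential, stagePotential,
        add_left_comm]
      refine add_le_add_right ?_ _
      rw [← avg_const hne (stagePotential _ (List.map _ Ss)), ← avg_add,
        ← avg_const hne (stagePotential _ Ss)]
      refine avg_mono fun v hv => ?_
      have hvr : v ≠ r := by
        rintro rfl
        rcases List.mem_append.1 hv with h | h
        · exact hrN h
        · exact hrS h
      have hlen := length_del (nodup_stage hn v).1 hv
      rw [List.length_append] at hlen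
      have hl : (del (N ++ S) v).length = N.length + S.length - 1 := by omega
      simp only [memCost_cons_of_ne hvr]
      have := ih (del (N ++ S) v) hrSs (nodup_stage hn v).2 (by rw [hl]; exact h.2)
      rwa [hl] at this

/-! ## Dropping the stages before an empty pool -/

/-- Drop all stages up to the last one after which the pool is empty. -/
def trim : ℕ → List (List ℕ) → List ℕ → List (List ℕ) → List ℕ → List (List ℕ) × List ℕ
  | _, aS, aV, [], _ => (aS, aV)
  | n, aS, aV, S :: Ss, vs =>
    if n + S.length - 1 = 0 then trim 0 [] [] Ss vs.tail
    else trim (n + S.length - 1) (aS ++ [S]) (aV ++ [vs.headD 0]) Ss vs.tail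

/-- Which stages are dropped depends only on their lengths, not on the evictions. Hence trimming
keeps the stages deterministic, given the requests. -/
theorem trim_cases (n : ℕ) (Ss : List (List ℕ)) :
    (Live n Ss ∧ ∀ aS aV vs, vs.length = Ss.length →
      trim n aS aV Ss vs = (aS ++ Ss, aV ++ vs)) ∨
    ∃ Ss₁ Ss₂, Ss = Ss₁ ++ Ss₂ ∧ poolSize n Ss₁ = 0 ∧ Live 0 Ss₂ ∧ ∀ aS aV vs,
      vs.length = Ss.length → trim n aS aV Ss vs = (Ss₂, vs.drop Ss₁.length) := by
  induction Ss generalizing n with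
  | nil =>
    refine Or.inl ⟨trivial, fun aS aV vs h => ?_⟩
    obtain rfl := List.length_eq_zero_iff.1 h
    simp [trim]
  | cons S Ss ih =>
    have hcons : ∀ vs : List ℕ, vs.length = (S :: Ss).length →
        vs = vs.headD 0 :: vs.tail ∧ vs.tail.length = Ss.length := by
      intro vs h
      cases vs with
      | nil => simp at h
      | cons v vs => simpa using h
    by_cases h0 : n + S.length - 1 = 0
    · rcases ih 0 with ⟨h1, h2⟩ | ⟨Ss₁, Ss₂, rfl, h1, h2, h3⟩
      · refine Or.inr ⟨[S], Ss, rfl, h0, h1, fun aS aV vs h => ?_⟩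
        rw [trim, if_pos h0, h2 _ _ _ (hcons vs h).2]
        simp
      · refine Or.inr ⟨S :: Ss₁, Ss₂, rfl, by rw [poolSize, h0, h1], h2, fun aS aV vs h => ?_⟩
        rw [trim, if_pos h0, h3 _ _ _ (hcons vs h).2]
        simp
    · rcases ih (n + S.length - 1) with ⟨h1, h2⟩ | ⟨Ss₁, Ss₂, rfl, h1, h2, h3⟩
      · refine Or.inl ⟨⟨by omega, h1⟩, fun aS aV vs h => ?_⟩
        rw [trim, if_neg h0, h2 _ _ _ (hcons vs h).2]
        conv_rhs => rw [(hcons vs h).1]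
        simp
      · refine Or.inr ⟨S :: Ss₁, Ss₂, rfl, h1, h2, fun aS aV vs h => ?_⟩
        rw [trim, if_neg h0, h3 _ _ _ (hcons vs h).2]
        simp

/-- Whatever was evicted in `Ss₁`, the pool after it is empty, so the evictions in `Ss₂` are
independent of it. -/
theorem sampleAvg_drop (Ss₁ Ss₂ : List (List ℕ)) (M : List ℕ) (f : List ℕ → ℝ≥0∞)
    (hn : (M ++ Ss₁.flatten).Nodup) (h : Evictable M.length Ss₁)
    (h0 : poolSize M.length Ss₁ = 0) :
    sampleAvg (Ss₁ ++ Ss₂) M (fun vs => f (vs.drop Ss₁.length)) = sampleAvg Ss₂ [] f := by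
  induction Ss₁ generalizing M with
  | nil =>
    obtain rfl := List.length_eq_zero_iff.1 h0
    rfl
  | cons S Ss₁ ih =>
    have hne : M ++ S ≠ [] := by
      intro h0
      have h1 := congrArg List.length h0
      have h2 := h.1
      simp only [List.length_append, List.length_nil] at h1
      omega
    rw [List.cons_append, sampleAvg, ← avg_const hne (sampleAvg Ss₂ [] f)]
    refine avg_congr fun v hv => ?_
    have hlen := length_del (nodup_stage hn v).1 hv
    rw [List.length_append] at hlen
    have hl : (del (M ++ S) v).length = M.length + S.length - 1 := by omega
    exact ih (del (M ++ S) v) (nodup_stage hn v).2 (by rw [hl]; exact h.2)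
      (by rw [hl]; exact h0)

theorem Evictable.append {n : ℕ} {Ss Ts : List (List ℕ)} :
    Evictable n (Ss ++ Ts) ↔ Evictable n Ss ∧ Evictable (poolSize n Ss) Ts := by
  induction Ss generalizing n with
  | nil => simp [Evictable, poolSize]
  | cons S Ss ih => simp [Evictable, poolSize, ih, and_assoc]

theorem sampleAvg_snoc (Ss : List (List ℕ)) (S N : List ℕ) (f : List ℕ → ℝ≥0∞) :
    sampleAvg (Ss ++ [S]) N f =
      sampleAvg Ss N fun vs => avg (finalPool N Ss vs ++ S) fun v => f (vs ++ [v]) := by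
  induction Ss generalizing N f with
  | nil => rfl
  | cons T Ss ih =>
    rw [List.cons_append, sampleAvg, sampleAvg]
    refine avg_congr fun v _ => ?_
    rw [ih]
    rfl

theorem poolSize_append (n : ℕ) (Ss Ts : List (List ℕ)) :
    poolSize n (Ss ++ Ts) = poolSize (poolSize n Ss) Ts := by
  induction Ss generalizing n with
  | nil => rfl
  | cons S Ss ih => exact ih _

/-! ## The partition algorithm -/

/-- `vs` is a possible sequence of evictions. -/
def Sampled : List ℕ → List (List ℕ) → List ℕ → Prop
  | _, [], [] => True
  | _, [], _ :: _ => False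
  | _, _ :: _, [] => False
  | N, S :: Ss, v :: vs => v ∈ N ++ S ∧ Sampled (del (N ++ S) v) Ss vs

theorem Sampled.length_eq {N : List ℕ} {Ss : List (List ℕ)} {vs : List ℕ} (h : Sampled N Ss vs) :
    vs.length = Ss.length := by
  induction Ss generalizing N vs with
  | nil => cases vs with
    | nil => rfl
    | cons v vs => exact h.elim
  | cons S Ss ih => cases vs with
    | nil => exact h.elim
    | cons v vs => simp [ih h.2]

theorem sampleAvg_congr {Ss : List (List ℕ)} {N : List ℕ} {f g : List ℕ → ℝ≥0∞}
    (h : ∀ vs, Sampled N Ss vs → f vs = g vs) : sampleAvg Ss N f = sampleAvg Ss N g := by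
  induction Ss generalizing N f g with
  | nil => exact h [] trivial
  | cons S Ss ih => exact avg_congr fun v hv => ih fun vs hvs => h _ ⟨hv, hvs⟩

theorem length_finalPool {Ss : List (List ℕ)} {N vs : List ℕ} (hn : (N ++ Ss.flatten).Nodup)
    (h : Sampled N Ss vs) : (finalPool N Ss vs).length = poolSize N.length Ss := by
  induction Ss generalizing N vs with
  | nil => rfl
  | cons S Ss ih => cases vs with
    | nil => exact h.elim
    | cons v vs =>
      have hlen := length_del (nodup_stage hn v).1 h.1
      rw [List.length_append] at hlen
      rw [finalPool, poolSize, List.headD_cons, List.tail_cons, ih (nodup_stage hn v).2 h.2]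
      congr 1
      omega

/-- `Live` ensures that the truncated subtraction never truncates, so every pool from the stage of
`r` on shrinks by exactly one. Pools may now become empty, but every stage still has a page to
evict; trimming then restores `Live`. -/
theorem poolSize_map_del {Ss : List (List ℕ)} {r n : ℕ} (hn : Ss.flatten.Nodup)
    (hr : r ∈ Ss.flatten) (h : Live n Ss) :
    poolSize n (Ss.map fun S => del S r) + 1 = poolSize n Ss ∧
      Evictable n (Ss.map fun S => del S r) := by
  have key : ∀ (Ss : List (List ℕ)) (m n : ℕ), n = m + 1 → Live n Ss →
      poolSize m Ss + 1 = poolSize n Ss ∧ Evictable m Ss := by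
    intro Ss
    induction Ss with
    | nil => rintro m n rfl _; exact ⟨rfl, trivial⟩
    | cons S Ss ih =>
      rintro m n rfl h
      have h1 := h.1
      obtain ⟨h2, h3⟩ := ih (m + S.length - 1) (m + 1 + S.length - 1) (by omega) h.2
      exact ⟨h2, by omega, h3⟩
  induction Ss generalizing n with
  | nil => simp at hr
  | cons S Ss ih =>
    have h1 := h.1
    rw [List.flatten_cons] at hn hr
    by_cases hrS : r ∈ S
    · have hrSs : r ∉ Ss.flatten := fun h' => (List.nodup_append.1 hn).2.2 r hrS r h' rfl
      have hlen := length_del hn.of_append_left hrS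
      rw [List.map_cons, map_del_of_notMem hrSs]
      obtain ⟨h2, h3⟩ := key Ss (n + (del S r).length - 1) (n + S.length - 1) (by omega) h.2
      exact ⟨h2, by omega, h3⟩
    · rw [List.map_cons, del_of_notMem hrS]
      obtain ⟨h2, h3⟩ := ih hn.of_append_right ((List.mem_append.1 hr).resolve_left hrS) h.2
      exact ⟨h2, by omega, h3⟩

/-- Trimming turns `Evictable` into `Live` and turns uniform evictions for all stages into uniform
evictions for the remaining ones. -/
theorem exists_trim {Ts : List (List ℕ)} (hn : Ts.flatten.Nodup) (he : Evictable 0 Ts) :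
    ∃ Ts₁ Ts₂, Ts = Ts₁ ++ Ts₂ ∧ poolSize 0 Ts₁ = 0 ∧ Live 0 Ts₂ ∧
      (∀ vs, vs.length = Ts.length → trim 0 [] [] Ts vs = (Ts₂, vs.drop Ts₁.length)) ∧
      ∀ F : List (List ℕ) × List ℕ → ℝ≥0∞,
        sampleAvg Ts [] (fun vs => F (trim 0 [] [] Ts vs)) =
          sampleAvg Ts₂ [] fun vs => F (Ts₂, vs) := by
  obtain ⟨Ts₁, Ts₂, h, h0, hl, ht⟩ : ∃ Ts₁ Ts₂, Ts = Ts₁ ++ Ts₂ ∧ poolSize 0 Ts₁ = 0 ∧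
      Live 0 Ts₂ ∧
      ∀ vs, vs.length = Ts.length → trim 0 [] [] Ts vs = (Ts₂, vs.drop Ts₁.length) := by
    rcases trim_cases 0 Ts with ⟨h1, h2⟩ | ⟨Ts₁, Ts₂, h1, h2, h3, h4⟩
    · exact ⟨[], Ts, rfl, rfl, h1, fun vs hvs => by simp [h2 [] [] vs hvs]⟩
    · exact ⟨Ts₁, Ts₂, h1, h2, h3, h4 [] []⟩
  refine ⟨Ts₁, Ts₂, h, h0, hl, ht, fun F => ?_⟩
  rw [sampleAvg_congr fun vs hvs => congrArg F (ht vs hvs.length_eq)]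
  subst h
  rw [List.flatten_append] at hn
  exact sampleAvg_drop Ts₁ Ts₂ [] (fun vs => F (Ts₂, vs)) (by simpa using hn.of_append_left)
    (Evictable.append.1 he).1 h0

/-- The state of the partition algorithm: the stages, the pages evicted in these stages, and the
pages requested since the last eviction of a stage. -/
abbrev Stages : Type := List (List ℕ) × List ℕ × List ℕ

namespace Stages

/-- The bounds for the draws that are needed to serve `r`. -/
def bounds (k : ℕ) (st : Stages) (r : ℕ) : List ℕ :=
  if r ∈ st.2.2 then []
  else if r ∈ st.1.flatten then stageBounds 0 (st.1.map fun S => del S r)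
  else if st.1 = [] ∧ st.2.2.length < k then []
  else [k - 1]

def addPage (t : List (List ℕ) × List ℕ) (top : List ℕ) : Stages := (t.1, t.2, top)

/-- The evictions after `r` was hit, and the page to be replaced by `r`. -/
def rerouted (st : Stages) (r : ℕ) (ds : List ℕ) : List ℕ × ℕ :=
  reroute [] r (st.1.map fun S => del S r) st.2.1 ds

/-- The page to be evicted when a new stage begins. -/
def victim (st : Stages) (ds : List ℕ) : ℕ :=
  (finalPool [] st.1 st.2.1 ++ st.2.2).getD (ds.headD 0) 0

def step (k : ℕ) (st : Stages) (r : ℕ) (ds : List ℕ) : Stages :=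
  if r ∈ st.2.2 then st
  else if r ∈ st.1.flatten then
    addPage (trim 0 [] [] (st.1.map fun S => del S r) (st.rerouted r ds).1) (st.2.2 ++ [r])
  else if st.1 = [] ∧ st.2.2.length < k then (st.1, st.2.1, st.2.2 ++ [r])
  else addPage (trim 0 [] [] (st.1 ++ [st.2.2]) (st.2.1 ++ [st.victim ds])) [r]

/-- The pages in the slots after `r` was served. -/
def nextSlots (k : ℕ) (st : Stages) (slots : List ℕ) (r : ℕ) (ds : List ℕ) : List ℕ :=
  if r ∈ st.2.2 then slots
  else if r ∈ st.1.flatten then replacePage slots (st.rerouted r ds).2 r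
  else if st.1 = [] ∧ st.2.2.length < k then slots ++ [r]
  else replacePage slots (st.victim ds) r

/-- A bound for the cost of serving `r`. -/
def pay (st : Stages) (r : ℕ) : ℝ≥0∞ :=
  if r ∈ st.2.2 then 0 else if r ∈ st.1.flatten then memCost r st.2.1 else 1

/-- A bound for the expected cost. -/
def expCost (k : ℕ) : List ℕ → Stages → ℝ≥0∞
  | [], _ => 0
  | r :: σ, st => st.pay r + drawAvg (st.bounds k r) fun ds => expCost k σ (st.step k r ds)

/-- The invariant of the stages. -/
structure Valid (k : ℕ) (Ss : List (List ℕ)) (top : List ℕ) : Prop where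
  nodup : (Ss.flatten ++ top).Nodup
  live : Live 0 Ss
  full : Ss ≠ [] → poolSize 0 Ss + top.length = k
  le : poolSize 0 Ss + top.length ≤ k

theorem Valid.trim {k : ℕ} {Ts Ts₁ Ts₂ : List (List ℕ)} {top : List ℕ}
    (hn : (Ts.flatten ++ top).Nodup) (h : Ts = Ts₁ ++ Ts₂) (h0 : poolSize 0 Ts₁ = 0)
    (hl : Live 0 Ts₂) (hk : poolSize 0 Ts + top.length = k) : Valid k Ts₂ top := by
  subst h
  rw [poolSize_append, h0] at hk
  refine ⟨?_, hl, fun _ => hk, hk.le⟩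
  rw [List.flatten_append, List.append_assoc] at hn
  exact hn.of_append_right

theorem Valid.hit {k : ℕ} {Ss : List (List ℕ)} {top : List ℕ} (h : Valid k Ss top) {r : ℕ}
    (hr : r ∈ Ss.flatten) :
    ((Ss.map fun S => del S r).flatten ++ (top ++ [r])).Nodup ∧
      Evictable 0 (Ss.map fun S => del S r) ∧
      poolSize 0 (Ss.map fun S => del S r) + (top ++ [r]).length = k := by
  have hSs : Ss ≠ [] := by rintro rfl; simp at hr
  obtain ⟨h1, h2⟩ := poolSize_map_del h.nodup.of_append_left hr h.live
  have := h.full hSs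
  refine ⟨?_, h2, by rw [List.length_append, List.length_singleton]; omega⟩
  rw [flatten_map_del, ← List.append_assoc]
  have hp : (del Ss.flatten r ++ top ++ [r]).Perm (Ss.flatten ++ top) := by
    refine (List.perm_append_singleton _ _).trans ?_
    rw [← List.cons_append]
    exact ((perm_cons_del h.nodup.of_append_left hr).symm).append_right _
  exact hp.nodup_iff.2 h.nodup

theorem Valid.fill {k : ℕ} {top : List ℕ} (h : Valid k [] top) {r : ℕ} (hr : r ∉ top)
    (hlt : top.length < k) : Valid k [] (top ++ [r]) := by
  refine ⟨?_, trivial, fun h => absurd rfl h, ?_⟩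
  · have := h.nodup
    rw [List.flatten_nil, List.nil_append] at this ⊢
    exact (List.perm_append_singleton _ _).nodup_iff.2 (List.nodup_cons.2 ⟨hr, this⟩)
  · rw [List.length_append, List.length_singleton, poolSize]; omega

theorem Valid.miss {k : ℕ} {Ss : List (List ℕ)} {top : List ℕ} (h : Valid k Ss top) (hk : 0 < k)
    {r : ℕ} (hr : r ∉ Ss.flatten) (hr' : r ∉ top) (hlt : ¬(Ss = [] ∧ top.length < k)) :
    ((Ss ++ [top]).flatten ++ [r]).Nodup ∧ Evictable 0 (Ss ++ [top]) ∧
      poolSize 0 Ss + top.length = k ∧ poolSize 0 (Ss ++ [top]) + [r].length = k := by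
  have hfull : poolSize 0 Ss + top.length = k := by
    by_cases hSs : Ss = []
    · have := h.le
      have h3 : ¬ top.length < k := fun h' => hlt ⟨hSs, h'⟩
      omega
    · exact h.full hSs
  refine ⟨?_, Evictable.append.2 ⟨h.live.evictable, by omega, trivial⟩, hfull, ?_⟩
  · rw [List.flatten_append, List.flatten_singleton]
    exact (List.perm_append_singleton _ _).nodup_iff.2 (List.nodup_cons.2 ⟨by simp [hr, hr'], h.nodup⟩)
  · rw [poolSize_append, poolSize, poolSize, List.length_singleton]; omega

/-- The lower bounds on the cost of a solution that has the pages `D` in its cache. -/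
def Lower (D : Finset ℕ) (miss cD : ℕ) (Ss : List (List ℕ)) (top : List ℕ) : Prop :=
  ∀ Ss₁ Ss₂, Ss = Ss₁ ++ Ss₂ →
    miss + (D \ (Ss₂.flatten ++ top).toFinset).card ≤ cD + poolSize 0 Ss₁

theorem Lower.trim {D : Finset ℕ} {miss cD : ℕ} {Ss Ts₁ Ts₂ : List (List ℕ)} {top : List ℕ}
    (h : Lower D miss cD Ss top) (hs : Ss = Ts₁ ++ Ts₂) (h0 : poolSize 0 Ts₁ = 0) :
    Lower D miss cD Ts₂ top := by
  intro Ss₁ Ss₂ hS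
  have := h (Ts₁ ++ Ss₁) Ss₂ (by rw [hs, hS, List.append_assoc])
  rwa [poolSize_append, h0] at this

theorem Lower.move {D D' : Finset ℕ} {miss cD : ℕ} {Ss : List (List ℕ)} {top : List ℕ}
    (h : Lower D miss cD Ss top) : Lower D' miss (cD + (D' \ D).card) Ss top := by
  intro Ss₁ Ss₂ hS
  have h1 := h Ss₁ Ss₂ hS
  have h2 := card_sdiff_le_add D D' (Ss₂.flatten ++ top).toFinset
  omega

/-- If `r` belongs to the first part of a split, the pool size and the number of pages of `D`
outside the second part both fall by one. If it belongs to the second part, neither changes. -/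
theorem Lower.hit {D : Finset ℕ} {miss cD : ℕ} {Ss : List (List ℕ)} {top : List ℕ}
    (h : Lower D miss cD Ss top) {r : ℕ} (hn : (Ss.flatten ++ top).Nodup) (hl : Live 0 Ss)
    (hr : r ∈ Ss.flatten) (hrD : r ∈ D) :
    Lower D miss cD (Ss.map fun S => del S r) (top ++ [r]) := by
  intro T₁ T₂ hT
  obtain ⟨Ss₁, Ss₂, rfl, rfl, rfl⟩ := List.map_eq_append_iff.1 hT
  have h1 := h Ss₁ Ss₂ rfl
  have hset : ((Ss₂.map fun S => del S r).flatten ++ (top ++ [r])).toFinset =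
      insert r (Ss₂.flatten ++ top).toFinset := by
    rw [flatten_map_del]
    ext x
    simp only [List.mem_toFinset, List.mem_append, mem_del, List.mem_singleton, Finset.mem_insert]
    by_cases hx : x = r <;> simp [hx]
  rw [hset]
  rw [List.flatten_append, List.append_assoc] at hn
  have hlive : Live 0 Ss₁ := by
    have key : ∀ (n : ℕ) (A B : List (List ℕ)), Live n (A ++ B) → Live n A := by
      intro n A B
      induction A generalizing n with
      | nil => intro _; trivial
      | cons S A ih => exact fun h => ⟨h.1, ih _ h.2⟩
    exact key _ _ _ hl
  by_cases hr2 : r ∈ Ss₁.flatten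
  · have hr3 : r ∉ (Ss₂.flatten ++ top).toFinset := by
      rw [List.mem_toFinset]
      exact fun h' => (List.nodup_append.1 hn).2.2 r hr2 r h' rfl
    have h2 := card_sdiff_insert hrD hr3
    have h3 := (poolSize_map_del hn.of_append_left hr2 hlive).1
    omega
  · have hr3 : r ∈ (Ss₂.flatten ++ top).toFinset := by
      rw [List.flatten_append, List.mem_append] at hr
      rw [List.mem_toFinset]
      exact List.mem_append_left _ (hr.resolve_left hr2)
    rw [Finset.insert_eq_of_mem hr3, map_del_of_notMem hr2]
    exact h1

theorem Lower.fill {D : Finset ℕ} {miss cD : ℕ} {top : List ℕ} (h : Lower D miss cD [] top)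
    {r : ℕ} (hr : r ∉ top) (hrD : r ∈ D) : Lower D (miss + 1) cD [] (top ++ [r]) := by
  intro Ss₁ Ss₂ hS
  obtain ⟨rfl, rfl⟩ := List.append_eq_nil_iff.1 hS.symm
  have h1 := h [] [] rfl
  have h2 := card_sdiff_insert (W := top.toFinset) hrD (by simpa using hr)
  have he : (List.flatten [] ++ (top ++ [r])).toFinset = insert r top.toFinset := by
    ext x; simp
  rw [he]
  rw [List.flatten_nil, List.nil_append] at h1
  omega

/-- For the split with empty second part, the bound at the trivial split with all old stages gives
`miss + 1 ≤ cD`, because `r` is a page of `D` outside the history, and `|D| ≤ k` does the rest. In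
every other split `r` leaves the uncovered part of `D`, which makes room for the additional miss. -/
theorem Lower.miss {D : Finset ℕ} {miss cD k : ℕ} {Ss : List (List ℕ)} {top : List ℕ}
    (h : Lower D miss cD Ss top) {r : ℕ} (hr : r ∉ Ss.flatten) (hr' : r ∉ top) (hrD : r ∈ D)
    (hD : D.card ≤ k) (hk : poolSize 0 Ss + top.length = k) :
    Lower D (miss + 1) cD (Ss ++ [top]) [r] := by
  intro T₁ T₂ hT
  rcases List.eq_nil_or_concat T₂ with rfl | ⟨T, t, rfl⟩
  · rw [List.append_nil] at hT
    subst hT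
    have h1 := h [] Ss rfl
    have h2 := card_sdiff_insert (W := (Ss.flatten ++ top).toFinset) hrD (by simp [hr, hr'])
    have h3 := card_sdiff_insert hrD (Finset.notMem_empty r)
    have he : (List.flatten [] ++ [r]).toFinset = insert r ∅ := by ext x; simp
    rw [he, poolSize_append, poolSize, poolSize]
    rw [Finset.sdiff_empty] at h3
    simp only [poolSize] at h1
    omega
  · rw [List.concat_eq_append, ← List.append_assoc] at hT
    obtain ⟨h1, h2⟩ := List.append_inj' hT rfl
    obtain rfl : top = t := by simpa using h2
    have h3 := h T₁ T h1
    have hr3 : r ∉ (T.flatten ++ top).toFinset := by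
      rw [h1, List.flatten_append] at hr
      simp only [List.mem_append, not_or] at hr
      simp [-List.mem_flatten, hr.2, hr']
    have h4 := card_sdiff_insert hrD hr3
    have he : ((T.concat top).flatten ++ [r]).toFinset = insert r (T.flatten ++ top).toFinset := by
      ext x
      simp only [List.concat_eq_append, List.flatten_append, List.flatten_singleton,
        List.mem_toFinset, List.mem_append, List.mem_singleton, Finset.mem_insert]
      tauto
    rw [he]
    omega

theorem tailHarmonic_ne_top (m : ℕ) : tailHarmonic m ≠ ⊤ := by
  refine (ENNReal.sum_lt_top.2 fun i _ => ?_).ne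
  exact ENNReal.div_lt_top (by simp) (by simp)

/-- Averaged over the evictions, with the stages fixed, the future cost and `H_k` times the misses
so far are bounded by `H_k` times the cost of the other solution plus the stage potential; here
`H_k` appears as `1 + tailHarmonic (k - 1)`. A miss spends `1` on the retrieval and `tailHarmonic (k
- 1)` on the potential of its new stage. Hits in the history are paid by the potential. In the end,
misses are bounded by `Lower` at the trivial split. -/
theorem expCost_le_aux {k : ℕ} (hk : 0 < k) {D : Finset ℕ} {σ : List ℕ} {c : ℕ}
    (h : Serves k D σ c) :
    ∀ (Ss : List (List ℕ)) (top : List ℕ) (miss cD : ℕ), Valid k Ss top →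
      Lower D miss cD Ss top →
      sampleAvg Ss [] (fun vs => expCost k σ (Ss, vs, top)) + (1 + tailHarmonic (k - 1)) * miss ≤
        (1 + tailHarmonic (k - 1)) * ((cD + c : ℕ) : ℝ≥0∞) + stagePotential 0 Ss := by
  induction h with
  | nil D =>
    intro Ss top miss cD _ hL
    have h1 := hL [] Ss rfl
    have h2 : miss ≤ cD := by simp only [poolSize] at h1; omega
    simp only [expCost, sampleAvg_zero, zero_add, add_zero]
    refine le_add_right (mul_le_mul_right ?_ _)
    exact_mod_cast h2
  | @cons D D' r σ c hcard hrD _ ih =>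
    intro Ss top miss cD hV hL
    replace hL := hL.move (D' := D')
    rw [← add_assoc cD]
    set cD' := cD + (D' \ D).card
    have hfin := hV.nodup.of_append_left
    by_cases hr1 : r ∈ top
    · simp only [expCost, pay, bounds, step, if_pos hr1, drawAvg, zero_add]
      exact ih Ss top miss _ hV hL
    by_cases hr2 : r ∈ Ss.flatten
    · obtain ⟨hn', he', hk'⟩ := hV.hit hr2
      obtain ⟨Ts₁, Ts₂, hT, h0, hl, _, hF⟩ := exists_trim hn'.of_append_left he'
      have h3 := ih Ts₂ (top ++ [r]) miss _ (Valid.trim hn' hT h0 hl hk')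
        ((hL.hit hV.nodup hV.live hr2 hrD).trim hT h0)
      -- `h4` bounds the expected cost of this hit by the drop in potential, and `h5` says that
      -- after rerouting the evictions are again uniform, so that `ih` applies.
      have h4 := sampleAvg_memCost_le Ss [] r hr2 (by simpa using hfin) hV.live
      have h5 := sampleAvg_condition Ss [] r (fun vs => expCost k σ
        (addPage (LaminarPaging.trim 0 [] [] (Ss.map fun S => del S r) vs) (top ++ [r]))) hr2
        (by simpa using hfin) hV.live
      rw [hF fun t => expCost k σ (addPage t (top ++ [r]))] at h5
      have h6 : stagePotential 0 (Ss.map fun S => del S r) = stagePotential 0 Ts₁ +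
          stagePotential 0 Ts₂ := by rw [hT, stagePotential_append, h0]
      simp only [expCost, pay, bounds, step, if_neg hr1, if_pos hr2, sampleAvg_add, rerouted]
      rw [List.length_nil] at h4 h5
      rw [h5]
      calc _ = sampleAvg Ss [] (memCost r) + (sampleAvg Ts₂ [] (fun vs => expCost k σ
            (addPage (Ts₂, vs) (top ++ [r]))) + (1 + tailHarmonic (k - 1)) * miss) := by
            rw [add_assoc]
        _ ≤ sampleAvg Ss [] (memCost r) + ((1 + tailHarmonic (k - 1)) *
            ((cD' + c : ℕ) : ℝ≥0∞) + stagePotential 0 (Ss.map fun S => del S r)) := by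
            refine add_le_add_right (h3.trans (add_le_add_right ?_ _)) _
            rw [h6]; exact le_add_self
        _ = (1 + tailHarmonic (k - 1)) * ((cD' + c : ℕ) : ℝ≥0∞) +
            (sampleAvg Ss [] (memCost r) + stagePotential 0 (Ss.map fun S => del S r)) := by ring
        _ ≤ _ := add_le_add_right h4 _
    by_cases hlt : Ss = [] ∧ top.length < k
    · have h3 := ih Ss (top ++ [r]) (miss + 1) cD' (hlt.1 ▸ (hlt.1 ▸ hV).fill hr1 hlt.2)
        (hlt.1 ▸ (hlt.1 ▸ hL).fill hr1 hrD)
      simp only [expCost, pay, bounds, step, if_neg hr1, if_neg hr2, if_pos hlt, drawAvg,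
        sampleAvg_add]
      rw [sampleAvg_const (Ss := Ss) (N := []) (by simpa using hfin) hV.live.evictable]
      refine le_trans ?_ h3
      push_cast
      rw [mul_add, mul_one]
      calc _ = sampleAvg Ss [] (fun vs => expCost k σ (Ss, vs, top ++ [r])) +
            ((1 + tailHarmonic (k - 1)) * miss + 1) := by ring
        _ ≤ _ := by gcongr; exact le_self_add
    · obtain ⟨hn', he', hfull, hk'⟩ := hV.miss hk hr2 hr1 hlt
      obtain ⟨Ts₁, Ts₂, hT, h0, hl, _, hF⟩ := exists_trim hn'.of_append_left he'
      have h3 := ih Ts₂ [r] (miss + 1) _ (Valid.trim hn' hT h0 hl hk')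
        ((hL.miss hr2 hr1 hrD hcard hfull).trim hT h0)
      have h5 := hF fun t => expCost k σ (addPage t [r])
      rw [sampleAvg_snoc] at h5
      have h6 : stagePotential 0 Ts₂ ≤ stagePotential 0 Ss + tailHarmonic (k - 1) := by
        have h7 : stagePotential 0 (Ss ++ [top]) = stagePotential 0 Ts₁ +
          stagePotential 0 Ts₂ := by rw [hT, stagePotential_append, h0]
        rw [stagePotential_append, stagePotential, stagePotential, add_zero, hfull] at h7
        rw [h7]; exact le_add_self
      simp only [expCost, pay, bounds, step, if_neg hr1, if_neg hr2, if_neg hlt, sampleAvg_add,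
        drawAvg, List.headD_cons, victim]
      rw [sampleAvg_const (Ss := Ss) (N := []) (by simpa using hfin) hV.live.evictable,
        sampleAvg_congr (g := fun vs => avg (finalPool [] Ss vs ++ top) fun v => expCost k σ
          (addPage (LaminarPaging.trim 0 [] [] (Ss ++ [top]) (vs ++ [v])) [r]))]
      · rw [h5]
        have h8 : sampleAvg Ts₂ [] (fun vs => expCost k σ (addPage (Ts₂, vs) [r])) +
            (1 + tailHarmonic (k - 1)) * ((miss + 1 : ℕ) : ℝ≥0∞) ≤
            (1 + tailHarmonic (k - 1)) * ((cD' + c : ℕ) : ℝ≥0∞) +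
              (stagePotential 0 Ss + tailHarmonic (k - 1)) :=
          h3.trans (add_le_add_right h6 _)
        -- The potential of the new stage is finite and is cancelled from both sides.
        refine (ENNReal.add_le_add_iff_right (tailHarmonic_ne_top (k - 1))).1 ?_
        refine le_of_eq_of_le ?_ (h8.trans_eq (add_assoc _ _ _).symm)
        push_cast
        ring
      · intro vs hvs
        refine avg_range_getD ?_ (fun v => expCost k σ
          (addPage (LaminarPaging.trim 0 [] [] (Ss ++ [top]) (vs ++ [v])) [r]))
        rw [List.length_append, length_finalPool (by simpa using hfin) hvs, List.length_nil]
        omega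

theorem one_add_tailHarmonic (k : ℕ) (hk : 0 < k) :
    1 + tailHarmonic (k - 1) = ∑ i ∈ Finset.Icc 1 k, 1 / (i : ℝ≥0∞) := by
  obtain ⟨m, rfl⟩ : ∃ m, k = m + 1 := ⟨k - 1, by omega⟩
  rw [Nat.add_sub_cancel]
  induction m with
  | zero => simp [tailHarmonic]
  | succ m ih =>
    rw [Finset.sum_Icc_succ_top (by omega), ← ih (by omega), tailHarmonic_succ, add_assoc]
    congr 3
    push_cast
    ring

/-- The partition algorithm is `H_k`-competitive. -/
theorem expCost_le {k : ℕ} (hk : 0 < k) {σ : List ℕ} {c : ℕ} (h : Serves k ∅ σ c) :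
    expCost k σ ([], [], []) ≤ (∑ i ∈ Finset.Icc 1 k, 1 / (i : ℝ≥0∞)) * c := by
  have := expCost_le_aux hk h [] [] 0 0 ⟨by simp, trivial, fun h => absurd rfl h, by simp [poolSize]⟩
    (fun Ss₁ Ss₂ _ => by simp)
  simpa [sampleAvg, stagePotential, one_add_tailHarmonic k hk] using this

end Stages

/-! ## The cache of the partition algorithm -/

/-- What `reroute` achieves when it turns evictions `vs` for the pool `M` and the stages `Ss` into
evictions for the pool `N` and the stages `Ts`. -/
def RerouteSpec (M : List ℕ) (Ss : List (List ℕ)) (N : List ℕ) (Ts : List (List ℕ)) (y : ℕ)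
    (vs ds : List ℕ) : Prop :=
  Sampled N Ts (reroute N y Ts vs ds).1 ∧
    (finalPool M Ss vs).Perm ((reroute N y Ts vs ds).2 :: finalPool N Ts (reroute N y Ts vs ds).1) ∧
    (y ∉ vs → (reroute N y Ts vs ds).2 = y)

theorem reroute_cons_self (N S : List ℕ) (Ss : List (List ℕ)) (y d : ℕ) (vs ds : List ℕ) :
    reroute N y (S :: Ss) (y :: vs) (d :: ds) =
      ((N ++ S).getD d 0 ::
        (reroute (del (N ++ S) ((N ++ S).getD d 0)) ((N ++ S).getD d 0) Ss vs ds).1,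
        (reroute (del (N ++ S) ((N ++ S).getD d 0)) ((N ++ S).getD d 0) Ss vs ds).2) := by
  rw [reroute]
  simp only [List.headD_cons, List.tail_cons, if_true]

theorem reroute_cons_of_ne (N S : List ℕ) (Ss : List (List ℕ)) {y v : ℕ} (h : v ≠ y) (d : ℕ)
    (vs ds : List ℕ) :
    reroute N y (S :: Ss) (v :: vs) (d :: ds) =
      (v :: (reroute (del (N ++ S) v) y Ss vs ds).1, (reroute (del (N ++ S) v) y Ss vs ds).2) := by
  simp only [reroute, if_neg (show ¬(v :: vs).headD 0 = y from h)]
  rfl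

theorem replacePage_perm {l A : List ℕ} {y r : ℕ} (h : l.Perm (y :: A)) (hl : l.Nodup) :
    (replacePage l y r).Perm (r :: A) := by
  have h1 := h.map fun x => if x = y then r else x
  have h2 := h.nodup_iff.1 hl
  rwa [List.map_cons, if_pos rfl, List.map_congr_left (l := A) (g := id), List.map_id] at h1
  intro x hx
  have hxy : x ≠ y := fun h' => (List.nodup_cons.1 h2).1 (h' ▸ hx)
  exact if_neg hxy

/-- The pointwise counterpart of `reroute_stage`: at each moment the real pool is the new pool
together with one extra page, which is `y` until `y` is evicted and the page chosen in exchange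
afterwards. -/
theorem rerouteSpec_cons {M T N S : List ℕ} {Ss : List (List ℕ)} {y v d : ℕ} {vs ds : List ℕ}
    (hA : (M ++ T).Perm (y :: (N ++ S))) (hn : (y :: (N ++ S) ++ Ss.flatten).Nodup)
    (hv : v ∈ M ++ T) (hd : d < (N ++ S).length)
    (ih : ∀ (N' : List ℕ) (y' : ℕ), (del (M ++ T) v).Perm (y' :: N') →
      (y' :: N' ++ Ss.flatten).Nodup → N'.length + 1 = (N ++ S).length →
      RerouteSpec (del (M ++ T) v) Ss N' Ss y' vs ds) :
    RerouteSpec M (T :: Ss) N (S :: Ss) y (v :: vs) (d :: ds) := by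
  have hy : y ∉ N ++ S := fun h => by
    simp only [List.cons_append, List.nodup_cons, List.mem_append, not_or] at hn
    exact (List.mem_append.1 h).elim hn.1.1.1 hn.1.1.2
  have hA'n : (N ++ S).Nodup := (List.nodup_cons.1 hn.of_append_left).2
  have hsub : ∀ v ∈ N ++ S, (v :: del (N ++ S) v ++ Ss.flatten).Nodup := fun v hv =>
    (List.Perm.nodup_iff ((perm_cons_del hA'n hv).append_right _)).1 (List.nodup_cons.1 hn).2
  unfold RerouteSpec
  by_cases hvy : v = y
  · subst hvy
    have hw : (N ++ S).getD d 0 ∈ N ++ S := by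
      rw [List.getD_eq_getElem _ _ hd]; exact List.getElem_mem hd
    obtain ⟨h1, h2, _⟩ := ih (del (N ++ S) ((N ++ S).getD d 0)) ((N ++ S).getD d 0)
      (by
        refine (del_perm hA v).trans ?_
        rw [del_cons_self, del_of_notMem hy]
        exact perm_cons_del hA'n hw)
      (hsub _ hw) (length_del hA'n hw)
    rw [reroute_cons_self]
    exact ⟨⟨hw, h1⟩, h2, fun h => absurd List.mem_cons_self h⟩
  · have hw : v ∈ N ++ S := (List.mem_cons.1 (hA.mem_iff.1 hv)).resolve_left hvy
    obtain ⟨h1, h2, h3⟩ := ih (del (N ++ S) v) y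
      (by
        rw [← del_cons_of_ne _ (Ne.symm hvy)]
        exact del_perm hA v)
      (List.Nodup.sublist (List.Sublist.append_right (List.filter_sublist.cons_cons y) _) hn)
      (length_del hA'n hw)
    rw [reroute_cons_of_ne N S Ss hvy]
    exact ⟨⟨hw, h1⟩, h2, fun h => h3 fun h' => h (List.mem_cons_of_mem _ h')⟩

theorem rerouteSpec_of_perm {Ss : List (List ℕ)} {M N : List ℕ} {y : ℕ} {vs ds : List ℕ}
    (hM : M.Perm (y :: N)) (hn : (y :: N ++ Ss.flatten).Nodup) (h : Live (N.length + 1) Ss)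
    (hvs : Sampled M Ss vs) (hds : List.Forall₂ (· ≤ ·) ds (stageBounds N.length Ss)) :
    RerouteSpec M Ss N Ss y vs ds := by
  induction Ss generalizing M N y vs ds with
  | nil =>
    obtain rfl := List.length_eq_zero_iff.1 hvs.length_eq
    exact ⟨trivial, hM, fun _ => rfl⟩
  | cons S Ss ih =>
    have hpos := h.1
    rcases vs with _ | ⟨v, vs⟩
    · exact hvs.elim
    rw [stageBounds, List.forall₂_cons_right_iff] at hds
    obtain ⟨d, ds, hd, hds, rfl⟩ := hds
    refine rerouteSpec_cons (hM.append_right S) (by simpa [List.append_assoc] using hn) hvs.1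
      (by rw [List.length_append]; omega) fun N' y' h1 h2 h3 => ?_
    rw [List.length_append] at h3
    refine ih h1 h2 ?_ hvs.2 ?_
    · have := h.2
      rwa [show N.length + 1 + S.length - 1 = N'.length + 1 by omega] at this
    · rwa [show N.length + S.length - 1 = N'.length by omega] at hds

theorem rerouteSpec_map_del {Ss : List (List ℕ)} {N : List ℕ} {r : ℕ} {vs ds : List ℕ}
    (hr : r ∈ Ss.flatten) (hn : (N ++ Ss.flatten).Nodup) (h : Live N.length Ss)
    (hvs : Sampled N Ss vs)
    (hds : List.Forall₂ (· ≤ ·) ds (stageBounds N.length (Ss.map fun S => del S r))) :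
    RerouteSpec N Ss N (Ss.map fun S => del S r) r vs ds := by
  induction Ss generalizing N vs ds with
  | nil => simp at hr
  | cons S Ss ih =>
    have hrN : r ∉ N := fun hrN => (List.nodup_append.1 hn).2.2 r hrN r hr rfl
    have hpos := h.1
    rcases vs with _ | ⟨v, vs⟩
    · exact hvs.elim
    rw [List.map_cons, stageBounds, List.forall₂_cons_right_iff] at hds
    obtain ⟨d, ds, hd, hds, rfl⟩ := hds
    rw [List.map_cons]
    have hlen := length_del (nodup_stage hn v).1 hvs.1
    rw [List.length_append] at hlen
    by_cases hrS : r ∈ S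
    · have hrSs : r ∉ Ss.flatten := fun h' => by
        have := hn.of_append_right
        rw [List.flatten_cons] at this
        exact (List.nodup_append.1 this).2.2 r hrS r h' rfl
      rw [map_del_of_notMem hrSs] at hds ⊢
      have hNS := (nodup_stage hn r).1
      have hA : (N ++ S).Perm (r :: (N ++ del S r)) := by
        have := perm_cons_del hNS (List.mem_append_right N hrS)
        rwa [del_append, del_of_notMem hrN] at this
      have hlenr := hA.length_eq
      rw [List.length_append, List.length_cons, List.length_append] at hlenr
      refine rerouteSpec_cons hA ?_ hvs.1 (by rw [List.length_append]; omega)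
        fun N' y' h1 h2 h3 => ?_
      · rw [List.flatten_cons, ← List.append_assoc] at hn
        exact (List.Perm.nodup_iff (hA.append_right _)).1 hn
      rw [List.length_append] at h3
      refine rerouteSpec_of_perm h1 h2 ?_ hvs.2 ?_
      · have := h.2
        rwa [show N.length + S.length - 1 = N'.length + 1 by omega] at this
      · rwa [show N.length + (del S r).length - 1 = N'.length by omega] at hds
    · have hrSs : r ∈ Ss.flatten := by
        rw [List.flatten_cons, List.mem_append] at hr
        exact hr.resolve_left hrS
      rw [del_of_notMem hrS] at hds ⊢
      have hvr : v ≠ r := by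
        rintro rfl
        rcases List.mem_append.1 hvs.1 with h | h
        · exact hrN h
        · exact hrS h
      have hl : (del (N ++ S) v).length = N.length + S.length - 1 := by omega
      obtain ⟨h1, h2, h3⟩ := ih (N := del (N ++ S) v) (vs := vs) (ds := ds) hrSs
        (nodup_stage hn v).2 (by rw [hl]; exact h.2) hvs.2 (by rwa [hl])
      unfold RerouteSpec
      rw [reroute_cons_of_ne _ _ _ hvr]
      exact ⟨⟨hvs.1, h1⟩, h2, fun h => h3 fun h' => h (List.mem_cons_of_mem _ h')⟩

theorem finalPool_append (Ss Ts : List (List ℕ)) (N vs : List ℕ) :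
    finalPool N (Ss ++ Ts) vs = finalPool (finalPool N Ss vs) Ts (vs.drop Ss.length) := by
  induction Ss generalizing N vs with
  | nil => simp [finalPool]
  | cons S Ss ih => rw [List.cons_append, finalPool, ih]; simp [finalPool]

theorem Sampled.drop {Ss Ts : List (List ℕ)} {N vs : List ℕ} (h : Sampled N (Ss ++ Ts) vs) :
    Sampled (finalPool N Ss vs) Ts (vs.drop Ss.length) := by
  induction Ss generalizing N vs with
  | nil => simpa [finalPool] using h
  | cons S Ss ih => cases vs with
    | nil => exact h.elim
    | cons v vs => simpa [finalPool] using ih h.2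

theorem Sampled.take {Ss Ts : List (List ℕ)} {N vs : List ℕ} (h : Sampled N (Ss ++ Ts) vs) :
    Sampled N Ss (vs.take Ss.length) := by
  induction Ss generalizing N vs with
  | nil => simp [Sampled]
  | cons S Ss ih => cases vs with
    | nil => exact h.elim
    | cons v vs => exact ⟨h.1, ih h.2⟩

theorem finalPool_take (Ss : List (List ℕ)) (N vs : List ℕ) (h : vs.length ≥ Ss.length) :
    finalPool N Ss (vs.take Ss.length) = finalPool N Ss vs := by
  induction Ss generalizing N vs with
  | nil => rfl
  | cons S Ss ih => cases vs with
    | nil => simp at h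
    | cons v vs => simpa [finalPool] using ih _ vs (by simpa using h)

theorem Sampled.snoc {Ss : List (List ℕ)} {S N vs : List ℕ} {v : ℕ} (h : Sampled N Ss vs)
    (hv : v ∈ finalPool N Ss vs ++ S) : Sampled N (Ss ++ [S]) (vs ++ [v]) := by
  induction Ss generalizing N vs with
  | nil =>
    obtain rfl := List.length_eq_zero_iff.1 h.length_eq
    exact ⟨hv, trivial⟩
  | cons T Ss ih => cases vs with
    | nil => exact h.elim
    | cons w vs => exact ⟨h.1, ih h.2 hv⟩

theorem finalPool_snoc {Ss : List (List ℕ)} {S N vs : List ℕ} {v : ℕ} (h : Sampled N Ss vs) :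
    finalPool N (Ss ++ [S]) (vs ++ [v]) = del (finalPool N Ss vs ++ S) v := by
  induction Ss generalizing N vs with
  | nil =>
    obtain rfl := List.length_eq_zero_iff.1 h.length_eq
    rfl
  | cons T Ss ih => cases vs with
    | nil => exact h.elim
    | cons w vs => exact ih h.2

namespace Stages

/-- The invariant of the stages together with the pages in the slots. -/
structure Consistent (k : ℕ) (st : Stages) (slots : List ℕ) : Prop where
  valid : Valid k st.1 st.2.2
  sampled : Sampled [] st.1 st.2.1
  nodup : slots.Nodup
  perm : slots.Perm (finalPool [] st.1 st.2.1 ++ st.2.2)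

/-- The dropped stages end with an empty pool, so the final pool, and with it the contents of the
slots, is determined by the stages that remain. -/
theorem Consistent.addPage {k : ℕ} {Ts : List (List ℕ)} {vs top slots : List ℕ}
    (hn : (Ts.flatten ++ top).Nodup) (he : Evictable 0 Ts) (hk : poolSize 0 Ts + top.length = k)
    (hvs : Sampled [] Ts vs) (hs : slots.Nodup) (hp : slots.Perm (finalPool [] Ts vs ++ top)) :
    Consistent k (addPage (trim 0 [] [] Ts vs) top) slots := by
  obtain ⟨Ts₁, Ts₂, hT, h0, hl, ht, _⟩ := exists_trim hn.of_append_left he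
  rw [ht vs hvs.length_eq]
  have hpool : finalPool [] Ts₁ vs = [] := by
    subst hT
    have h1 := length_finalPool (N := []) (Ss := Ts₁) (vs := vs.take Ts₁.length)
      (by
        rw [List.flatten_append, List.append_assoc] at hn
        simpa using hn.of_append_left) hvs.take
    rw [List.length_nil, h0, finalPool_take _ _ _ (by rw [hvs.length_eq]; simp)] at h1
    exact List.length_eq_zero_iff.1 h1
  have h2 : Sampled [] Ts₂ (vs.drop Ts₁.length) := by
    subst hT
    simpa [hpool] using hvs.drop
  refine ⟨Valid.trim hn hT h0 hl hk, h2, hs, ?_⟩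
  rwa [hT, finalPool_append, hpool] at hp

theorem mem_finalPool {Ss : List (List ℕ)} {N vs : List ℕ} {x : ℕ} (h : x ∈ finalPool N Ss vs) :
    x ∈ N ++ Ss.flatten := by
  induction Ss generalizing N vs with
  | nil => simpa [finalPool] using h
  | cons S Ss ih =>
    have := ih h
    rw [List.mem_append, mem_del, List.mem_append] at this
    rw [List.flatten_cons, List.mem_append, List.mem_append]
    tauto

/-- Serving a request keeps the invariant, brings the page into the cache, and costs at most
`pay`. -/
theorem Consistent.step {k : ℕ} (hk : 0 < k) {st : Stages} {slots : List ℕ} {r : ℕ} {ds : List ℕ}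
    (h : Consistent k st slots) (hds : List.Forall₂ (· ≤ ·) ds (st.bounds k r)) :
    Consistent k (st.step k r ds) (st.nextSlots k slots r ds) ∧
      r ∈ st.nextSlots k slots r ds ∧
      (Cache.retrievals (slotCache k slots) (slotCache k (st.nextSlots k slots r ds)) : ℝ≥0∞) ≤
        st.pay r := by
  obtain ⟨Ss, vs, top⟩ := st
  obtain ⟨hV, hvs, hs, hp⟩ := h
  simp only at hV hvs hp
  have hfin := hV.nodup.of_append_left
  by_cases hr1 : r ∈ top
  · simp only [Stages.step, nextSlots, pay, if_pos hr1]
    exact ⟨⟨hV, hvs, hs, hp⟩, hp.mem_iff.2 (List.mem_append_right _ hr1), by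
      simp [retrievals_self]⟩
  -- A cached page that is not in `top` survives from the pool. Hence a request outside the history
  -- is really a miss.
  have hin : r ∈ slots → r ∈ Ss.flatten := fun h' => by
    have := (List.mem_append.1 (hp.mem_iff.1 h')).resolve_right hr1
    simpa using mem_finalPool this
  by_cases hr2 : r ∈ Ss.flatten
  · obtain ⟨hn', he', hk'⟩ := hV.hit hr2
    simp only [bounds, if_neg hr1, if_pos hr2] at hds
    obtain ⟨h1, h2, h3⟩ := rerouteSpec_map_del (N := []) hr2 (by simpa using hfin) hV.live hvs hds
    simp only [Stages.step, nextSlots, pay, rerouted, if_neg hr1, if_pos hr2]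
    set q := reroute [] r (Ss.map fun S => del S r) vs ds
    have hp' : slots.Perm (q.2 :: (finalPool [] (Ss.map fun S => del S r) q.1 ++ top)) :=
      hp.trans (h2.append_right top)
    have hq : q.2 ∈ slots := hp'.mem_iff.2 List.mem_cons_self
    have hnew : r ∉ finalPool [] (Ss.map fun S => del S r) q.1 ++ top := by
      rw [List.mem_append, not_or]
      refine ⟨fun h' => ?_, hr1⟩
      have := mem_finalPool h'
      rw [flatten_map_del, List.nil_append, mem_del] at this
      exact this.2 rfl
    have hp'' : (replacePage slots q.2 r).Perm
        (finalPool [] (Ss.map fun S => del S r) q.1 ++ (top ++ [r])) := by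
      rw [← List.append_assoc]
      exact (replacePage_perm hp' hs).trans (List.perm_append_singleton _ _).symm
    refine ⟨Consistent.addPage hn' he' hk' h1 ?_ hp'', mem_replacePage.2 (Or.inl ⟨rfl, hq⟩), ?_⟩
    · refine hp''.nodup_iff.2 ?_
      rw [← List.append_assoc]
      refine (List.perm_append_singleton _ _).nodup_iff.2 (List.nodup_cons.2 ⟨hnew, ?_⟩)
      exact (List.nodup_cons.1 (hp'.nodup_iff.1 hs)).2
    -- If `r` was never evicted, the extra page left by rerouting is `r` itself, and the replacement
    -- changes nothing.
    · unfold memCost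
      split_ifs with hrv
      · exact_mod_cast retrievals_replace k hs q.2 r
      · rw [h3 hrv, replacePage_self, retrievals_self]; simp
  have hrs : r ∉ slots := fun h => hr2 (hin h)
  by_cases hlt : Ss = [] ∧ top.length < k
  · obtain ⟨rfl, hlt'⟩ := hlt
    simp only [Stages.step, nextSlots, pay, if_neg hr1, if_neg hr2, if_pos hlt', true_and]
    refine ⟨⟨hV.fill hr1 hlt', hvs, ?_, ?_⟩, by simp, ?_⟩
    · exact (List.perm_append_singleton _ _).nodup_iff.2 (List.nodup_cons.2 ⟨hrs, hs⟩)
    · simp only [← List.append_assoc]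
      exact hp.append_right _
    · exact_mod_cast retrievals_append k slots r
  · obtain ⟨hn', he', hfull, hk'⟩ := hV.miss hk hr2 hr1 hlt
    simp only [bounds, if_neg hr1, if_neg hr2, if_neg hlt, List.forall₂_cons_right_iff,
      List.forall₂_nil_right_iff] at hds
    obtain ⟨d, _, hd, rfl, rfl⟩ := hds
    simp only [Stages.step, nextSlots, pay, victim, if_neg hr1, if_neg hr2, if_neg hlt,
      List.headD_cons]
    have hlen : (finalPool [] Ss vs ++ top).length = k := by
      rw [List.length_append, length_finalPool (by simpa using hfin) hvs, List.length_nil, hfull]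
    have hv : (finalPool [] Ss vs ++ top).getD d 0 ∈ finalPool [] Ss vs ++ top := by
      rw [List.getD_eq_getElem _ _ (by omega)]; exact List.getElem_mem (by omega)
    set v := (finalPool [] Ss vs ++ top).getD d 0
    have hs' := hp.nodup_iff.1 hs
    have hp'' : (replacePage slots v r).Perm
        (finalPool [] (Ss ++ [top]) (vs ++ [v]) ++ [r]) := by
      rw [finalPool_snoc hvs]
      exact (replacePage_perm (hp.trans (perm_cons_del hs' hv)) hs).trans
        (List.perm_append_singleton _ _).symm
    refine ⟨Consistent.addPage hn' he' hk' (hvs.snoc hv) (nodup_replacePage hs (Or.inl hrs)) hp'',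
      mem_replacePage.2 (Or.inl ⟨rfl, hp.mem_iff.2 hv⟩), ?_⟩
    exact_mod_cast retrievals_replace k hs v r

end Stages

/-! ### Size bounds and polynomial-time computation for stages. -/

section

variable {α β γ δ : Type} [Enc α] [Enc β] [Enc γ] [Enc δ]

theorem esize_filter_le (l : List α) (t : α → Bool) : esize (l.filter t) ≤ esize l := by
  induction l with
  | nil => exact le_rfl
  | cons a l ih =>
    rw [List.filter_cons]
    split_ifs <;> simp only [esize_cons] <;> omega

theorem esize_headD_add_tail_le (l : List ℕ) : esize (l.headD 0) + esize l.tail ≤ esize l + 1 := by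
  cases l with
  | nil => simp [esize_nil, esize_nat]
  | cons a l => simp only [esize_cons, List.headD_cons, List.tail_cons]; omega

theorem esize_getD_le {l : List ℕ} {B : ℕ} (h : ∀ x ∈ l, esize x ≤ B) (hB : 0 < B) (i : ℕ) :
    esize (l.getD i 0) ≤ B := by
  rcases Nat.lt_or_ge i l.length with hi | hi
  · rw [List.getD_eq_getElem _ _ hi]
    exact h _ (List.getElem_mem hi)
  · rw [List.getD_eq_default _ _ hi]
    rw [esize_nat, Nat.size_zero]
    omega

theorem esize_length_le (l : List α) : esize l.length ≤ esize l := by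
  have h1 := length_lt_esize l
  have h2 : Nat.size l.length ≤ l.length := Nat.size_le.2 Nat.lt_two_pow_self
  rw [esize_nat]
  omega

namespace PolyTime

/-- A fold whose accumulator satisfies an invariant that bounds its size. -/
theorem foldl_of_inv {l : α → List γ} {init : α → β} {step : α × γ × β → β} (hl : PolyTime l)
    (hi : PolyTime init) (hs : PolyTime step) (Inv : α → ℕ → β → Prop)
    (h0 : ∀ a, Inv a 0 (init a))
    (hstep : ∀ a, ∀ x ∈ l a, ∀ n acc, Inv a n acc → Inv a (n + 1) (step (a, x, acc)))
    (hQ : ∃ Q : Polynomial ℕ, ∀ a n acc, n ≤ (l a).length → Inv a n acc →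
      esize acc ≤ Q.eval (esize a)) :
    PolyTime fun a => (l a).foldl (fun acc x => step (a, x, acc)) (init a) := by
  obtain ⟨Q, hQ⟩ := hQ
  refine foldl hl hi hs ⟨Q, fun a l₁ l₂ h => hQ a l₁.length _ (by simp [h]) ?_⟩
  induction l₁ using List.reverseRecOn generalizing l₂ with
  | nil => exact h0 a
  | append_singleton l₁ x ih =>
    rw [List.foldl_append, List.length_append]
    exact hstep a x (by simp [h]) _ _ (ih (x :: l₂) (by simpa using h))

theorem mem_flatten {f : α → ℕ} {l : α → List (List ℕ)} (hf : PolyTime f) (hl : PolyTime l) :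
    PolyTime fun a => decide (f a ∈ (l a).flatten) := by
  have := any hl (t := fun z : α × List ℕ => decide (f z.1 ∈ z.2)) (mem (hf.comp fst) snd)
  convert this using 2 with a
  rw [Bool.eq_iff_iff]
  simp

theorem del {A : α → List ℕ} {v : α → ℕ} (hA : PolyTime A) (hv : PolyTime v) :
    PolyTime fun a => LaminarPaging.del (A a) (v a) :=
  filter hA (t := fun z : α × ℕ => !decide (z.2 = v z.1)) (nat_eq snd (hv.comp fst)).not

theorem replacePage {l : α → List ℕ} {y v : α → ℕ} (hl : PolyTime l) (hy : PolyTime y)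
    (hv : PolyTime v) : PolyTime fun a => LaminarPaging.replacePage (l a) (y a) (v a) :=
  map hl (f := fun z : α × ℕ => if z.2 = y z.1 then v z.1 else z.2)
    (ite_prop (nat_eq snd (hy.comp fst)) (hv.comp fst) snd)

theorem singleton {f : α → β} (hf : PolyTime f) : PolyTime fun a => [f a] := cons hf const_nil

theorem finalPool {Ss : α → List (List ℕ)} {vs : α → List ℕ} (hS : PolyTime Ss)
    (hv : PolyTime vs) : PolyTime fun a => LaminarPaging.finalPool [] (Ss a) (vs a) := by
  have := foldl_of_growth (init := fun a => (([] : List ℕ), vs a))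
    (step := fun z : α × List ℕ × List ℕ × List ℕ =>
      (LaminarPaging.del (z.2.2.1 ++ z.2.1) (z.2.2.2.headD 0), z.2.2.2.tail)) hS
    (const_nil.pair hv)
    ((del (append snd.snd'.fst' snd.fst') (headD snd.snd'.snd')).pair (tail snd.snd'.snd'))
    ⟨Polynomial.X + 1, fun a S ⟨N, us⟩ => by
      have h1 := esize_filter_le (N ++ S) fun x => !decide (x = us.headD 0)
      have h2 := esize_append N S
      have h3 := esize_headD_add_tail_le us
      have h4 := esize_pos (us.headD 0)
      simp only [esize_pair, Polynomial.eval_add, Polynomial.eval_X, Polynomial.eval_one,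
        LaminarPaging.del]
      omega⟩
  have key : ∀ (Ss : List (List ℕ)) (N vs : List ℕ),
      (Ss.foldl (fun (acc : List ℕ × List ℕ) S =>
        (LaminarPaging.del (acc.1 ++ S) (acc.2.headD 0), acc.2.tail)) (N, vs)).1 =
        LaminarPaging.finalPool N Ss vs := by
    intro Ss
    induction Ss with
    | nil => intro N vs; rfl
    | cons S Ss ih => intro N vs; exact ih _ _
  convert this.fst' using 2 with a
  exact (key _ _ _).symm

theorem trim {Ss : α → List (List ℕ)} {vs : α → List ℕ} (hS : PolyTime Ss)
    (hv : PolyTime vs) : PolyTime fun a => LaminarPaging.trim 0 [] [] (Ss a) (vs a) := by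
  have := foldl_of_growth (β := ℕ × List (List ℕ) × List ℕ × List ℕ)
    (init := fun a => (0, [], [], vs a))
    (step := fun z : α × List ℕ × ℕ × List (List ℕ) × List ℕ × List ℕ =>
      if z.2.2.1 + z.2.1.length - 1 = 0 then (0, [], [], z.2.2.2.2.2.tail)
      else (z.2.2.1 + z.2.1.length - 1, z.2.2.2.1 ++ [z.2.1],
        z.2.2.2.2.1 ++ [z.2.2.2.2.2.headD 0], z.2.2.2.2.2.tail)) hS
    ((const_nat 0).pair (const_nil.pair (const_nil.pair hv)))
    (have hn := nat_sub (nat_add snd.snd'.fst' (length snd.fst')) (const_nat 1)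
     have hvs := snd.snd'.snd'.snd'.snd'
     ite_prop (nat_eq hn (const_nat 0)) ((const_nat 0).pair (const_nil.pair (const_nil.pair
        (tail hvs))))
      (hn.pair ((append snd.snd'.snd'.fst' (singleton snd.fst')).pair
        ((append snd.snd'.snd'.snd'.fst' (singleton (headD hvs))).pair (tail hvs)))))
    ⟨2 * Polynomial.X + 10, fun a S ⟨n, aS, aV, us⟩ => by
      have h3 := esize_headD_add_tail_le us
      have h4 := esize_pos (us.headD 0)
      have h5 := esize_append aS [S]
      have h6 := esize_append aV [us.headD 0]
      have h7 := esize_pos aS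
      have h8 := esize_pos aV
      have h9 : Nat.size (n + S.length - 1) ≤ Nat.size (n + S.length) := Nat.size_le_size (by omega)
      have h10 := natSize_add_le n S.length
      have h11 := esize_length_le S
      have h12 : Nat.size 0 = 0 := Nat.size_zero
      simp only [Polynomial.eval_add, Polynomial.eval_X, Polynomial.eval_mul,
        Polynomial.eval_ofNat, esize_cons, esize_nil] at *
      split_ifs <;> simp only [esize_pair, esize_nat, esize_nil] at * <;> omega⟩
  have key : ∀ (Ss : List (List ℕ)) (n : ℕ) (aS : List (List ℕ)) (aV vs : List ℕ),
      (fun p : ℕ × List (List ℕ) × List ℕ × List ℕ => (p.2.1, p.2.2.1))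
      (Ss.foldl (fun (acc : ℕ × List (List ℕ) × List ℕ × List ℕ) S =>
        if acc.1 + S.length - 1 = 0 then (0, [], [], acc.2.2.2.tail)
        else (acc.1 + S.length - 1, acc.2.1 ++ [S], acc.2.2.1 ++ [acc.2.2.2.headD 0],
          acc.2.2.2.tail)) (n, aS, aV, vs)) = LaminarPaging.trim n aS aV Ss vs := by
    intro Ss
    induction Ss with
    | nil => intro n aS aV vs; rfl
    | cons S Ss ih =>
      intro n aS aV vs
      rw [List.foldl_cons, LaminarPaging.trim]
      split_ifs with h
      · exact ih _ _ _ _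
      · exact ih _ _ _ _
  convert this.snd'.fst'.pair this.snd'.snd'.fst' using 2 with a
  exact (key _ _ _ _ _).symm

/-- Each step appends a copy of the running pool size, so the growth is not bounded by the inputs of
the step alone. The invariant bounds the size of the counter linearly in the number of steps. -/
theorem stageBounds {Ss : α → List (List ℕ)} (hS : PolyTime Ss) :
    PolyTime fun a => LaminarPaging.stageBounds 0 (Ss a) := by
  obtain ⟨p, hp⟩ := hS.size_le
  have hn : PolyTime fun z : α × List ℕ × ℕ × List ℕ => z.2.2.1 + z.2.1.length - 1 :=
    nat_sub (nat_add snd.snd'.fst' (length snd.fst')) (const_nat 1)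
  have := foldl_of_inv (β := ℕ × List ℕ) (init := fun _ => (0, []))
    (step := fun z : α × List ℕ × ℕ × List ℕ =>
      (z.2.2.1 + z.2.1.length - 1, z.2.2.2 ++ [z.2.2.1 + z.2.1.length - 1])) hS
    ((const_nat 0).pair const_nil) (hn.pair (append snd.snd'.snd' (singleton hn)))
    (fun a m acc => esize acc.1 ≤ m * (p.eval (esize a) + 1) + 1 ∧ acc.2.length = m ∧
      ∀ x ∈ acc.2, esize x ≤ m * (p.eval (esize a) + 1) + 1)
    (fun a => ⟨by simp [esize_nat], rfl, by simp⟩)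
    (fun a S hSa m ⟨n, out⟩ ⟨h1, h2, h3⟩ => by
      have h4 : esize (n + S.length - 1) ≤ (m + 1) * (p.eval (esize a) + 1) + 1 := by
        have h9 : Nat.size (n + S.length - 1) ≤ Nat.size (n + S.length) :=
          Nat.size_le_size (by omega)
        have h10 := natSize_add_le n S.length
        have h11 := esize_length_le S
        have h12 := (esize_mem hSa).le.trans (hp a)
        rw [add_mul, one_mul]
        simp only [esize_nat] at *
        omega
      refine ⟨h4, by simp [h2], fun x hx => ?_⟩
      rcases List.mem_append.1 hx with hx | hx
      · refine (h3 x hx).trans ?_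
        rw [add_mul]
        omega
      · rw [List.mem_singleton.1 hx]; exact h4)
    ⟨p * (p + 1) + p * (p * (p + 1) + 2) + 3, fun a m ⟨n, out⟩ hm ⟨h1, h2, h3⟩ => by
      have h4 := esize_list_le h3
      have h5 := length_lt_esize (Ss a)
      have h6 : m ≤ p.eval (esize a) := by have := hp a; omega
      have h7 := Nat.mul_le_mul_right (p.eval (esize a) + 1) h6
      have h8 := Nat.mul_le_mul h6 (Nat.add_le_add_right h7 2)
      simp only [Polynomial.eval_add, Polynomial.eval_mul, Polynomial.eval_one,
        Polynomial.eval_ofNat, esize_pair] at *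
      rw [h2] at h4
      have h9 : m * (m * (p.eval (esize a) + 1) + 1 + 1) =
        m * (m * (p.eval (esize a) + 1) + 2) := rfl
      omega⟩
  have key : ∀ (Ss : List (List ℕ)) (n : ℕ) (out : List ℕ),
      (Ss.foldl (fun (acc : ℕ × List ℕ) S =>
        (acc.1 + S.length - 1, acc.2 ++ [acc.1 + S.length - 1])) (n, out)).2 =
        out ++ LaminarPaging.stageBounds n Ss := by
    intro Ss
    induction Ss with
    | nil => intro n out; simp [LaminarPaging.stageBounds]
    | cons S Ss ih => intro n out; rw [List.foldl_cons, ih, LaminarPaging.stageBounds]; simp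
  convert this.snd' using 2 with a
  simpa using (key (Ss a) 0 []).symm

/-- All pages handled are copied from the inputs or are the default `0`, so each keeps a size at
most `p`; only the lengths of the pool and of the output grow. -/
theorem reroute {y : α → ℕ} {Ss : α → List (List ℕ)} {vs ds : α → List ℕ} (hy : PolyTime y)
    (hS : PolyTime Ss) (hv : PolyTime vs) (hd : PolyTime ds) :
    PolyTime fun a => LaminarPaging.reroute [] (y a) (Ss a) (vs a) (ds a) := by
  obtain ⟨p, hp⟩ : ∃ p : Polynomial ℕ, ∀ a, esize (y a) ≤ p.eval (esize a) ∧
      esize (Ss a) ≤ p.eval (esize a) ∧ esize (vs a) ≤ p.eval (esize a) ∧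
      esize (ds a) ≤ p.eval (esize a) := by
    obtain ⟨p₁, h₁⟩ := hy.exists_add_le hS
    obtain ⟨p₂, h₂⟩ := hv.exists_add_le hd
    refine ⟨p₁ + p₂, fun a => ?_⟩
    have := h₁ a
    have := h₂ a
    rw [Polynomial.eval_add]
    omega
  let w : α × List ℕ × List ℕ × ℕ × List ℕ × List ℕ × List ℕ → ℕ := fun z =>
    if z.2.2.2.2.1.headD 0 = z.2.2.2.1 then (z.2.2.1 ++ z.2.1).getD (z.2.2.2.2.2.1.headD 0) 0
    else z.2.2.2.2.1.headD 0
  have hN : PolyTime fun z : α × List ℕ × List ℕ × ℕ × List ℕ × List ℕ × List ℕ =>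
    z.2.2.1 ++ z.2.1 := append snd.snd'.fst' snd.fst'
  have hvs : PolyTime fun z : α × List ℕ × List ℕ × ℕ × List ℕ × List ℕ × List ℕ =>
    z.2.2.2.2.1 := snd.snd'.snd'.snd'.fst'
  have hds : PolyTime fun z : α × List ℕ × List ℕ × ℕ × List ℕ × List ℕ × List ℕ =>
    z.2.2.2.2.2.1 := snd.snd'.snd'.snd'.snd'.fst'
  have ht : PolyTime fun z : α × List ℕ × List ℕ × ℕ × List ℕ × List ℕ × List ℕ =>
    decide (z.2.2.2.2.1.headD 0 = z.2.2.2.1) := nat_eq (headD hvs) snd.snd'.snd'.fst'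
  have hw : PolyTime w := ite_prop ht (getD hN (headD hds)) (headD hvs)
  have := foldl_of_inv (β := List ℕ × ℕ × List ℕ × List ℕ × List ℕ)
    (init := fun a => ([], y a, vs a, ds a, []))
    (step := fun z => (LaminarPaging.del (z.2.2.1 ++ z.2.1) (w z),
      if z.2.2.2.2.1.headD 0 = z.2.2.2.1 then w z else z.2.2.2.1, z.2.2.2.2.1.tail,
      z.2.2.2.2.2.1.tail, z.2.2.2.2.2.2 ++ [w z])) hS
    (const_nil.pair (hy.pair (hv.pair (hd.pair const_nil))))
    ((del hN hw).pair ((ite_prop ht hw snd.snd'.snd'.fst').pair ((tail hvs).pair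
      ((tail hds).pair (append snd.snd'.snd'.snd'.snd'.snd' (singleton hw))))))
    (fun a n acc => esize acc.1 ≤ n * p.eval (esize a) + 1 ∧
      (∀ x ∈ acc.1, esize x ≤ p.eval (esize a)) ∧ esize acc.2.1 ≤ p.eval (esize a) ∧
      esize acc.2.2.1 ≤ p.eval (esize a) ∧ esize acc.2.2.2.1 ≤ p.eval (esize a) ∧
      acc.2.2.2.2.length = n ∧ ∀ x ∈ acc.2.2.2.2, esize x ≤ p.eval (esize a))
    (fun a => ⟨by simp [esize_nil], by simp, (hp a).1, (hp a).2.2.1, (hp a).2.2.2, rfl, by simp⟩)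
    (fun a S hSa n ⟨N, u, us, es, out⟩ ⟨h1, h2, h3, h4, h5, h6, h7⟩ => by
      simp only at h1 h2 h3 h4 h5 h6 h7
      have hSle := (esize_mem hSa).le.trans (hp a).2.1
      have hmem : ∀ x ∈ N ++ S, esize x ≤ p.eval (esize a) := fun x hx => by
        rcases List.mem_append.1 hx with hx | hx
        · exact h2 x hx
        · exact (esize_mem hx).le.trans hSle
      have hpos : 0 < p.eval (esize a) := (esize_pos u).trans_le h3
      have hus := esize_headD_add_tail_le us
      have hes := esize_headD_add_tail_le es
      have hus' := esize_pos (us.headD 0)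
      have hut := esize_pos us.tail
      have hes' := esize_pos (es.headD 0)
      have hwle : esize (w (a, S, N, u, us, es, out)) ≤ p.eval (esize a) := by
        simp only [w]
        split_ifs
        · exact esize_getD_le hmem hpos _
        · omega
      refine ⟨?_, fun x hx => hmem x (mem_del.1 hx).1, ?_, ?_, ?_, by simp [h6], fun x hx => ?_⟩
      · have h8 := esize_filter_le (N ++ S) fun x => !decide (x = w (a, S, N, u, us, es, out))
        have h9 := esize_append N S
        simp only [LaminarPaging.del, add_mul, one_mul]
        omega
      · dsimp only
        split_ifs
        · exact hwle
        · exact h3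
      · dsimp only; omega
      · dsimp only; omega
      · rcases List.mem_append.1 hx with hx | hx
        · exact h7 x hx
        · rw [List.mem_singleton.1 hx]; exact hwle)
    ⟨p * p + p * (p + 1) + 3 * p + 6, fun a n ⟨N, u, us, es, out⟩ hn
        ⟨h1, h2, h3, h4, h5, h6, h7⟩ => by
      have h8 := esize_list_le h7
      have h9 := length_lt_esize (Ss a)
      have h10 : n ≤ p.eval (esize a) := by have := (hp a).2.1; omega
      have h11 := Nat.mul_le_mul_right (p.eval (esize a)) h10
      have h12 := Nat.mul_le_mul_right (p.eval (esize a) + 1) h10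
      simp only [Polynomial.eval_add, Polynomial.eval_mul, Polynomial.eval_one,
        Polynomial.eval_ofNat, esize_pair] at *
      rw [h6] at h8
      omega⟩
  have key : ∀ (Ss : List (List ℕ)) (N : List ℕ) (y : ℕ) (vs ds out : List ℕ) (a : α),
      (fun q : List ℕ × ℕ × List ℕ × List ℕ × List ℕ => (q.2.2.2.2, q.2.1))
      (Ss.foldl (fun acc S => (LaminarPaging.del (acc.1 ++ S) (w (a, S, acc)),
        if acc.2.2.1.headD 0 = acc.2.1 then w (a, S, acc) else acc.2.1, acc.2.2.1.tail,
        acc.2.2.2.1.tail, acc.2.2.2.2 ++ [w (a, S, acc)])) (N, y, vs, ds, out)) =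
      (out ++ (LaminarPaging.reroute N y Ss vs ds).1,
        (LaminarPaging.reroute N y Ss vs ds).2) := by
    intro Ss
    induction Ss with
    | nil => intro N y vs ds out a; simp [LaminarPaging.reroute]
    | cons S Ss ih =>
      intro N y vs ds out a
      rw [List.foldl_cons, ih, LaminarPaging.reroute]
      simp [w]
  convert this.snd'.snd'.snd'.snd'.pair this.snd'.fst' using 2 with a
  simpa using (key (Ss a) [] (y a) (vs a) (ds a) [] a).symm

end PolyTime

end

/-! ## Expectations -/

/-- The expectation of `f`. -/
def expect {α : Type*} (μ : PMF α) (f : α → ℝ≥0∞) : ℝ≥0∞ := ∑' a, μ a * f a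

theorem expect_pure {α : Type*} (a : α) (f : α → ℝ≥0∞) : expect (PMF.pure a) f = f a := by
  rw [expect, tsum_eq_single a fun b hb => by simp [PMF.pure_apply, hb]]
  simp

theorem expect_bind {α β : Type*} (μ : PMF α) (κ : α → PMF β) (f : β → ℝ≥0∞) :
    expect (μ.bind κ) f = expect μ fun a => expect (κ a) f := by
  simp only [expect, PMF.bind_apply, ← ENNReal.tsum_mul_left, ← ENNReal.tsum_mul_right]
  rw [ENNReal.tsum_comm]
  simp only [mul_assoc]

theorem expect_map {α β : Type*} (μ : PMF α) (g : α → β) (f : β → ℝ≥0∞) :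
    expect (μ.map g) f = expect μ fun a => f (g a) := by
  rw [PMF.map, expect_bind]
  simp only [Function.comp, expect_pure]

theorem expect_mono {α : Type*} {μ : PMF α} {f g : α → ℝ≥0∞} (h : ∀ a ∈ μ.support, f a ≤ g a) :
    expect μ f ≤ expect μ g := by
  refine ENNReal.tsum_le_tsum fun a => ?_
  by_cases ha : a ∈ μ.support
  · exact mul_le_mul_right (h a ha) _
  · simp [(PMF.apply_eq_zero_iff μ a).2 ha]

theorem expect_const_add {α : Type*} (μ : PMF α) (c : ℝ≥0∞) (f : α → ℝ≥0∞) :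
    (expect μ fun a => c + f a) = c + expect μ f := by
  simp only [expect, mul_add, ENNReal.tsum_add, ENNReal.tsum_mul_right, PMF.tsum_coe, one_mul]

theorem expect_uniformNat (n : ℕ) (f : ℕ → ℝ≥0∞) :
    expect (uniformNat n) f = avg (List.range (n + 1)) f := by
  have hsum : ((List.range (n + 1)).map f).sum = ∑ i ∈ Finset.range (n + 1), f i := rfl
  rw [uniformNat, expect_map, expect, tsum_fintype, avg, List.length_range, hsum]
  simp only [PMF.uniformOfFintype_apply, Fintype.card_fin]
  rw [← Finset.mul_sum, Fin.sum_univ_eq_sum_range f (n + 1), ENNReal.div_eq_inv_mul]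

/-- Independent uniform draws from `{0, …, b}` for `b ∈ bs`. -/
def drawList : List ℕ → PMF (List ℕ)
  | [] => PMF.pure []
  | b :: bs => (uniformNat b).bind fun d => (drawList bs).map fun ds => d :: ds

theorem expect_drawList (bs : List ℕ) (f : List ℕ → ℝ≥0∞) :
    expect (drawList bs) f = drawAvg bs f := by
  induction bs generalizing f with
  | nil => exact expect_pure _ _
  | cons b bs ih =>
    rw [drawList, expect_bind, expect_uniformNat, drawAvg]
    simp only [expect_map, ih]

theorem mem_support_uniformNat {n d : ℕ} (h : d ∈ (uniformNat n).support) : d ≤ n := by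
  rw [uniformNat, PMF.support_map] at h
  obtain ⟨i, _, rfl⟩ := h
  omega

theorem mem_support_drawList {bs ds : List ℕ} (h : ds ∈ (drawList bs).support) :
    List.Forall₂ (· ≤ ·) ds bs := by
  induction bs generalizing ds with
  | nil =>
    obtain rfl : ds = [] := by simpa [drawList] using h
    exact List.Forall₂.nil
  | cons b bs ih =>
    rw [drawList, PMF.mem_support_bind_iff] at h
    obtain ⟨d, hd, h⟩ := h
    rw [PMF.support_map] at h
    obtain ⟨ds, hds, rfl⟩ := h
    exact List.Forall₂.cons (mem_support_uniformNat hd) (ih hds)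

theorem esize_le_of_forall₂ {ds bs : List ℕ} (h : List.Forall₂ (· ≤ ·) ds bs) :
    esize ds ≤ esize bs := by
  induction h with
  | nil => exact le_rfl
  | cons hd _ ih =>
    have := Nat.size_le_size hd
    simp only [esize_cons, esize_nat]
    omega

/-! ## Programs that draw -/

/-- While register `4` holds a nonempty list, its first element is removed and taken as the bound
for a random draw, the result of which is added to the list in register `5`. -/
def drawLoop : Com :=
  .loop (.isPair (.reg 4)) (.seq (.draw 6 (.fst (.reg 4)))
    (.seq (.assign 5 (.pair (.reg 6) (.reg 5))) (.assign 4 (.snd (.reg 4)))))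

/-- The number and the bounds of the draws are fixed by register `4` at the start, so the outcome is
a function `g` of the list of draws. Register `5` collects them in reverse order. -/
theorem drawLoop_spec : ∃ p : Polynomial ℕ, ∀ (bs acc : List ℕ) (s : Store) (n : ℕ),
    s 4 = enc bs → s 5 = enc acc → esize bs + esize acc ≤ n → ∃ g : List ℕ → Store,
      drawLoop.Spec s (bs.length * p.eval n + p.eval n) ((drawList bs).map g) ∧
      ∀ ds ∈ (drawList bs).support, g ds 5 = enc (ds.reverse ++ acc) ∧ ∀ i < 4, g ds i = s i := by
  obtain ⟨p₁, h₁⟩ := (Exp.isPair (.reg 4)).exists_bound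
  obtain ⟨p₂, h₂⟩ := (Exp.fst (.reg 4)).exists_bound
  obtain ⟨p₃, h₃⟩ := (Exp.pair (.reg 6) (.reg 5)).exists_bound
  obtain ⟨p₄, h₄⟩ := (Exp.snd (.reg 4)).exists_bound
  refine ⟨p₁ + p₂ + p₃ + p₄ + 10, fun bs => ?_⟩
  induction bs with
  | nil =>
    intro acc s n hs4 hs5 hn
    rw [esize_nil] at hn
    refine ⟨fun _ => s, ?_, fun ds hds => ?_⟩
    · have h := Com.spec_loop_false (a := .seq (.draw 6 (.fst (.reg 4)))
        (.seq (.assign 5 (.pair (.reg 6) (.reg 5))) (.assign 4 (.snd (.reg 4)))))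
        (show (Exp.isPair (.reg 4)).test s = false by
          simp [Exp.test, Exp.eval, hs4, enc_nil, Val.isPair, Val.ofBool])
      rw [drawList, PMF.pure_map]
      refine Com.Spec.mono h ?_
      have := (h₁ s n fun i hi => by
        simp only [Exp.regs, List.mem_singleton] at hi
        subst hi
        rw [hs4, enc_nil]
        have := esize_pos acc
        simp [Val.size]; omega).1
      simp only [Polynomial.eval_add, Polynomial.eval_ofNat]
      omega
    · obtain rfl : ds = [] := by simpa [drawList] using hds
      exact ⟨by simpa using hs5, fun _ _ => rfl⟩
  | cons b bs ih =>
    intro acc s n hs4 hs5 hn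
    have hsz : esize (b :: bs) = esize b + esize bs + 1 := esize_cons b bs
    -- the registers after one iteration
    let s₁ : ℕ → Store := fun d => Function.update s 6 (Val.num d)
    let s₂ : ℕ → Store := fun d => Function.update (s₁ d) 5 (enc (d :: acc))
    let s₃ : ℕ → Store := fun d => Function.update (s₂ d) 4 (enc bs)
    have hacc : ∀ d ≤ b, esize bs + esize (d :: acc) ≤ n := fun d hd => by
      have := Nat.size_le_size hd
      rw [esize_cons, esize_nat]
      rw [esize_nat] at hsz
      omega
    -- A function is chosen for every `d`, with an arbitrary value for those `d > b` that are never
    -- drawn.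
    have hex : ∀ d, ∃ g : List ℕ → Store, d ≤ b →
        drawLoop.Spec (s₃ d) (bs.length * (p₁ + p₂ + p₃ + p₄ + 10).eval n +
          (p₁ + p₂ + p₃ + p₄ + 10).eval n) ((drawList bs).map g) ∧
        ∀ ds ∈ (drawList bs).support, g ds 5 = enc (ds.reverse ++ d :: acc) ∧
          ∀ i < 4, g ds i = s₃ d i := fun d => by
      by_cases hd : d ≤ b
      · obtain ⟨g, hg⟩ := ih (d :: acc) (s₃ d) n (by simp [s₃]) (by simp [s₃, s₂]) (hacc d hd)
        exact ⟨g, fun _ => hg⟩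
      · exact ⟨fun _ => s, fun h => absurd h hd⟩
    choose g hg using hex
    have hbody : (Com.seq (.draw 6 (.fst (.reg 4)))
        (.seq (.assign 5 (.pair (.reg 6) (.reg 5))) (.assign 4 (.snd (.reg 4))))).Spec s
        (p₂.eval n + p₃.eval n + p₄.eval n + 7) ((uniformNat b).map s₃) := by
      have hr4 : ((s 4).size ≤ n) := by
        have : (s 4).size = esize (b :: bs) := by rw [hs4]; rfl
        omega
      have hd := Com.spec_draw 6 (.fst (.reg 4)) s
      have he : ((Exp.fst (.reg 4)).eval s).toNat = b := by
        simp [Exp.eval, hs4, enc_cons, Val.fst, enc_nat, Val.toNat]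
      rw [he] at hd
      have ht := (h₂ s n fun i hi => by
        simp only [Exp.regs, List.mem_singleton] at hi
        subst hi; exact hr4).1
      have hb := Com.Spec.seq (T₂ := p₃.eval n + p₄.eval n + 4)
        (ν := fun s' => PMF.pure (s₃ ((s' 6).toNat))) hd (b := (Com.seq
          (.assign 5 (.pair (.reg 6) (.reg 5))) (.assign 4 (.snd (.reg 4))))) fun s' hs' => by
        rw [PMF.support_map] at hs'
        obtain ⟨d, hd, rfl⟩ := hs'
        have hdb := mem_support_uniformNat hd
        have h6 : (s₁ d 6) = Val.num d := by simp [s₁]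
        have h5 : (s₁ d 5) = enc acc := by simp [s₁, hs5]
        have h4 : (s₂ d 4) = enc (b :: bs) := by simp [s₂, s₁, hs4]
        have ha := Com.spec_assign 5 (.pair (.reg 6) (.reg 5)) (s₁ d)
        have ha' := Com.spec_assign 4 (.snd (.reg 4)) (s₂ d)
        have e1 : (Exp.pair (.reg 6) (.reg 5)).eval (s₁ d) = enc (d :: acc) := by
          simp [Exp.eval, h6, h5, enc_cons, enc_nat]
        have e2 : (Exp.snd (.reg 4)).eval (s₂ d) = enc bs := by
          simp [Exp.eval, h4, enc_cons, Val.snd]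
        rw [e1] at ha
        rw [e2] at ha'
        have t1 := (h₃ (s₁ d) n fun i hi => by
          have := hacc d hdb
          rw [esize_cons] at this
          simp only [Exp.regs, List.mem_append, List.mem_singleton] at hi
          rcases hi with rfl | rfl
          · rw [h6]; change esize d ≤ n; omega
          · rw [h5]; change esize acc ≤ n; omega).1
        have t2 := (h₄ (s₂ d) n fun i hi => by
          simp only [Exp.regs, List.mem_singleton] at hi
          subst hi
          rw [h4]; change esize (b :: bs) ≤ n; omega).1
        have := (Com.Det.seq ha ha').mono (T' := p₃.eval n + p₄.eval n + 4) (by omega)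
        change Com.Spec _ (s₁ d) _ (PMF.pure (s₃ ((s₁ d 6).toNat)))
        rw [h6]
        exact this
      refine Com.Spec.mono (μ := (uniformNat b).map s₃) ?_ (show _ ≤ _ by
        exact (show 1 + (Exp.fst (.reg 4)).time s + (p₃.eval n + p₄.eval n + 4) + 1 ≤
          p₂.eval n + p₃.eval n + p₄.eval n + 7 by omega))
      have hmap : (((uniformNat b).map fun r => Function.update s 6 (Val.num r)).bind
          fun s' => PMF.pure (s₃ ((s' 6).toNat))) = (uniformNat b).map s₃ := by
        rw [PMF.bind_map]
        simp only [Function.comp_def, Function.update_self, Val.toNat]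
        rfl
      rwa [hmap] at hb
    refine ⟨fun ds => g (ds.headD 0) ds.tail, ?_, ?_⟩
    · have ht := (h₁ s n fun i hi => by
        simp only [Exp.regs, List.mem_singleton] at hi
        subst hi
        rw [hs4]; change esize (b :: bs) ≤ n; omega).1
      have := Com.Spec.loop (e := .isPair (.reg 4)) (T₂ := bs.length *
          (p₁ + p₂ + p₃ + p₄ + 10).eval n + (p₁ + p₂ + p₃ + p₄ + 10).eval n)
        (ν := fun s' => (drawList bs).map (g (s' 6).toNat))
        (show (Exp.isPair (.reg 4)).test s = true by
          simp [Exp.test, Exp.eval, hs4, enc_cons, Val.isPair, Val.ofBool]) hbody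
        fun s' hs' => by
          rw [PMF.support_map] at hs'
          obtain ⟨d, hd, rfl⟩ := hs'
          have h6 : (s₃ d 6) = Val.num d := by simp [s₃, s₂, s₁]
          have h7 : (s₃ d 6).toNat = d := by rw [h6]; rfl
          rw [h7]
          exact (hg d (mem_support_uniformNat hd)).1
      have hmap : ((uniformNat b).map s₃).bind (fun s' => (drawList bs).map (g (s' 6).toNat)) =
          (drawList (b :: bs)).map fun ds => g (ds.headD 0) ds.tail := by
        rw [drawList, PMF.bind_map, PMF.map_bind]
        congr 1
        funext d
        have h6 : (s₃ d 6) = Val.num d := by simp [s₃, s₂, s₁]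
        simp only [Function.comp, h6, Val.toNat, PMF.map_comp]
        rfl
      rw [hmap] at this
      refine this.mono ?_
      simp only [Polynomial.eval_add, Polynomial.eval_ofNat, List.length_cons, add_mul, one_mul]
      omega
    · intro ds hds
      rw [drawList, PMF.mem_support_bind_iff] at hds
      obtain ⟨d, hd, hds⟩ := hds
      rw [PMF.support_map] at hds
      obtain ⟨ds, hds, rfl⟩ := hds
      obtain ⟨h1, h2⟩ := (hg d (mem_support_uniformNat hd)).2 ds hds
      refine ⟨by simpa using h1, fun i hi => ?_⟩
      have h3 : i ≠ 4 := by omega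
      have h4 : i ≠ 5 := by omega
      have h5 : i ≠ 6 := by omega
      simpa [s₃, s₂, s₁, h3, h4, h5] using h2 i hi

/-! ### Programs that draw, compute and update a state. -/

section

variable {σ ρ ω : Type} [Enc σ] [Enc ρ] [Enc ω]

theorem enc_list_nat_injective : Function.Injective (enc : List ℕ → Val) := by
  intro l
  induction l with
  | nil => intro l' h; cases l' with
    | nil => rfl
    | cons a l' => simp [enc_nil, enc_cons] at h
  | cons a l ih => intro l' h; cases l' with
    | nil => simp [enc_nil, enc_cons] at h
    | cons b l' =>
      simp only [enc_cons, enc_nat, Val.pair.injEq, Val.num.injEq] at h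
      rw [h.1, ih h.2]

theorem esize_reverse (l : List σ) : esize l.reverse = esize l := by
  induction l with
  | nil => rfl
  | cons a l ih =>
    have := esize_append l.reverse [a]
    simp only [List.reverse_cons, esize_cons, esize_nil] at *
    omega

/-- With a state in register `2` and a request in register `0`, the program makes the draws given
by `bounds`, and then puts the new state into register `2` and the output into register `1`. -/
def Implements (c : Com) (bounds : σ × ρ → List ℕ) (G : (σ × ρ) × List ℕ → σ × ω) : Prop :=
  ∃ p : Polynomial ℕ, ∀ (s : Store) (a : σ × ρ), s 2 = enc a.1 → s 0 = enc a.2 →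
    ∃ g : List ℕ → Store, c.Spec s (p.eval (esize a)) ((drawList (bounds a)).map g) ∧
      ∀ ds ∈ (drawList (bounds a)).support,
        g ds 2 = enc (G (a, ds)).1 ∧ g ds 1 = enc (G (a, ds)).2

theorem exists_assign (i : ℕ) (e : Exp) : ∃ p : Polynomial ℕ, ∀ (s : Store) (n : ℕ),
    (∀ j ∈ e.regs, (s j).size ≤ n) →
      (Com.assign i e).Det s (Function.update s i (e.eval s)) (p.eval n) := by
  obtain ⟨p, hp⟩ := e.exists_bound
  refine ⟨1 + p, fun s n h => (Com.spec_assign i e s).mono ?_⟩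
  have := (hp s n h).1
  simpa using this

/-- The part of the program after the draws. -/
theorem exists_update {G : (σ × ρ) × List ℕ → σ × ω} (hG : PolyTime G) :
    ∃ (c : Com) (p : Polynomial ℕ), c.Deterministic ∧ ∀ (s : Store) (a : σ × ρ) (ds : List ℕ),
      s 3 = enc a → s 5 = enc ds → ∃ s', c.Det s s' (p.eval (esize (a, ds))) ∧
        s' 2 = enc (G (a, ds)).1 ∧ s' 1 = enc (G (a, ds)).2 := by
  obtain ⟨c, p, hc, hp⟩ := hG 3
  obtain ⟨p₁, h₁⟩ := exists_assign 3 (.pair (.reg 3) (.reg 5))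
  obtain ⟨p₂, h₂⟩ := exists_assign 2 (.fst (.reg 3))
  obtain ⟨p₃, h₃⟩ := exists_assign 1 (.snd (.reg 3))
  refine ⟨.seq (.assign 3 (.pair (.reg 3) (.reg 5))) (.seq c (.seq (.assign 2 (.fst (.reg 3)))
    (.assign 1 (.snd (.reg 3))))), p₁ + p + p₂.comp p + p₃.comp p + 3,
    ⟨trivial, hc, trivial, trivial⟩, fun s a ds hs3 hs5 => ?_⟩
  have hsz := esize_pair a ds
  have k₁ := h₁ s (esize (a, ds)) fun i hi => by
    simp only [Exp.regs, List.mem_append, List.mem_singleton] at hi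
    rcases hi with rfl | rfl
    · rw [hs3]; change esize a ≤ _; omega
    · rw [hs5]; change esize ds ≤ _; omega
  have e₁ : (Exp.pair (.reg 3) (.reg 5)).eval s = enc (a, ds) := by
    simp [Exp.eval, hs3, hs5, enc_pair]
  rw [e₁] at k₁
  obtain ⟨s₂, k₂, h2, h3, h4⟩ := hp (Function.update s 3 (enc (a, ds))) (a, ds) (by simp)
  have k₃ := h₂ s₂ (p.eval (esize (a, ds))) fun i hi => by
    simp only [Exp.regs, List.mem_singleton] at hi
    subst hi
    rw [h2]; exact h4
  have e₃ : (Exp.fst (.reg 3)).eval s₂ = enc (G (a, ds)).1 := by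
    change (s₂ 3).fst = _
    rw [h2]
    rfl
  rw [e₃] at k₃
  have k₄ := h₃ (Function.update s₂ 2 (enc (G (a, ds)).1)) (p.eval (esize (a, ds))) fun i hi => by
    simp only [Exp.regs, List.mem_singleton] at hi
    subst hi
    rw [Function.update_of_ne (by decide), h2]; exact h4
  have e₄ : (Exp.snd (.reg 3)).eval (Function.update s₂ 2 (enc (G (a, ds)).1)) =
      enc (G (a, ds)).2 := by
    change (Function.update s₂ 2 (enc (G (a, ds)).1) 3).snd = _
    rw [Function.update_of_ne (by decide), h2]
    rfl
  rw [e₄] at k₄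
  refine ⟨_, (k₁.seq (k₂.seq (k₃.seq k₄))).mono ?_, by simp, by simp⟩
  simp only [Polynomial.eval_add, Polynomial.eval_comp, Polynomial.eval_ofNat]
  omega

theorem exists_det_implements {G : (σ × ρ) × List ℕ → σ × ω} (hG : PolyTime G) :
    ∃ c : Com, c.Deterministic ∧ Implements c (fun _ => []) G := by
  obtain ⟨c, p, hc, hp⟩ := exists_update hG
  obtain ⟨p₁, h₁⟩ := exists_assign 3 (.pair (.reg 2) (.reg 0))
  obtain ⟨p₂, h₂⟩ := exists_assign 5 (.const 0)
  refine ⟨.seq (.assign 3 (.pair (.reg 2) (.reg 0))) (.seq (.assign 5 (.const 0)) c),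
    ⟨trivial, trivial, hc⟩, p₁ + p₂ + p.comp (Polynomial.X + 1 + 1) + 2, fun s a hs2 hs0 => ?_⟩
  have hsz := esize_pair a.1 a.2
  have k₁ := h₁ s (esize a) fun i hi => by
    simp only [Exp.regs, List.mem_append, List.mem_singleton] at hi
    rcases hi with rfl | rfl
    · rw [hs2]; change esize a.1 ≤ esize (a.1, a.2); omega
    · rw [hs0]; change esize a.2 ≤ esize (a.1, a.2); omega
  have e₁ : (Exp.pair (.reg 2) (.reg 0)).eval s = enc a := by
    simp [Exp.eval, hs2, hs0, ← enc_pair]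
  rw [e₁] at k₁
  have k₂ := h₂ (Function.update s 3 (enc a)) (esize a) (by simp [Exp.regs])
  obtain ⟨s', k₃, h2, h3⟩ := hp (Function.update (Function.update s 3 (enc a)) 5 (Val.num 0)) a []
    (by simp) (by simp [enc_nil])
  refine ⟨fun _ => s', ?_, fun ds hds => ?_⟩
  · rw [drawList, PMF.pure_map]
    refine (k₁.seq (k₂.seq k₃)).mono ?_
    simp only [Polynomial.eval_add, Polynomial.eval_comp, Polynomial.eval_ofNat,
      Polynomial.eval_X, Polynomial.eval_one, esize_pair, esize_nil]
    omega
  · obtain rfl : ds = [] := by simpa [drawList] using hds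
    exact ⟨h2, h3⟩

/-- The bounds are computed in register `4` above the saved argument in register `3`, the draws are
made, and a deterministic program does the rest after undoing the reversal of the draws. -/
theorem exists_implements {bounds : σ × ρ → List ℕ} {G : (σ × ρ) × List ℕ → σ × ω}
    (hb : PolyTime bounds) (hG : PolyTime G) : ∃ c : Com, Implements c bounds G := by
  obtain ⟨c, p, _, hp⟩ := exists_update (hG.comp (PolyTime.fst.pair (PolyTime.snd).reverse))
  obtain ⟨cB, q, _, hq⟩ := hb 4
  obtain ⟨r, hr⟩ := drawLoop_spec
  obtain ⟨p₁, h₁⟩ := exists_assign 3 (.pair (.reg 2) (.reg 0))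
  obtain ⟨p₂, h₂⟩ := exists_assign 4 (.reg 3)
  obtain ⟨p₃, h₃⟩ := exists_assign 5 (.const 0)
  refine ⟨.seq (.seq (.assign 3 (.pair (.reg 2) (.reg 0))) (.seq (.assign 4 (.reg 3))
    (.seq cB (.assign 5 (.const 0))))) (.seq drawLoop c),
    p₁ + p₂ + q + p₃ + (q * r.comp (q + 1) + r.comp (q + 1)) + p.comp (Polynomial.X + q + 1) + 10,
    fun s a hs2 hs0 => ?_⟩
  have hsz := esize_pair a.1 a.2
  have k₁ := h₁ s (esize a) fun i hi => by
    simp only [Exp.regs, List.mem_append, List.mem_singleton] at hi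
    rcases hi with rfl | rfl
    · rw [hs2]; change esize a.1 ≤ esize (a.1, a.2); omega
    · rw [hs0]; change esize a.2 ≤ esize (a.1, a.2); omega
  have e₁ : (Exp.pair (.reg 2) (.reg 0)).eval s = enc a := by
    simp [Exp.eval, hs2, hs0, ← enc_pair]
  rw [e₁] at k₁
  have k₂ := h₂ (Function.update s 3 (enc a)) (esize a) fun i hi => by
    simp only [Exp.regs, List.mem_singleton] at hi
    subst hi
    rw [Function.update_self]; exact le_rfl
  have e₂ : (Exp.reg 3).eval (Function.update s 3 (enc a)) = enc a := by simp [Exp.eval]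
  rw [e₂] at k₂
  obtain ⟨s₁, k₃, h4, hpres, hle⟩ := hq
    (Function.update (Function.update s 3 (enc a)) 4 (enc a)) a (by simp)
  have k₄ := h₃ s₁ (esize a) (by simp [Exp.regs])
  have hs3 : s₁ 3 = enc a := by rw [hpres 3 (by decide)]; simp
  obtain ⟨g, hg, hg'⟩ := hr (bounds a) [] (Function.update s₁ 5 (Val.num 0))
    (q.eval (esize a) + 1) (by simp [h4]) (by simp [enc_nil]) (by rw [esize_nil]; omega)
  -- `Spec.seq` needs the final store as a function of the store after the draws. This is possible
  -- because the draws can be read off from register `5`, the encoding of lists being injective.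
  have hfin : ∀ t, ∃ t', ∀ ds ∈ (drawList (bounds a)).support, g ds = t →
      c.Det t t' (p.eval (esize a + q.eval (esize a) + 1)) ∧
        t' 2 = enc (G (a, ds)).1 ∧ t' 1 = enc (G (a, ds)).2 := fun t => by
    by_cases ht : ∃ ds ∈ (drawList (bounds a)).support, g ds = t
    · obtain ⟨ds, hds, rfl⟩ := ht
      obtain ⟨h1, h2⟩ := hg' ds hds
      obtain ⟨t', h3, h4, h5⟩ := hp (g ds) a ds.reverse
        (by rw [h2 3 (by decide), Function.update_of_ne (by decide), hs3]) (by simpa using h1)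
      refine ⟨t', fun es hes he => ?_⟩
      obtain rfl : es = ds := by
        have h6 := (hg' es hes).1
        rw [he, h1] at h6
        simpa using (enc_list_nat_injective h6).symm
      refine ⟨h3.mono (polyEval_mono p ?_), by simpa using h4, by simpa using h5⟩
      have h6 := esize_le_of_forall₂ (mem_support_drawList hds)
      rw [esize_pair, esize_reverse]
      omega
    · exact ⟨t, fun ds hds h => absurd ⟨ds, hds, h⟩ ht⟩
  choose f hf using hfin
  refine ⟨fun ds => f (g ds), ?_, fun ds hds => (hf (g ds) ds hds rfl).2⟩
  have hloop := Com.Spec.seq (ν := fun t => PMF.pure (f t)) hg (b := c) fun t ht => by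
    rw [PMF.support_map] at ht
    obtain ⟨ds, hds, rfl⟩ := ht
    exact (hf (g ds) ds hds rfl).1
  rw [PMF.bind_map] at hloop
  have := Com.Spec.seq (ν := fun _ => (drawList (bounds a)).map fun ds => f (g ds))
    (k₁.seq (k₂.seq (k₃.seq k₄))) (b := .seq drawLoop c) fun s' hs' => by
      obtain rfl : s' = _ := by simpa using hs'
      exact hloop
  rw [PMF.pure_bind] at this
  refine this.mono ?_
  have hlen : (bounds a).length ≤ q.eval (esize a) := (length_lt_esize _).le.trans hle
  have := Nat.mul_le_mul_right (r.eval (q.eval (esize a) + 1)) hlen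
  simp only [Polynomial.eval_add, Polynomial.eval_mul, Polynomial.eval_comp,
    Polynomial.eval_ofNat, Polynomial.eval_X, Polynomial.eval_one]
  omega

end

/-! ## Representatives -/

/-- Earlier requests with the pages that represented them, the latest first. -/
abbrev History : Type := List (List ℕ × ℕ)

/-- The page that represents a set, given by the increasing list of its pages. -/
def pageOf (hist : History) (R : List ℕ) : ℕ :=
  hist.foldr (fun h acc => if h.1 ⊆ R then h.2 else acc) (R.headD 0)

def repOf (hist : History) (A : Finset ℕ) : ℕ := pageOf hist (A.sort (· ≤ ·))

/-- The history after a further request. -/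
def History.push (hist : History) (R : Finset ℕ) : History :=
  (R.sort (· ≤ ·), repOf hist R) :: hist

/-- The latest entry is tested first, just as the latest redirection overrides the earlier ones.
Thus the representatives, a function on all sets, are stored as a finite history. -/
theorem repOf_push (hist : History) (P : Finset ℕ) :
    repOf (hist.push P) = redirect (repOf hist) P := by
  funext A
  have h : P.sort (· ≤ ·) ⊆ A.sort (· ≤ ·) ↔ P ⊆ A := by
    simp [List.subset_def, Finset.subset_iff]
  simp only [repOf, History.push, redirect, pageOf, List.foldr_cons, h]

theorem PolyTime.pageOf {α : Type} [Enc α] {f : α → History} {R : α → List ℕ} (hf : PolyTime f)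
    (hR : PolyTime R) : PolyTime fun a => LaminarPaging.pageOf (f a) (R a) :=
  foldr_of_growth (step := fun z : α × (List ℕ × ℕ) × ℕ => if z.2.1.1 ⊆ R z.1 then z.2.1.2 else z.2.2)
    hf (headD hR)
    (ite_prop (subset snd.fst'.fst' (hR.comp fst)) snd.fst'.snd' snd.snd')
    ⟨Polynomial.X, fun a x acc => by
      rcases x with ⟨S, v⟩
      simp only [Polynomial.eval_X, esize_pair]
      split_ifs <;> omega⟩

/-- Page `x` is written as `x + 1`, since `0` denotes an empty slot. -/
theorem toCache_enc (k : ℕ) (l : List ℕ) :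
    Val.toCache k (enc (l.map fun x => x + 1)) = slotCache k l := by
  have h : ∀ l : List ℕ, (enc l).toList = l.map Val.num := by
    intro l
    induction l with
    | nil => rfl
    | cons a l ih => rw [enc_cons, Val.toList, ih]; rfl
  funext i
  rw [Val.toCache, h, slotCache, List.map_map, List.getElem?_map]
  cases l[i.val]? <;> rfl

/-! ## Online algorithms from algorithms for Paging -/

/-- An online algorithm for Paging with states in `γ`. A request is served by a step that uses
random numbers from `{0, …, b}` for the numbers `b` in the list `bounds`. -/
structure PagingAlgorithm (γ : Type) where
  init : γ
  bounds : ℕ → γ → ℕ → List ℕ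
  step : ℕ → γ → ℕ → List ℕ → γ
  slots : γ → List ℕ

namespace PagingAlgorithm

variable {γ : Type} [Enc γ]

/-- A polynomial-time algorithm with an invariant, which may depend on a bound for the sizes of
the pages and on the number of requests, and with a bound `cost` for the expected cost. -/
structure Analysis (A : PagingAlgorithm γ) (Inv : ℕ → ℕ → ℕ → γ → Prop) (pay : γ → ℕ → ℝ≥0∞)
    (cost : ℕ → List ℕ → γ → ℝ≥0∞) : Prop where
  polyTime_step : PolyTime fun z : ℕ × γ × ℕ × List ℕ => A.step z.1 z.2.1 z.2.2.1 z.2.2.2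
  polyTime_slots : PolyTime A.slots
  polyTime_init : PolyTime fun _ : ℕ => A.init
  slots_init : A.slots A.init = []
  inv_init : ∀ k B, Inv k B 0 A.init
  size_le : ∃ q : Polynomial ℕ, ∀ k B n g, Inv k B n g → esize g ≤ q.eval (k + B + n)
  inv_step : ∀ k B n g r ds, 0 < k → Inv k B n g → esize r ≤ B →
    List.Forall₂ (· ≤ ·) ds (A.bounds k g r) → Inv k B (n + 1) (A.step k g r ds) ∧
      r ∈ A.slots (A.step k g r ds) ∧ (A.slots (A.step k g r ds)).length ≤ k ∧
      (Cache.retrievals (slotCache k (A.slots g)) (slotCache k (A.slots (A.step k g r ds))) : ℝ≥0∞) ≤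
        pay g r
  cost_cons : ∀ k g r σ, cost k (r :: σ) g =
    pay g r + drawAvg (A.bounds k g r) fun ds => cost k σ (A.step k g r ds)

/-- The random configurations of the algorithm for the derived requests. -/
def run (A : PagingAlgorithm γ) (k : ℕ) : List (Finset ℕ) → History → γ → PMF (List (Cache k))
  | [], _, _ => PMF.pure []
  | R :: rest, hist, g => (drawList (A.bounds k g (repOf hist R))).bind fun ds =>
      (run A k rest (hist.push R) (A.step k g (repOf hist R) ds)).map fun C =>
        slotCache k (A.slots (A.step k g (repOf hist R) ds)) :: C

variable {A : PagingAlgorithm γ} {Inv : ℕ → ℕ → ℕ → γ → Prop} {pay : γ → ℕ → ℝ≥0∞}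
  {cost : ℕ → List ℕ → γ → ℝ≥0∞}

/-- A representative is not larger than its set. -/
theorem esize_rep_le {p : Finset ℕ → ℕ} {F : Finset (Finset ℕ)} (hp : Represents F p)
    {R : Finset ℕ} (hR : R ∈ F) {B : ℕ} (hB : esize (R.sort (· ≤ ·)) ≤ B) : esize (p R) ≤ B :=
  (esize_mem (by simpa using hp.mem R hR)).le.trans hB

theorem Analysis.satisfies (hA : A.Analysis Inv pay cost) {F : Finset (Finset ℕ)} (hF : Laminar F)
    {k B : ℕ} (hk : 0 < k) :
    ∀ (rs : List (Finset ℕ)) (hist : History) (g : γ) (n : ℕ),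
      (∀ R ∈ rs, R ∈ F ∧ esize (R.sort (· ≤ ·)) ≤ B) → Represents F (repOf hist) →
      Inv k B n g → ∀ C ∈ (A.run k rs hist g).support,
        List.Forall₂ (fun c R => Cache.Satisfies c R) C rs := by
  intro rs
  induction rs with
  | nil =>
    intro hist g n _ _ _ C hC
    obtain rfl : C = [] := by simpa [run] using hC
    exact List.Forall₂.nil
  | cons R rs ih =>
    intro hist g n hrs hrep hinv C hC
    obtain ⟨hR, hRB⟩ := hrs R (by simp)
    rw [run, PMF.mem_support_bind_iff] at hC
    obtain ⟨ds, hds, hC⟩ := hC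
    rw [PMF.support_map] at hC
    obtain ⟨C, hC, rfl⟩ := hC
    obtain ⟨h1, h2, h3, _⟩ := hA.inv_step k B n g (repOf hist R) ds hk hinv
      (esize_rep_le hrep hR hRB) (mem_support_drawList hds)
    refine List.Forall₂.cons ?_ (ih _ _ (n + 1) (fun R' hR' => hrs R' (by simp [hR'])) ?_ h1 C hC)
    · obtain ⟨i, hi, h4⟩ := List.mem_iff_getElem.1 h2
      exact ⟨repOf hist R, hrep.mem R hR, ⟨i, by omega⟩, by simp [slotCache, hi, h4]⟩
    · rw [repOf_push]; exact hrep.redirect hF hR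

/-- The step-by-step bounds `pay` add up to `cost` because the algorithm's recursion for `cost`
averages over the same draws as its runs. -/
theorem Analysis.expect_cost_le (hA : A.Analysis Inv pay cost) {F : Finset (Finset ℕ)}
    (hF : Laminar F) {k B : ℕ} (hk : 0 < k) :
    ∀ (rs : List (Finset ℕ)) (hist : History) (g : γ) (n : ℕ),
      (∀ R ∈ rs, R ∈ F ∧ esize (R.sort (· ≤ ·)) ≤ B) → Represents F (repOf hist) →
      Inv k B n g → expect (A.run k rs hist g) (fun C =>
        (Cache.costFrom (slotCache k (A.slots g)) C : ℝ≥0∞)) ≤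
        cost k (pageSeq (repOf hist) rs) g := by
  intro rs
  induction rs with
  | nil =>
    intro hist g n _ _ _
    simp [run, expect_pure, Cache.costFrom]
  | cons R rs ih =>
    intro hist g n hrs hrep hinv
    obtain ⟨hR, hRB⟩ := hrs R (by simp)
    rw [run, pageSeq, hA.cost_cons, expect_bind, ← expect_drawList, ← expect_const_add]
    refine expect_mono fun ds hds => ?_
    obtain ⟨h1, _, _, h4⟩ := hA.inv_step k B n g (repOf hist R) ds hk hinv
      (esize_rep_le hrep hR hRB) (mem_support_drawList hds)
    simp only [expect_map, Cache.costFrom, Nat.cast_add]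
    rw [expect_const_add, ← repOf_push]
    refine add_le_add h4 (ih _ _ (n + 1) (fun R' hR' => hrs R' (by simp [hR'])) ?_ h1)
    rw [repOf_push]; exact hrep.redirect hF hR

/-- The bounds for the draws, as a function of the state in the registers and the request. -/
def drawBounds (A : PagingAlgorithm γ) (a : (ℕ × History × γ) × List ℕ) : List ℕ :=
  A.bounds a.1.1 a.1.2.2 (pageOf a.1.2.1 a.2)

/-- The new state in the registers, and the output. -/
def update (A : PagingAlgorithm γ) (z : ((ℕ × History × γ) × List ℕ) × List ℕ) :
    (ℕ × History × γ) × List ℕ :=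
  ((z.1.1.1, (z.1.2, pageOf z.1.1.2.1 z.1.2) :: z.1.1.2.1,
    A.step z.1.1.1 z.1.1.2.2 (pageOf z.1.1.2.1 z.1.2) z.2),
    (A.slots (A.step z.1.1.1 z.1.1.2.2 (pageOf z.1.1.2.1 z.1.2) z.2)).map fun x => x + 1)

theorem Analysis.polyTime_update (hA : A.Analysis Inv pay cost) : PolyTime A.update := by
  have hv : PolyTime fun z : ((ℕ × History × γ) × List ℕ) × List ℕ => pageOf z.1.1.2.1 z.1.2 :=
    PolyTime.fst.fst'.snd'.fst'.pageOf PolyTime.fst.snd'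
  have hs : PolyTime fun z : ((ℕ × History × γ) × List ℕ) × List ℕ =>
      A.step z.1.1.1 z.1.1.2.2 (pageOf z.1.1.2.1 z.1.2) z.2 :=
    hA.polyTime_step.comp (PolyTime.fst.fst'.fst'.pair
      (PolyTime.fst.fst'.snd'.snd'.pair (hv.pair PolyTime.snd)))
  exact (PolyTime.fst.fst'.fst'.pair (((PolyTime.fst.snd'.pair hv).cons
    PolyTime.fst.fst'.snd'.fst').pair hs)).pair
    ((hA.polyTime_slots.comp hs).map (f := fun z => z.2 + 1)
      (PolyTime.snd.nat_add (PolyTime.const_nat 1)))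

theorem ofPages_eq (R : Finset ℕ) : Val.ofPages R = enc (R.sort (· ≤ ·)) := rfl

/-- The runs of the program are the runs of the algorithm. -/
theorem Analysis.exists_serveAll_eq (hA : A.Analysis Inv pay cost) {O : OnlineAlgorithm}
    (hO : Implements O.serve A.drawBounds A.update) : ∃ P : Polynomial ℕ,
    ∀ (F : Finset (Finset ℕ)) (k M N : ℕ), Laminar F → 0 < k → k ≤ M → P.eval M ≤ N →
      ∀ (rs : List (Finset ℕ)) (hist : History) (g : γ) (s : Store),
        (∀ R ∈ rs, R ∈ F ∧ esize (R.sort (· ≤ ·)) ≤ M) → Represents F (repOf hist) →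
        (∀ h ∈ hist, esize h ≤ 2 * M + 1) → Inv k M hist.length g → hist.length + rs.length ≤ M →
        s 2 = enc (k, hist, g) → O.serveAll k N rs s = (A.run k rs hist g).map some := by
  obtain ⟨p, hp⟩ := hO
  obtain ⟨q, hq⟩ := hA.size_le
  -- A bound for the state and the request when `k`, the sizes of pages and sets, and the number of
  -- requests are at most `M`: up to `M` history entries of size at most `2 * M + 1`, and the
  -- algorithm's state by `size_le`.
  let W : Polynomial ℕ := 2 * Polynomial.X * Polynomial.X + 4 * Polynomial.X +
    q.comp (Polynomial.X + Polynomial.X + Polynomial.X) + 10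
  refine ⟨p.comp W, fun F k M N hF hk hkM hN rs => ?_⟩
  induction rs with
  | nil =>
    intro hist g s _ _ _ _ _ _
    simp [OnlineAlgorithm.serveAll, run, PMF.pure_map]
  | cons R rs ih =>
    intro hist g s hrs hrep hh hinv hlen hs
    obtain ⟨hR, hRM⟩ := hrs R (by simp)
    obtain ⟨f, hspec, hf⟩ := hp (Function.update s 0 (Val.ofPages R))
      ((k, hist, g), R.sort (· ≤ ·)) (by simpa using hs) (by simp [ofPages_eq])
    have hpage : pageOf hist (R.sort (· ≤ ·)) = repOf hist R := rfl
    have hrun := hspec.run_eq (N := N) (by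
      refine le_trans (polyEval_mono p ?_) ((Polynomial.eval_comp (p := p)).symm.trans_le hN)
      have h1 := hq k M hist.length g hinv
      have h2 := esize_list_le hh
      have h3 : esize k ≤ k + 1 := by
        rw [esize_nat]
        have : Nat.size k ≤ k := Nat.size_le.2 Nat.lt_two_pow_self
        omega
      rw [List.length_cons] at hlen
      have h4 := polyEval_mono q (show k + M + hist.length ≤ M + M + M by omega)
      have h5 := Nat.mul_le_mul_right (2 * M + 1 + 1) (show hist.length ≤ M by omega)
      have h6 : M * (2 * M + 1 + 1) = 2 * M * M + 2 * M := by ring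
      simp only [W, esize_pair, Polynomial.eval_add, Polynomial.eval_mul, Polynomial.eval_comp,
        Polynomial.eval_ofNat, Polynomial.eval_X]
      omega)
    rw [OnlineAlgorithm.serveAll, hrun, run, PMF.map_comp, PMF.bind_map, PMF.map_bind]
    refine bind_congr_support fun ds hds => ?_
    obtain ⟨h1, h2⟩ := hf ds hds
    have hv := esize_rep_le hrep hR hRM
    obtain ⟨h3, -⟩ := hA.inv_step k M hist.length g (repOf hist R) ds hk hinv hv
      (mem_support_drawList hds)
    have := ih (hist.push R) (A.step k g (repOf hist R) ds) (f ds)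
      (fun R' hR' => hrs R' (by simp [hR'])) (by rw [repOf_push]; exact hrep.redirect hF hR)
      (fun h hmem => by
        rcases List.mem_cons.1 hmem with rfl | hmem
        · rw [esize_pair]; omega
        · exact hh h hmem)
      h3 (by rw [History.push, List.length_cons]; rw [List.length_cons] at hlen; omega) h1
    simp only [Function.comp]
    rw [this, h2, PMF.map_comp, PMF.map_comp]
    congr 1
    funext C
    simp only [Function.comp, Option.map_some, update, toCache_enc, hpage]

theorem exists_prepare {α β : Type} [Enc α] [Enc β] {f : α → β} (hf : PolyTime f) :
    ∃ (c : Com) (p : Polynomial ℕ), c.Deterministic ∧ ∀ (s : Store) (a : α), s 0 = enc a →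
      ∃ s', c.Det s s' (p.eval (esize a)) ∧ s' 2 = enc (f a) := by
  obtain ⟨c, p, hc, hp⟩ := hf 2
  obtain ⟨q, hq⟩ := exists_assign 2 (.reg 0)
  refine ⟨.seq (.assign 2 (.reg 0)) c, q + p + 1, ⟨trivial, hc⟩, fun s a hs => ?_⟩
  have h1 := hq s (esize a) fun i hi => by
    simp only [Exp.regs, List.mem_singleton] at hi
    subst hi
    rw [hs]; exact le_rfl
  obtain ⟨s', h2, h3, -⟩ := hp (Function.update s 2 ((Exp.reg 0).eval s)) a
    (by simpa [Exp.eval] using hs)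
  refine ⟨s', (h1.seq h2).mono ?_, h3⟩
  simp only [Polynomial.eval_add, Polynomial.eval_one]
  exact le_rfl

theorem encodeStatic_eq (I : PagingInput) : I.encodeStatic =
    enc (List.range I.k, I.family.map fun R => R.sort (· ≤ ·)) := by
  rw [enc_pair]
  simp only [PagingInput.encodeStatic, Val.ofFamily, Enc.enc, List.map_map]
  rfl

theorem encode_eq (I : PagingInput) : I.encode =
    enc ((List.range I.k, I.family.map fun R => R.sort (· ≤ ·)),
      I.requests.map fun R => R.sort (· ≤ ·)) := by
  rw [enc_pair, ← encodeStatic_eq]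
  simp only [PagingInput.encode, Val.ofFamily, Enc.enc, List.map_map]
  rfl

theorem size_eq (I : PagingInput) : I.size =
    esize (List.range I.k, I.family.map fun R => R.sort (· ≤ ·)) +
      esize (I.requests.map fun R => R.sort (· ≤ ·)) + 1 := by
  rw [← esize_pair, esize, ← encode_eq]
  rfl

/-- The factor `height` comes from passing to the derived paging instance, the factor `ρ` from the
paging algorithm on it. -/
theorem exists_online (hA : A.Analysis Inv pay cost) {serve : Com}
    (hs : Implements serve A.drawBounds A.update) {ρ : ℕ → ℝ≥0}
    (hρ : ∀ k σ c, 0 < k → Serves k ∅ σ c → cost k σ A.init ≤ ρ k * c) :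
    ∃ prepare : Com, prepare.Deterministic ∧
      (OnlineAlgorithm.mk prepare serve).IsCompetitive fun I => height I.family * ρ I.k := by
  obtain ⟨prep, p, hdet, hp⟩ := exists_prepare (α := List ℕ × List (List ℕ))
    (f := fun x => (x.1.length, ([] : History), A.init))
    ((PolyTime.fst.length).pair (PolyTime.const_nil.pair
      (hA.polyTime_init.comp (PolyTime.const_nat 0))))
  refine ⟨prep, hdet, ?_⟩
  obtain ⟨P, hP⟩ := hA.exists_serveAll_eq (O := ⟨prep, serve⟩) hs
  -- One polynomial covers the preparation and every request. No additive constant is needed, since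
  -- all algorithms start with the empty cache.
  refine ⟨p + P, 0, fun I hI => ?_⟩
  have hF := I.laminar hI
  have hsz := size_eq I
  -- The slots are listed explicitly, so `k` counts in unary.
  have hk : I.k ≤ I.size := by
    have h1 := length_lt_esize (List.range I.k)
    rw [List.length_range] at h1
    rw [esize_pair] at hsz
    omega
  have hrs : ∀ R ∈ I.requests, R ∈ I.family.toFinset ∧ esize (R.sort (· ≤ ·)) ≤ I.size := by
    intro R hR
    refine ⟨by simpa using I.requests_mem R hR, ?_⟩
    have := esize_mem (List.mem_map_of_mem (f := fun R : Finset ℕ => R.sort (· ≤ ·)) hR)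
    omega
  have hlen : I.requests.length ≤ I.size := by
    have := length_lt_esize (I.requests.map fun R => R.sort (· ≤ ·))
    rw [List.length_map] at this
    omega
  have hrep : Represents I.family.toFinset (repOf []) := represents_minPage hF
  obtain ⟨s, h1, h2⟩ := hp (Store.init I.encodeStatic)
    (List.range I.k, I.family.map fun R => R.sort (· ≤ ·)) (by simp [Store.init, encodeStatic_eq])
  have hN : (p + P).eval I.size = p.eval I.size + P.eval I.size := Polynomial.eval_add
  have hprep := h1.run_eq (N := (p + P).eval I.size) (by
    have := polyEval_mono p (show esize (List.range I.k, I.family.map fun R => R.sort (· ≤ ·)) ≤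
      I.size by omega)
    omega)
  have hrun : (OnlineAlgorithm.mk prep serve).run I ((p + P).eval I.size) =
      (A.run I.k I.requests [] A.init).map some := by
    rw [OnlineAlgorithm.run, hprep, PMF.pure_map, PMF.pure_bind]
    refine hP I.family.toFinset I.k I.size _ hF I.k_pos hk (by omega) I.requests [] A.init s hrs
      hrep (by simp) (hA.inv_init _ _) (by simpa using hlen) ?_
    simpa using h2
  rw [hrun]
  constructor
  · intro o ho
    rw [PMF.support_map] at ho
    obtain ⟨C, hC, rfl⟩ := ho
    exact ⟨C, rfl, hA.satisfies hF I.k_pos I.requests [] A.init 0 hrs hrep (hA.inv_init _ _) C hC⟩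
  · obtain ⟨c, hc, hle⟩ := I.exists_serves hI
    have h3 := hA.expect_cost_le hF I.k_pos I.requests [] A.init 0 hrs hrep (hA.inv_init _ _)
    rw [hA.slots_init] at h3
    change expect ((A.run I.k I.requests [] A.init).map some) _ ≤ _
    rw [expect_map]
    refine h3.trans ((hρ I.k _ c I.k_pos hc).trans ?_)
    have h4 : (c : ℝ≥0) ≤ height I.family * I.opt := by exact_mod_cast hle
    have h5 : ρ I.k * c ≤ height I.family * ρ I.k * I.opt + 0 := by
      calc ρ I.k * c ≤ ρ I.k * (height I.family * I.opt) := mul_le_mul_right h4 _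
        _ = _ := by ring
    exact_mod_cast h5

end PagingAlgorithm

/-! ## The deterministic online algorithm -/

def flushAlgorithm : PagingAlgorithm (List ℕ) where
  init := []
  bounds _ _ _ := []
  step k W v _ := flushStep k W v
  slots W := W

theorem PolyTime.flushStep {α : Type} [Enc α] {k v : α → ℕ} {W : α → List ℕ} (hk : PolyTime k)
    (hW : PolyTime W) (hv : PolyTime v) :
    PolyTime fun a => LaminarPaging.flushStep (k a) (W a) (v a) :=
  ite_prop (mem hv hW) hW (ite_prop (nat_lt (length hW) hk) (append hW (singleton hv))
    (singleton hv))

theorem flushAlgorithm_analysis : flushAlgorithm.Analysis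
    (fun k B _ W => W.length ≤ k ∧ ∀ x ∈ W, esize x ≤ B) (fun W v => if v ∈ W then 0 else 1)
    (fun k σ W => flushCost k W σ) where
  polyTime_step := PolyTime.fst.flushStep PolyTime.snd.fst' PolyTime.snd.snd'.fst'
  polyTime_slots := PolyTime.id
  polyTime_init := PolyTime.const_nil
  slots_init := rfl
  inv_init k B := ⟨Nat.zero_le _, by simp [flushAlgorithm]⟩
  size_le := ⟨Polynomial.X * (Polynomial.X + 1) + 1, fun k B n W ⟨h1, h2⟩ => by
    refine (esize_list_le h2).trans ?_
    simp only [Polynomial.eval_add, Polynomial.eval_mul, Polynomial.eval_X, Polynomial.eval_one]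
    exact Nat.add_le_add_right (Nat.mul_le_mul (by omega) (by omega)) _⟩
  inv_step k B n W r ds hk hW hr _ := by
    obtain ⟨h1, h2⟩ := hW
    simp only [flushAlgorithm, flushStep]
    split_ifs with h h'
    · exact ⟨⟨h1, h2⟩, h, h1, by simp [retrievals_self]⟩
    · have h3 : (W ++ [r]).length ≤ k := by simp; omega
      refine ⟨⟨h3, fun x hx => ?_⟩, by simp, h3, by exact_mod_cast retrievals_append k W r⟩
      rcases List.mem_append.1 hx with hx | hx
      · exact h2 x hx
      · rwa [List.mem_singleton.1 hx]
    · exact ⟨⟨hk, by simpa using hr⟩, by simp, hk, by exact_mod_cast retrievals_singleton k _ r⟩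
  cost_cons k W r σ := by
    simp [flushCost, drawAvg, flushAlgorithm]

theorem exists_deterministic_online : ∃ O : OnlineAlgorithm, O.Deterministic ∧
    O.IsCompetitive fun I => (height I.family : ℝ≥0) * (I.k : ℝ≥0) := by
  obtain ⟨serve, hdet, hs⟩ := exists_det_implements flushAlgorithm_analysis.polyTime_update
  obtain ⟨prep, hdet', h⟩ := PagingAlgorithm.exists_online flushAlgorithm_analysis hs
    (ρ := fun k => k) fun k σ c hk hσ => by exact_mod_cast flushCost_le hk hσ
  exact ⟨⟨prep, serve⟩, ⟨hdet', hdet⟩, h⟩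

/-! ## The randomized online algorithm -/

def partitionAlgorithm : PagingAlgorithm (Stages × List ℕ) where
  init := (([], [], []), [])
  bounds k g r := g.1.bounds k r
  step k g r ds := (g.1.step k r ds, g.1.nextSlots k g.2 r ds)
  slots g := g.2

section

variable {α : Type} [Enc α] {k r : α → ℕ} {st : α → Stages} {ds slots : α → List ℕ}

theorem PolyTime.stages_del (hst : PolyTime st) (hr : PolyTime r) :
    PolyTime fun a => (st a).1.map fun S => LaminarPaging.del S (r a) :=
  map hst.fst' (f := fun z : α × List ℕ => LaminarPaging.del z.2 (r z.1)) (del snd (hr.comp fst))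

theorem PolyTime.stages_rerouted (hst : PolyTime st) (hr : PolyTime r) (hds : PolyTime ds) :
    PolyTime fun a => (st a).rerouted (r a) (ds a) :=
  reroute hr (stages_del hst hr) hst.snd'.fst' hds

theorem PolyTime.stages_victim (hst : PolyTime st) (hds : PolyTime ds) :
    PolyTime fun a => (st a).victim (ds a) :=
  getD (append (finalPool hst.fst' hst.snd'.fst') hst.snd'.snd') (headD hds)

theorem PolyTime.stages_notFull (hk : PolyTime k) (hst : PolyTime st) :
    PolyTime fun a => decide ((st a).1 = [] ∧ (st a).2.2.length < k a) := by
  have := and (isEmpty hst.fst') (nat_lt (length hst.snd'.snd') hk)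
  convert this using 2 with a
  rw [Bool.decide_and]
  congr 1
  cases (st a).1 <;> simp

theorem PolyTime.stages_bounds (hk : PolyTime k) (hst : PolyTime st) (hr : PolyTime r) :
    PolyTime fun a => (st a).bounds (k a) (r a) :=
  ite_prop (mem hr hst.snd'.snd') const_nil (ite_prop (mem_flatten hr hst.fst')
    (stageBounds (stages_del hst hr)) (ite_prop (stages_notFull hk hst) const_nil
      (singleton (nat_sub hk (const_nat 1)))))

theorem PolyTime.stages_step (hk : PolyTime k) (hst : PolyTime st) (hr : PolyTime r)
    (hds : PolyTime ds) : PolyTime fun a => (st a).step (k a) (r a) (ds a) := by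
  have htop := hst.snd'.snd'
  have h1 := trim (stages_del hst hr) (stages_rerouted hst hr hds).fst'
  have h2 := trim (append hst.fst' (singleton htop))
    (append hst.snd'.fst' (singleton (stages_victim hst hds)))
  exact ite_prop (mem hr htop) hst (ite_prop (mem_flatten hr hst.fst')
    (h1.fst'.pair (h1.snd'.pair (append htop (singleton hr))))
    (ite_prop (stages_notFull hk hst)
      (hst.fst'.pair (hst.snd'.fst'.pair (append htop (singleton hr))))
      (h2.fst'.pair (h2.snd'.pair (singleton hr)))))

theorem PolyTime.stages_nextSlots (hk : PolyTime k) (hst : PolyTime st) (hsl : PolyTime slots)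
    (hr : PolyTime r) (hds : PolyTime ds) :
    PolyTime fun a => (st a).nextSlots (k a) (slots a) (r a) (ds a) :=
  ite_prop (mem hr hst.snd'.snd') hsl (ite_prop (mem_flatten hr hst.fst')
    (replacePage hsl (stages_rerouted hst hr hds).snd' hr)
    (ite_prop (stages_notFull hk hst) (append hsl (singleton hr))
      (replacePage hsl (stages_victim hst hds) hr)))

end

/-! ### The size of the state of the partition algorithm. -/

theorem trim_sublist (Ss : List (List ℕ)) (n : ℕ) (aS : List (List ℕ)) (aV vs : List ℕ) :
    (trim n aS aV Ss vs).1.Sublist (aS ++ Ss) := by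
  induction Ss generalizing n aS aV vs with
  | nil => simp [trim]
  | cons S Ss ih =>
    rw [trim]
    split_ifs
    · exact ((ih 0 [] [] _).trans (List.sublist_cons_self S Ss)).trans
        (List.sublist_append_right _ _)
    · simpa using ih (n + S.length - 1) (aS ++ [S]) _ _

theorem Sampled.mem {Ss : List (List ℕ)} {N vs : List ℕ} (h : Sampled N Ss vs) {v : ℕ}
    (hv : v ∈ vs) : v ∈ N ++ Ss.flatten := by
  induction Ss generalizing N vs with
  | nil =>
    obtain rfl := List.length_eq_zero_iff.1 h.length_eq
    simp at hv
  | cons S Ss ih => cases vs with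
    | nil => exact h.elim
    | cons w vs =>
      rw [List.flatten_cons, ← List.append_assoc]
      rcases List.mem_cons.1 hv with rfl | hv
      · exact List.mem_append_left _ h.1
      · rcases List.mem_append.1 (ih h.2 hv) with h1 | h1
        · exact List.mem_append_left _ (mem_del.1 h1).1
        · exact List.mem_append_right _ h1

namespace Stages

/-- A request adds at most itself to the pages of the history and at most one stage; together with
`Valid.nodup` this keeps the state polynomial in the number of requests. -/
theorem step_subset (k : ℕ) (st : Stages) (r : ℕ) (ds : List ℕ) :
    (st.step k r ds).1.flatten ++ (st.step k r ds).2.2 ⊆ r :: (st.1.flatten ++ st.2.2) ∧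
      (st.step k r ds).1.length ≤ st.1.length + 1 := by
  have hsub : ∀ {A B : List (List ℕ)}, A.Sublist B → A.flatten ⊆ B.flatten := fun h x hx => by
    obtain ⟨S, hS, hx⟩ := List.mem_flatten.1 hx
    exact List.mem_flatten.2 ⟨S, h.subset hS, hx⟩
  unfold step
  split_ifs with h1 h2 h3
  · exact ⟨List.subset_cons_self _ _, by omega⟩
  · have h := trim_sublist (st.1.map fun S => del S r) 0 [] [] (st.rerouted r ds).1
    refine ⟨fun x hx => ?_, ?_⟩
    · rcases List.mem_append.1 hx with hx | hx
      · have := hsub h hx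
        rw [List.nil_append, flatten_map_del, mem_del] at this
        exact List.mem_cons_of_mem _ (List.mem_append_left _ this.1)
      · simp only [addPage, List.mem_append, List.mem_cons] at hx ⊢
        tauto
    · have := h.length_le
      simp only [List.nil_append, List.length_map] at this
      exact this.trans (Nat.le_succ _)
  · refine ⟨fun x hx => ?_, by simp⟩
    simp only [List.mem_append, List.mem_cons] at hx ⊢
    tauto
  · have h := trim_sublist (st.1 ++ [st.2.2]) 0 [] [] (st.2.1 ++ [st.victim ds])
    refine ⟨fun x hx => ?_, ?_⟩
    · rcases List.mem_append.1 hx with hx | hx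
      · have := hsub h hx
        rw [List.nil_append, List.flatten_append, List.flatten_singleton] at this
        exact List.mem_cons_of_mem _ this
      · simp only [addPage, List.mem_singleton] at hx
        simp [hx]
    · have := h.length_le
      rw [List.nil_append, List.length_append, List.length_singleton] at this
      exact this

end Stages

theorem length_le_of_nodup_subset {l l' : List ℕ} (h : l.Nodup) (hs : l ⊆ l') :
    l.length ≤ l'.length := (List.subperm_of_subset h hs).length_le

theorem length_le_flatten {Ss : List (List ℕ)} {S : List ℕ} (h : S ∈ Ss) :
    S.length ≤ Ss.flatten.length := (List.sublist_flatten_of_mem h).length_le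

/-- The invariant of the partition algorithm. -/
structure PartitionInv (k B n : ℕ) (g : Stages × List ℕ) : Prop where
  consistent : g.1.Consistent k g.2
  esize_le : ∀ x ∈ g.1.1.flatten ++ g.1.2.2, esize x ≤ B
  length_le : g.1.1.length ≤ n
  pages_le : (g.1.1.flatten ++ g.1.2.2).length ≤ n

theorem PartitionInv.size_le {k B n : ℕ} {g : Stages × List ℕ} (h : PartitionInv k B n g) :
    esize g ≤ (2 * (k + B + n)) * ((2 * (k + B + n)) * (2 * (k + B + n)) + 7 * (2 * (k + B + n)) + 10)
      + 10 := by
  obtain ⟨⟨Ss, vs, top⟩, slots⟩ := g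
  obtain ⟨⟨hV, hvs, hs, hp⟩, h1, h2, h3⟩ := h
  simp only at hV hvs hp h1 h2 h3
  have hn : ([] ++ Ss.flatten).Nodup := by simpa using hV.nodup.of_append_left
  have k1 : ∀ S ∈ Ss, esize S ≤ n * (B + 1) + 1 := fun S hS => by
    refine (esize_list_le (B := B) fun x hx => h1 x ?_).trans ?_
    · exact List.mem_append_left _ (List.mem_flatten.2 ⟨S, hS, hx⟩)
    · have := length_le_flatten hS
      rw [List.length_append] at h3
      exact Nat.add_le_add_right (Nat.mul_le_mul_right _ (by omega)) _
  have k2 := esize_list_le k1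
  have k3 := esize_list_le (l := vs) (B := B) fun x hx => h1 x
    (List.mem_append_left _ (by simpa using hvs.mem hx))
  have k4 := esize_list_le (l := top) (B := B) fun x hx => h1 x (List.mem_append_right _ hx)
  have k5 := esize_list_le (l := slots) (B := B) fun x hx => h1 x (by
    rcases List.mem_append.1 (hp.mem_iff.1 hx) with h | h
    · exact List.mem_append_left _ (by simpa using Stages.mem_finalPool h)
    · exact List.mem_append_right _ h)
  have k6 : slots.length ≤ k := by
    rw [hp.length_eq, List.length_append, length_finalPool hn hvs]
    exact hV.le
  rw [hvs.length_eq] at k3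
  rw [List.length_append] at h3
  set Y := k + B + n
  have m1 : n * (B + 1) ≤ Y * (Y + 1) := Nat.mul_le_mul (by omega) (by omega)
  have m2 : Ss.length * (n * (B + 1) + 1 + 1) ≤ Y * (Y * (Y + 1) + 2) :=
    Nat.mul_le_mul (by omega) (by omega)
  have m3 : Ss.length * (B + 1) ≤ Y * (Y + 1) := Nat.mul_le_mul (by omega) (by omega)
  have m4 : top.length * (B + 1) ≤ Y * (Y + 1) := Nat.mul_le_mul (by omega) (by omega)
  have m5 : slots.length * (B + 1) ≤ Y * (Y + 1) := Nat.mul_le_mul (by omega) (by omega)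
  simp only [esize_pair]
  nlinarith

theorem partitionAlgorithm_analysis : partitionAlgorithm.Analysis PartitionInv
    (fun g r => g.1.pay r) (fun k σ g => Stages.expCost k σ g.1) where
  polyTime_step := by
    have hk : PolyTime fun z : ℕ × (Stages × List ℕ) × ℕ × List ℕ => z.1 := PolyTime.fst
    have hst : PolyTime fun z : ℕ × (Stages × List ℕ) × ℕ × List ℕ => z.2.1.1 :=
      PolyTime.snd.fst'.fst'
    have hsl : PolyTime fun z : ℕ × (Stages × List ℕ) × ℕ × List ℕ => z.2.1.2 :=
      PolyTime.snd.fst'.snd'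
    have hr : PolyTime fun z : ℕ × (Stages × List ℕ) × ℕ × List ℕ => z.2.2.1 :=
      PolyTime.snd.snd'.fst'
    have hds : PolyTime fun z : ℕ × (Stages × List ℕ) × ℕ × List ℕ => z.2.2.2 :=
      PolyTime.snd.snd'.snd'
    exact (PolyTime.stages_step hk hst hr hds).pair (PolyTime.stages_nextSlots hk hst hsl hr hds)
  polyTime_slots := PolyTime.snd
  polyTime_init := (PolyTime.const_nil.pair (PolyTime.const_nil.pair PolyTime.const_nil)).pair
    PolyTime.const_nil
  slots_init := rfl
  inv_init k B := by
    refine ⟨⟨⟨by simp [partitionAlgorithm], trivial, fun h => absurd rfl h, ?_⟩, trivial, ?_, ?_⟩,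
      ?_, ?_, ?_⟩ <;> simp [partitionAlgorithm, poolSize, finalPool]
  size_le := ⟨(2 * Polynomial.X) * ((2 * Polynomial.X) * (2 * Polynomial.X) +
    7 * (2 * Polynomial.X) + 10) + 10, fun k B n g h => by
      simpa using h.size_le⟩
  inv_step k B n g r ds hk h hr hds := by
    obtain ⟨h1, h2, h3, h4⟩ := h
    obtain ⟨k1, k2, k3⟩ := h1.step hk hds
    obtain ⟨k4, k5⟩ := g.1.step_subset k r ds
    refine ⟨⟨k1, fun x hx => ?_, k5.trans (Nat.add_le_add_right h3 1), ?_⟩, k2, ?_, k3⟩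
    · rcases List.mem_cons.1 (k4 hx) with rfl | h
      · exact hr
      · exact h2 x h
    · exact (length_le_of_nodup_subset k1.valid.nodup k4).trans (Nat.add_le_add_right h4 1)
    · have h5 := k1.valid.le
      have h6 := length_finalPool (N := []) (by simpa using k1.valid.nodup.of_append_left)
        k1.sampled
      have h7 := k1.perm.length_eq
      rw [List.length_append, h6] at h7
      exact h7.trans_le h5
  cost_cons _ _ _ _ := rfl

theorem exists_randomized_online : ∃ O : OnlineAlgorithm, O.IsCompetitive fun I =>
    (height I.family : ℝ≥0) * ∑ i ∈ Finset.Icc 1 I.k, (1 : ℝ≥0) / (i : ℝ≥0) := by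
  have hb : PolyTime partitionAlgorithm.drawBounds :=
    PolyTime.stages_bounds PolyTime.fst.fst' PolyTime.fst.snd'.snd'.fst'
      (PolyTime.fst.snd'.fst'.pageOf PolyTime.snd)
  obtain ⟨serve, hs⟩ := exists_implements hb partitionAlgorithm_analysis.polyTime_update
  obtain ⟨prep, -, h⟩ := PagingAlgorithm.exists_online partitionAlgorithm_analysis hs
    (ρ := fun k => ∑ i ∈ Finset.Icc 1 k, (1 : ℝ≥0) / (i : ℝ≥0)) fun k σ c hk hσ => by
      refine (Stages.expCost_le hk hσ).trans_eq ?_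
      push_cast
      congr 1
      refine Finset.sum_congr rfl fun i hi => ?_
      have : (i : ℝ≥0) ≠ 0 := by
        have := (Finset.mem_Icc.1 hi).1
        exact_mod_cast (by omega : i ≠ 0)
      rw [ENNReal.coe_div this]
      simp
  exact ⟨⟨prep, serve⟩, h⟩

/-! ## The offline algorithm -/

theorem PolyTime.farthest {α : Type} [Enc α] {slots rest : α → List ℕ} (hs : PolyTime slots)
    (hr : PolyTime rest) : PolyTime fun a => LaminarPaging.farthest (slots a) (rest a) :=
  foldl_of_growth (step := fun z : α × ℕ × ℕ =>
      if (rest z.1).idxOf z.2.2 < (rest z.1).idxOf z.2.1 then z.2.1 else z.2.2) hs (headD hs)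
    (ite_prop (nat_lt (idxOf snd.snd' (hr.comp fst)) (idxOf snd.fst' (hr.comp fst))) snd.fst'
      snd.snd')
    ⟨Polynomial.X, fun a x acc => by
      simp only [Polynomial.eval_X]
      split_ifs <;> omega⟩

theorem PolyTime.beladyStep {α : Type} [Enc α] {k v : α → ℕ} {slots rest : α → List ℕ}
    (hk : PolyTime k) (hs : PolyTime slots) (hv : PolyTime v) (hr : PolyTime rest) :
    PolyTime fun a => LaminarPaging.beladyStep (k a) (slots a) (v a) (rest a) :=
  ite_prop (mem hv hs) hs (ite_prop (nat_lt (length hs) hk) (append hs (singleton hv))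
    (replacePage hs (farthest hs hr) hv))

/-- The pages in the slots after each request. -/
def beladyRun (k : ℕ) : List ℕ → List ℕ → List (List ℕ)
  | _, [] => []
  | slots, v :: σ => beladyStep k slots v σ :: beladyRun k (beladyStep k slots v σ) σ

theorem beladyStep_subset (k : ℕ) (slots : List ℕ) (v : ℕ) (rest : List ℕ) :
    beladyStep k slots v rest ⊆ v :: slots ∧
      (beladyStep k slots v rest).length ≤ slots.length + 1 := by
  unfold beladyStep
  split_ifs
  · exact ⟨List.subset_cons_self _ _, by omega⟩
  · refine ⟨fun x hx => ?_, by simp⟩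
    simp only [List.mem_append, List.mem_cons] at hx ⊢
    tauto
  · refine ⟨fun x hx => ?_, by rw [length_replacePage]; omega⟩
    rw [mem_replacePage] at hx
    rw [List.mem_cons]
    tauto

theorem esize_map_succ_le {l : List ℕ} {B n : ℕ} (h : ∀ x ∈ l, esize x ≤ B) (hl : l.length ≤ n) :
    esize (l.map fun x => x + 1) ≤ n * (B + 3) + 1 := by
  refine (esize_list_le (B := B + 2) fun y hy => ?_).trans ?_
  · obtain ⟨x, hx, rfl⟩ := List.mem_map.1 hy
    have h1 := h x hx
    have h2 := natSize_add_le x 1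
    rw [Nat.size_one] at h2
    rw [esize_nat] at h1 ⊢
    omega
  · rw [List.length_map]
    exact Nat.add_le_add_right (Nat.mul_le_mul_right _ hl) _

/-- The accumulator carries the remaining requests, because an eviction needs the whole future;
cached pages are always copies of requested ones, so their sizes stay bounded. -/
theorem PolyTime.beladyRun {α : Type} [Enc α] {k : α → ℕ} {σ : α → List ℕ} (hk : PolyTime k)
    (hσ : PolyTime σ) :
    PolyTime fun a => (LaminarPaging.beladyRun (k a) [] (σ a)).map fun l => l.map fun x => x + 1 := by
  obtain ⟨p, hp⟩ := hσ.size_le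
  have hst : PolyTime fun z : α × ℕ × List ℕ × List ℕ × List (List ℕ) =>
      LaminarPaging.beladyStep (k z.1) z.2.2.2.1 z.2.1 z.2.2.1.tail :=
    beladyStep (hk.comp fst) snd.snd'.snd'.fst' snd.fst' snd.snd'.fst'.tail
  have := foldl_of_inv (β := List ℕ × List ℕ × List (List ℕ)) (init := fun a => (σ a, [], []))
    (step := fun z : α × ℕ × List ℕ × List ℕ × List (List ℕ) => (z.2.2.1.tail,
      LaminarPaging.beladyStep (k z.1) z.2.2.2.1 z.2.1 z.2.2.1.tail,
      z.2.2.2.2 ++ [(LaminarPaging.beladyStep (k z.1) z.2.2.2.1 z.2.1 z.2.2.1.tail).map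
        fun x => x + 1])) hσ
    (hσ.pair (const_nil.pair const_nil))
    (snd.snd'.fst'.tail.pair (hst.pair (append snd.snd'.snd'.snd'
      (singleton (map hst (f := fun z => z.2 + 1) (nat_add snd (const_nat 1)))))))
    (fun a n acc => esize acc.1 ≤ p.eval (esize a) ∧ (acc.2.1.length ≤ n ∧
      ∀ x ∈ acc.2.1, esize x ≤ p.eval (esize a)) ∧ acc.2.2.length = n ∧
      ∀ l ∈ acc.2.2, esize l ≤ n * (p.eval (esize a) + 3) + 1)
    (fun a => ⟨hp a, ⟨le_rfl, by simp⟩, rfl, by simp⟩)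
    (fun a v hv n ⟨rest, slots, out⟩ ⟨h1, ⟨h2, h3⟩, h4, h5⟩ => by
      simp only at h1 h2 h3 h4 h5
      obtain ⟨k1, k2⟩ := beladyStep_subset (k a) slots v rest.tail
      have h6 : ∀ x ∈ LaminarPaging.beladyStep (k a) slots v rest.tail,
          esize x ≤ p.eval (esize a) := fun x hx => by
        rcases List.mem_cons.1 (k1 hx) with rfl | hx
        · exact (esize_mem hv).le.trans (hp a)
        · exact h3 x hx
      have h7 := k2.trans (Nat.add_le_add_right h2 1)
      refine ⟨?_, ⟨h7, h6⟩, by simp [h4], fun l hl => ?_⟩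
      · have h8 := esize_headD_add_tail_le rest
        have h9 := esize_pos (rest.headD 0)
        dsimp only
        omega
      · rcases List.mem_append.1 hl with hl | hl
        · refine (h5 l hl).trans (Nat.add_le_add_right (Nat.mul_le_mul_right _ (Nat.le_succ n)) 1)
        · rw [List.mem_singleton.1 hl]
          exact esize_map_succ_le h6 h7)
    ⟨p + (p * (p + 1) + 1) + (p * (p * (p + 3) + 2) + 1) + 2, fun a n ⟨rest, slots, out⟩ hn
        ⟨h1, ⟨h2, h3⟩, h4, h5⟩ => by
      simp only at h1 h2 h3 h4 h5
      have h6 := esize_list_le h3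
      have h7 := esize_list_le h5
      have h8 := length_lt_esize (σ a)
      have h9 : n ≤ p.eval (esize a) := by have := hp a; omega
      have h10 := Nat.mul_le_mul_right (p.eval (esize a) + 1) (h2.trans h9)
      have h11 : n * (n * (p.eval (esize a) + 3) + 1 + 1) ≤
          p.eval (esize a) * (p.eval (esize a) * (p.eval (esize a) + 3) + 2) :=
        Nat.mul_le_mul h9 (by
          have := Nat.mul_le_mul_right (p.eval (esize a) + 3) h9
          omega)
      rw [h4] at h7
      simp only [esize_pair, Polynomial.eval_add, Polynomial.eval_mul, Polynomial.eval_ofNat,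
        Polynomial.eval_one]
      omega⟩
  have key : ∀ (k : ℕ) (σ slots : List ℕ) (out : List (List ℕ)),
      (σ.foldl (fun (acc : List ℕ × List ℕ × List (List ℕ)) v => (acc.1.tail,
        LaminarPaging.beladyStep k acc.2.1 v acc.1.tail,
        acc.2.2 ++ [(LaminarPaging.beladyStep k acc.2.1 v acc.1.tail).map fun x => x + 1]))
        (σ, slots, out)).2.2 =
      out ++ (LaminarPaging.beladyRun k slots σ).map fun l => l.map fun x => x + 1 := by
    intro k σ
    induction σ with
    | nil => intro slots out; simp [LaminarPaging.beladyRun]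
    | cons v σ ih =>
      intro slots out
      rw [List.foldl_cons, List.tail_cons, ih, LaminarPaging.beladyRun]
      simp
  convert this.snd'.snd' using 2 with a
  simpa using (key (k a) (σ a) [] []).symm

/-- The pages that replace the given requests. -/
def derivedPages (rs : List (List ℕ)) : List ℕ :=
  (rs.foldl (fun (acc : History × List ℕ) R =>
    ((R, pageOf acc.1 R) :: acc.1, acc.2 ++ [pageOf acc.1 R])) ([], [])).2

theorem derivedPages_eq (rs : List (Finset ℕ)) :
    derivedPages (rs.map fun R => R.sort (· ≤ ·)) = pageSeq minPage rs := by
  have key : ∀ (rs : List (Finset ℕ)) (hist : History) (out : List ℕ),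
      ((rs.map fun R => R.sort (· ≤ ·)).foldl (fun (acc : History × List ℕ) R =>
        ((R, pageOf acc.1 R) :: acc.1, acc.2 ++ [pageOf acc.1 R])) (hist, out)).2 =
        out ++ pageSeq (repOf hist) rs := by
    intro rs
    induction rs with
    | nil => intro hist out; simp [pageSeq]
    | cons R rs ih =>
      intro hist out
      rw [List.map_cons, List.foldl_cons, pageSeq, ← repOf_push]
      exact (ih (hist.push R) (out ++ [repOf hist R])).trans (by simp)
  exact key rs [] []

/-- Representatives are copied from the history or from the set itself, so their size does not grow
along the sequence. -/
theorem esize_pageOf_le {hist : History} {R : List ℕ} {B : ℕ} (h : ∀ x ∈ hist, esize x.2 ≤ B)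
    (hR : esize R ≤ B) : esize (pageOf hist R) ≤ B := by
  induction hist with
  | nil =>
    have h1 := esize_headD_add_tail_le R
    have h2 := esize_pos R.tail
    rw [pageOf, List.foldr_nil]
    omega
  | cons x hist ih =>
    rw [pageOf, List.foldr_cons]
    split_ifs
    · exact h x (by simp)
    · exact ih fun y hy => h y (by simp [hy])

theorem PolyTime.derivedPages {α : Type} [Enc α] {rs : α → List (List ℕ)} (hrs : PolyTime rs) :
    PolyTime fun a => LaminarPaging.derivedPages (rs a) := by
  obtain ⟨p, hp⟩ := hrs.size_le
  have hv : PolyTime fun z : α × List ℕ × History × List ℕ =>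
      LaminarPaging.pageOf z.2.2.1 z.2.1 := snd.snd'.fst'.pageOf snd.fst'
  have := foldl_of_inv (β := History × List ℕ) (init := fun _ => ([], []))
    (step := fun z : α × List ℕ × History × List ℕ =>
      ((z.2.1, LaminarPaging.pageOf z.2.2.1 z.2.1) :: z.2.2.1,
        z.2.2.2 ++ [LaminarPaging.pageOf z.2.2.1 z.2.1])) hrs (const_nil.pair const_nil)
    ((cons (snd.fst'.pair hv) snd.snd'.fst').pair (append snd.snd'.snd' (singleton hv)))
    (fun a n acc => (acc.1.length = n ∧ ∀ x ∈ acc.1, esize x.1 ≤ p.eval (esize a) ∧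
      esize x.2 ≤ p.eval (esize a)) ∧ acc.2.length = n ∧ ∀ x ∈ acc.2, esize x ≤ p.eval (esize a))
    (fun a => ⟨⟨rfl, by simp⟩, rfl, by simp⟩)
    (fun a R hR n ⟨hist, out⟩ ⟨⟨h1, h2⟩, h3, h4⟩ => by
      simp only at h1 h2 h3 h4
      have h5 := (esize_mem hR).le.trans (hp a)
      have h6 := esize_pageOf_le (fun x hx => (h2 x hx).2) h5
      refine ⟨⟨by simp [h1], fun x hx => ?_⟩, by simp [h3], fun x hx => ?_⟩
      · rcases List.mem_cons.1 hx with rfl | hx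
        · exact ⟨h5, h6⟩
        · exact h2 x hx
      · rcases List.mem_append.1 hx with hx | hx
        · exact h4 x hx
        · rw [List.mem_singleton.1 hx]; exact h6)
    ⟨p * (2 * p + 2) + p * (p + 1) + 3, fun a n ⟨hist, out⟩ hn ⟨⟨h1, h2⟩, h3, h4⟩ => by
      simp only at h1 h2 h3 h4
      have h5 := esize_list_le (l := hist) (B := 2 * p.eval (esize a) + 1) fun x hx => by
        have h := h2 x hx
        have := esize_pair x.1 x.2
        change esize (x.1, x.2) ≤ _
        omega
      have h6 := esize_list_le h4
      have h7 := length_lt_esize (rs a)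
      have h8 : n ≤ p.eval (esize a) := by have := hp a; omega
      have h9 := Nat.mul_le_mul_right (2 * p.eval (esize a) + 1 + 1) h8
      have h10 := Nat.mul_le_mul_right (p.eval (esize a) + 1) h8
      rw [h1] at h5
      rw [h3] at h6
      simp only [esize_pair, Polynomial.eval_add, Polynomial.eval_mul, Polynomial.eval_ofNat,
        Polynomial.eval_one]
      have e : 2 * p.eval (esize a) + 1 + 1 = 2 * p.eval (esize a) + 2 := rfl
      rw [e] at h9 h5
      omega⟩
  exact this.snd'

theorem beladyRun_cost_le {k : ℕ} (σ : List ℕ) (slots : List ℕ) (hs : slots.Nodup) :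
    Cache.costFrom (slotCache k slots) ((beladyRun k slots σ).map (slotCache k)) ≤
      beladyCost k slots σ := by
  induction σ generalizing slots with
  | nil => exact le_rfl
  | cons v σ ih =>
    rw [beladyRun, List.map_cons, Cache.costFrom, beladyCost]
    refine add_le_add ?_ (ih _ (beladyStep_nodup hs))
    unfold beladyStep
    split_ifs
    · rw [retrievals_self]
    · exact retrievals_append k slots v
    · exact retrievals_replace k hs _ v

theorem beladyRun_satisfies {F : Finset (Finset ℕ)} (hF : Laminar F) {k : ℕ} (hk : 0 < k)
    (rs : List (Finset ℕ)) (hrs : ∀ R ∈ rs, R ∈ F) (p : Finset ℕ → ℕ) (hp : Represents F p)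
    (slots : List ℕ) (hs : slots.length ≤ k) :
    List.Forall₂ (fun c R => Cache.Satisfies c R)
      ((beladyRun k slots (pageSeq p rs)).map (slotCache k)) rs := by
  induction rs generalizing p slots with
  | nil => exact List.Forall₂.nil
  | cons R rs ih =>
    have hR := hrs R (by simp)
    have h1 := length_beladyStep_le (v := p R) (rest := pageSeq (redirect p R) rs) hs
    refine List.Forall₂.cons ?_ (ih (fun R' hR' => hrs R' (by simp [hR'])) _
      (hp.redirect hF hR) _ h1)
    obtain ⟨i, hi, h2⟩ := List.mem_iff_getElem.1
      (mem_beladyStep hk (slots := slots) (v := p R) (rest := pageSeq (redirect p R) rs))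
    exact ⟨p R, hp.mem R hR, ⟨i, by omega⟩, by simp [slotCache, hi, h2]⟩

theorem toCaches_enc (k : ℕ) (l : List (List ℕ)) :
    Val.toCaches k (enc (l.map fun W => W.map fun x => x + 1)) = l.map (slotCache k) := by
  rw [Val.toCaches]
  induction l with
  | nil => rfl
  | cons W l ih =>
    rw [List.map_cons, enc_cons, Val.toList, List.map_cons, ih, toCache_enc, List.map_cons]

/-- The derived sequence depends only on the requests, so it can be computed first and then served
optimally. -/
theorem exists_offline : ∃ c : Com, IsOfflineApprox c fun I => (height I.family : ℝ≥0) := by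
  have hf : PolyTime fun z : (List ℕ × List (List ℕ)) × List (List ℕ) =>
      (beladyRun z.1.1.length [] (derivedPages z.2)).map fun l => l.map fun x => x + 1 :=
    PolyTime.beladyRun PolyTime.fst.fst'.length PolyTime.snd.derivedPages
  obtain ⟨c, p, hc, hp⟩ := hf 1
  obtain ⟨q, hq⟩ := exists_assign 1 (.reg 0)
  refine ⟨.seq (.assign 1 (.reg 0)) c, ⟨trivial, hc⟩, q + p + 1, fun I hI o ho => ?_⟩
  have hsz : I.size = esize ((List.range I.k, I.family.map fun R => R.sort (· ≤ ·)),
      I.requests.map fun R => R.sort (· ≤ ·)) := by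
    rw [esize, ← PagingAlgorithm.encode_eq]; rfl
  have h1 := hq (Store.init I.encode) I.size fun i hi => by
    simp only [Exp.regs, List.mem_singleton] at hi
    subst hi
    exact le_rfl
  obtain ⟨s, h2, h3, -⟩ := hp (Function.update (Store.init I.encode) 1
    ((Exp.reg 0).eval (Store.init I.encode))) ((List.range I.k,
      I.family.map fun R => R.sort (· ≤ ·)), I.requests.map fun R => R.sort (· ≤ ·))
    (by simp [Exp.eval, Store.init, PagingAlgorithm.encode_eq])
  rw [← hsz] at h2
  have hN : (q + p + 1).eval I.size = q.eval I.size + p.eval I.size + 1 := by simp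
  have hrun := (h1.seq h2).run_eq (N := (q + p + 1).eval I.size) (by omega)
  rw [runOffline, hrun, PMF.pure_map, PMF.pure_map, PMF.support_pure, Set.mem_singleton_iff] at ho
  simp only [List.length_range, derivedPages_eq] at h3
  rw [Option.map_some, h3, toCaches_enc] at ho
  have hF := I.laminar hI
  refine ⟨_, ho, beladyRun_satisfies hF I.k_pos I.requests
    (fun R hR => by simpa using I.requests_mem R hR) _ (represents_minPage hF) [] (Nat.zero_le _), ?_⟩
  obtain ⟨c, hc, hle⟩ := I.exists_serves hI
  have h4 := beladyRun_cost_le (k := I.k) (pageSeq minPage I.requests) [] (by simp)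
  have h5 : I.cost ((beladyRun I.k [] (pageSeq minPage I.requests)).map (slotCache I.k)) ≤
      height I.family * I.opt := (h4.trans (beladyCost_le I.k_pos hc)).trans hle
  beta_reduce
  exact_mod_cast h5

end LaminarPaging

end

theorem mainTheorem5 :
    (∃ A : LaminarPaging.OnlineAlgorithm, A.Deterministic ∧
      A.IsCompetitive fun I => (LaminarPaging.height I.family : NNReal) * (I.k : NNReal)) ∧
    (∃ A : LaminarPaging.OnlineAlgorithm,
      A.IsCompetitive fun I =>
        (LaminarPaging.height I.family : NNReal) * ∑ i ∈ Finset.Icc 1 I.k, (1 : NNReal) / (i : NNReal)) ∧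
    (∃ c : LaminarPaging.Com,
      LaminarPaging.IsOfflineApprox c fun I => (LaminarPaging.height I.family : NNReal)) :=
  ⟨LaminarPaging.exists_deterministic_online, LaminarPaging.exists_randomized_online,
    LaminarPaging.exists_offline⟩
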